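/- **Conventions.** A $C^*$-category $\mathbf V$ is a (not necessarily unital) category-like structure with Banach spaces $\mathbf V(X,Y)$ of morphisms, bilinear associative composition with $\|gf\|\le\|g\|\|f\|$ and a conjugate linear involution $\mathbf V(X,Y)\to\mathbf V(Y,X)$, $f\mapsto f^*$, with $(gf)^*=f^*g^*$, $\|f^*f\|=\|f\|^2$ and $f^*f\geq 0$ in $\mathbf V(X,X)$. No identity morphisms are required; $M\mathbf V$ denotes the multiplier category. A linear $*$-functor $F:\mathbf V\to\mathbf W$ is *nondegenerate* if $[F(\mathbf V(Y,Y))\mathbf W(FX,FY)]=\mathbf W(FX,FY)=[\mathbf W(FX,FY)F(\mathbf V(X,X))]$ for all $X,Y$, where $[\,\cdot\,]$ is the closed linear span. It is an *equivalence* if there is a nondegenerate linear $*$-functor $G:\mathbf W\to\mathbf V$ such that $GF$ and $FG$ are naturally isomorphic to the identity functors via unitary multiplier morphisms (and $F$ is itself nondegenerate). The *subobject completion* of $\mathbf V$ has as objects the pairs $(X,p)$ with $p\in M\mathbf V(X,X)$ a projection, and morphisms $q\mathbf V(X,Y)p$ from $(X,p)$ to $(Y,q)$. Let $A$ be a $C^*$-algebra.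 $\mathrm{Hilb}_A$ is the $C^*$-category whose objects are the right Hilbert $A$-modules isomorphic to direct summands of the standard module $\mathbb H_A=\bigoplus_{n=1}^\infty A$, and whose morphisms are the compact operators, i.e. the norm limits of linear combinations of the operators $\zeta\mapsto\eta\langle\xi,\zeta\rangle$. Let $\mathbf V_1,\mathbf V_2$ be $C^*$-categories and let $\mathbf V_1\boxdot\mathbf V_2$ be the $*$-category with objects the pairs $(X_1,X_2)$ and morphism spaces the algebraic tensor products $\mathbf V_1(X_1,Y_1)\odot\mathbf V_2(X_2,Y_2)$. A *realisation* of a $C^*$-category is a faithful nondegenerate linear $*$-functor from it to Hilbert spaces and bounded operators. The minimal norm on the morphism spaces of $\mathbf V_1\boxdot\mathbf V_2$ is $\|f\|_{\min}=\|(\iota_1\otimes\iota_2)(f)\|$, where $\iota_1,\iota_2$ are realisations of $\mathbf V_1,\mathbf V_2$ and $\iota_1\otimes\iota_2$ acts on the Hilbert space tensor products; the maximal norm $\|f\|_{\max}$ is the supremum of $\|\pi(f)\|$ over all nondegenerate linear $*$-functors $\pi$ from $\mathbf V_1\boxdot\mathbf V_2$ to Hilbert spaces and bounded operators. Let $\mathbf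 V_1\boxtimes_{\min}\mathbf V_2$ and $\mathbf V_1\boxtimes_{\max}\mathbf V_2$ be the subobject completions of the respective completions of $\mathbf V_1\boxdot\mathbf V_2$, and write $X_1\boxtimes X_2$ and $f_1\boxtimes f_2$ for the images of $(X_1,X_2)$ and $f_1\otimes f_2$. For $C^*$-algebras, viewed as $C^*$-categories with one object, the completions of $A\odot B$ in these two norms are $A\otimes_{\min}B$ and $A\otimes_{\max}B$. **Proposition.** Let $A$ and $B$ be $C^*$-algebras. Then there are equivalences of $C^*$-categories $$\mathrm{Hilb}_A\boxtimes_{\min}\mathrm{Hilb}_B\simeq\mathrm{Hilb}_{A\otimes_{\min}B},\qquad \mathrm{Hilb}_A\boxtimes_{\max}\mathrm{Hilb}_B\simeq\mathrm{Hilb}_{A\otimes_{\max}B},$$ the first one for every choice of realisations of $\mathrm{Hilb}_A$, $\mathrm{Hilb}_B$, $A$ and $B$ in the definition of the minimal norms. These equivalences are induced by exterior tensor products of Hilbert modules in the following sense. For $E\in\mathrm{Hilb}_A$ and $F\in\mathrm{Hilb}_B$ the equivalence maps $E\boxtimes F$ to the exterior tensor product $E\otimes F$, that is, to the completion of $E\odot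 F$ with respect to the inner product $$\langle\xi\otimes\eta,\zeta\otimes\kappa\rangle=\langle\xi,\zeta\rangle\otimes\langle\eta,\kappa\rangle$$ with values in $A\otimes_{\min}B$ and $A\otimes_{\max}B$, respectively; and for compact operators $S:E\to E'$ and $T:F\to F'$ it maps $S\boxtimes T$ to the operator $\xi\otimes\eta\mapsto S\xi\otimes T\eta$. -/

import Mathlib

open scoped TensorProduct InnerProductSpace

universe u v u₁ v₁ u₂ v₂ w w₁ w₂ w₃ w₄

noncomputable section

set_option linter.checkUnivs false

namespace CStarTensor

/-! ## `*`-categories and `C*`-categories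

Following the usual convention for non-unital `C*`-categories, categories are semicategories:
they need not contain identity morphisms. The composition `g ∘ f` is written
`comp g f` and the adjoint `f*` is written `adj f`. -/

/-- A (complex) `*`-category. -/
structure StarCat where
  Obj : Type u
  Hom : Obj → Obj → Type v
  [addCommGroup : ∀ X Y, AddCommGroup (Hom X Y)]
  [module : ∀ X Y, Module ℂ (Hom X Y)]
  comp : ∀ {X Y Z : Obj}, Hom Y Z →ₗ[ℂ] Hom X Y →ₗ[ℂ] Hom X Z
  assoc : ∀ {W X Y Z : Obj} (h : Hom Y Z) (g : Hom X Y) (f : Hom W X),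
    comp (comp h g) f = comp h (comp g f)
  adj : ∀ {X Y : Obj}, Hom X Y →ₗ⋆[ℂ] Hom Y X
  adj_adj : ∀ {X Y : Obj} (f : Hom X Y), adj (adj f) = f
  adj_comp : ∀ {X Y Z : Obj} (g : Hom Y Z) (f : Hom X Y),
    adj (comp g f) = comp (adj f) (adj g)

attribute [instance] StarCat.addCommGroup StarCat.module

/-- A `*`-category whose morphism spaces are Banach spaces, with submultiplicative norm satisfying
the `C*`-identity. -/
structure BanachStarCat where
  Obj : Type u
  Hom : Obj → Obj → Type v
  [normed : ∀ X Y, NormedAddCommGroup (Hom X Y)]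
  [normedSpace : ∀ X Y, NormedSpace ℂ (Hom X Y)]
  [complete : ∀ X Y, CompleteSpace (Hom X Y)]
  comp : ∀ {X Y Z : Obj}, Hom Y Z →ₗ[ℂ] Hom X Y →ₗ[ℂ] Hom X Z
  assoc : ∀ {W X Y Z : Obj} (h : Hom Y Z) (g : Hom X Y) (f : Hom W X),
    comp (comp h g) f = comp h (comp g f)
  adj : ∀ {X Y : Obj}, Hom X Y →ₗ⋆[ℂ] Hom Y X
  adj_adj : ∀ {X Y : Obj} (f : Hom X Y), adj (adj f) = f
  adj_comp : ∀ {X Y Z : Obj} (g : Hom Y Z) (f : Hom X Y),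
    adj (comp g f) = comp (adj f) (adj g)
  norm_comp_le : ∀ {X Y Z : Obj} (g : Hom Y Z) (f : Hom X Y), ‖comp g f‖ ≤ ‖g‖ * ‖f‖
  norm_adj_comp_self : ∀ {X Y : Obj} (f : Hom X Y), ‖comp (adj f) f‖ = ‖f‖ * ‖f‖

attribute [instance] BanachStarCat.normed BanachStarCat.normedSpace BanachStarCat.complete

/-- A `C*`-category: moreover `f* ∘ f` is a positive element of the endomorphism algebra of the
source of `f`, that is, of the form `g* ∘ g` for an endomorphism `g`. -/
structure CStarCat extends BanachStarCat.{u, v} where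
  pos : ∀ {X Y : Obj} (f : Hom X Y), ∃ g : Hom X X, comp (adj f) f = comp (adj g) g

/-- The `*`-category underlying a `C*`-category. -/
@[reducible] def CStarCat.toStarCat (V : CStarCat.{u, v}) : StarCat.{u, v} where
  Obj := V.Obj
  Hom := V.Hom
  comp := V.comp
  assoc := V.assoc
  adj := V.adj
  adj_adj := V.adj_adj
  adj_comp := V.adj_comp

/-- The endomorphism algebra `V(X, X)`. -/
def BanachStarCat.End (V : BanachStarCat.{u, v}) (X : V.Obj) : Type v := V.Hom X X

instance BanachStarCat.instEndNormed (V : BanachStarCat.{u, v}) (X : V.Obj) :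
    NormedAddCommGroup (V.End X) := V.normed X X

/-- `V(X, X)` is a `C*`-algebra, with multiplication the composition. -/
instance BanachStarCat.instEnd (V : BanachStarCat.{u, v}) (X : V.Obj) :
    NonUnitalCStarAlgebra (V.End X) where
  __ := V.instEndNormed X
  mul f g := V.comp f g
  left_distrib f g h := (V.comp f).map_add g h
  right_distrib f g h := V.comp.map_add₂ f g h
  zero_mul f := V.comp.map_zero₂ f
  mul_zero f := (V.comp f).map_zero
  mul_assoc f g h := V.assoc f g h
  norm_mul_le f g := V.norm_comp_le f g
  star f := V.adj f
  star_involutive f := V.adj_adj f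
  star_mul f g := V.adj_comp f g
  star_add f g := map_add V.adj f g
  norm_mul_self_le f := (V.norm_adj_comp_self f).symm.le
  complete := (V.complete X X).complete
  toModule := (V.normedSpace X X).toModule
  norm_smul_le := (V.normedSpace X X).norm_smul_le
  smul_assoc c f g := V.comp.map_smul₂ c f g
  smul_comm c f g := ((V.comp f).map_smul c g).symm
  star_smul c f := V.adj.map_smulₛₗ c f

namespace BanachStarCat

variable (V : BanachStarCat.{u, v})

lemma norm_adj {X Y : V.Obj} (f : V.Hom X Y) : ‖V.adj f‖ = ‖f‖ := by
  have key : ∀ {X Y : V.Obj} (f : V.Hom X Y), ‖f‖ ≤ ‖V.adj f‖ := by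
    intro X Y f
    rcases (norm_nonneg f).eq_or_lt with h | h
    · rw [← h]; exact norm_nonneg _
    · have h1 := V.norm_adj_comp_self f
      have h2 := V.norm_comp_le (V.adj f) f
      rw [h1] at h2
      exact le_of_mul_le_mul_right h2 h
  refine le_antisymm ?_ (key f)
  simpa only [V.adj_adj] using key (V.adj f)

/-- A criterion for the positivity axiom. -/
lemma pos_of_aniso (hV : ∀ {X Y : V.Obj} (f : V.Hom X Y) (g : V.Hom X X),
      V.comp (V.adj f) f + V.comp (V.adj g) g = 0 → g = 0) {X Y : V.Obj} (f : V.Hom X Y) :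
    ∃ g : V.Hom X X, V.comp (V.adj f) f = V.comp (V.adj g) g := by
  let _ := CStarAlgebra.spectralOrder (V.End X)
  have _ := CStarAlgebra.spectralOrderedRing (V.End X)
  let a : V.End X := V.comp (V.adj f) f
  have ha : IsSelfAdjoint a := by
    change V.adj (V.comp (V.adj f) f) = V.comp (V.adj f) f
    rw [V.adj_comp, V.adj_adj]
  -- `b = a⁻` satisfies `b a b = - b³`
  let b : V.End X := a⁻
  have hb : 0 ≤ b := CFC.negPart_nonneg a
  have hbs : star b = b := hb.isSelfAdjoint
  have hab : b * a * b = - (b * b * b) := by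
    have h1 : a⁺ * a⁻ = 0 := CFC.posPart_mul_negPart a
    have h2 : a⁻ * a⁺ = 0 := CFC.negPart_mul_posPart a
    have h3 : a⁺ - a⁻ = a := CFC.posPart_sub_negPart a ha
    calc b * a * b = a⁻ * (a⁺ - a⁻) * a⁻ := by rw [h3]
      _ = -(a⁻ * a⁻ * a⁻) := by rw [mul_sub, h2, zero_sub, neg_mul]
  have hb3 : 0 ≤ b * b * b := by
    have := star_left_conjugate_nonneg hb b
    rwa [hbs] at this
  obtain ⟨g, hg⟩ := CStarAlgebra.nonneg_iff_eq_star_mul_self.mp hb3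
  have e1 : ∀ c : V.Hom X X, V.comp (V.adj (V.comp f c)) (V.comp f c) =
      V.comp (V.comp (V.adj c) (V.comp (V.adj f) f)) c := by
    intro c
    rw [V.adj_comp]
    simp only [V.assoc]
  have e2 : star b * a * b + star g * g = 0 := by
    rw [← hg, hbs, hab]
    exact neg_add_cancel (b * b * b)
  have hsum : V.comp (V.adj (V.comp f b)) (V.comp f b) + V.comp (V.adj g) g = 0 :=
    (congrArg (· + V.comp (V.adj g) g) (e1 b)).trans e2
  have hg0 : g = 0 := hV _ _ hsum
  have hb30 : b * b * b = 0 := by rw [hg, hg0, mul_zero]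
  have hb0 : b = 0 := by
    have h4 : star (b * b) * (b * b) = 0 := by
      rw [star_mul, hbs, ← mul_assoc, hb30, zero_mul]
    have h5 : b * b = 0 := (CStarRing.star_mul_self_eq_zero_iff _).mp h4
    have h6 : star b * b = 0 := by rw [hbs, h5]
    exact (CStarRing.star_mul_self_eq_zero_iff _).mp h6
  have hapos : 0 ≤ a := by
    have h3 : a⁺ - a⁻ = a := CFC.posPart_sub_negPart a ha
    rw [← h3, show a⁻ = 0 from hb0, sub_zero]
    exact CFC.posPart_nonneg a
  obtain ⟨g', hg'⟩ := CStarAlgebra.nonneg_iff_eq_star_mul_self.mp hapos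
  exact ⟨g', hg'⟩

end BanachStarCat

/-- In a `C*`-category a sum of positive elements vanishes only if each summand does. -/
lemma CStarCat.aniso (V : CStarCat.{u, v}) {X Y : V.Obj} (f : V.Hom X Y) (g : V.Hom X X)
    (h : V.comp (V.adj f) f + V.comp (V.adj g) g = 0) : g = 0 := by
  obtain ⟨k, hk⟩ := V.pos f
  let _ := CStarAlgebra.spectralOrder (V.End X)
  have _ := CStarAlgebra.spectralOrderedRing (V.End X)
  let k' : V.End X := k
  let g' : V.End X := g
  have h1 : star k' * k' + star g' * g' = 0 := by
    rw [hk] at h; exact h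
  have h2 : star g' * g' ≤ 0 := by
    rw [← h1]; exact le_add_of_nonneg_left (star_mul_self_nonneg k')
  have h3 := le_antisymm h2 (star_mul_self_nonneg g')
  exact (CStarRing.star_mul_self_eq_zero_iff g').mp h3

/-- A `C*`-algebra, viewed as a `C*`-category with one object. -/
def ofAlgebra (A : Type v) [NonUnitalCStarAlgebra A] : CStarCat.{0, v} where
  Obj := Unit
  Hom _ _ := A
  comp := LinearMap.mul ℂ A
  assoc h g f := mul_assoc h g f
  adj := (starLinearEquiv ℂ (A := A)).toLinearMap
  adj_adj f := star_star f
  adj_comp g f := star_mul g f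
  norm_comp_le g f := norm_mul_le g f
  norm_adj_comp_self _ := CStarRing.norm_star_mul_self
  pos f := ⟨f, rfl⟩

/-! ## Multiplier morphisms -/

/-- A multiplier morphism `X → Y` in a `C*`-category: a pair of a left multiplier `L`
(`L Z h` plays the role of `M ∘ h`) and a right multiplier `R` (`R Z g` plays the role
of `g ∘ M`). -/
@[ext]
structure Multiplier (V : CStarCat.{u, v}) (X Y : V.Obj) where
  L : ∀ Z, V.Hom Z X →ₗ[ℂ] V.Hom Z Y
  R : ∀ Z, V.Hom Y Z →ₗ[ℂ] V.Hom X Z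
  bound_L : ∃ C : ℝ, ∀ Z (h : V.Hom Z X), ‖L Z h‖ ≤ C * ‖h‖
  bound_R : ∃ C : ℝ, ∀ Z (g : V.Hom Y Z), ‖R Z g‖ ≤ C * ‖g‖
  L_comp : ∀ {W Z} (h : V.Hom Z X) (g : V.Hom W Z), L W (V.comp h g) = V.comp (L Z h) g
  R_comp : ∀ {W Z} (f : V.Hom W Z) (h : V.Hom Y W), R Z (V.comp f h) = V.comp f (R W h)
  compat : ∀ {W Z} (f : V.Hom W X) (g : V.Hom Y Z), V.comp g (L W f) = V.comp (R Z g) f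

namespace Multiplier

variable {V : CStarCat.{u, v}}

/-- The identity multiplier. -/
protected def id (V : CStarCat.{u, v}) (X : V.Obj) : Multiplier V X X where
  L _ := LinearMap.id
  R _ := LinearMap.id
  bound_L := ⟨1, fun _ _ => by simp⟩
  bound_R := ⟨1, fun _ _ => by simp⟩
  L_comp _ _ := rfl
  R_comp _ _ := rfl
  compat _ _ := rfl

/-- Composition `G ∘ F` of multiplier morphisms. -/
protected def comp {X Y Z : V.Obj} (G : Multiplier V Y Z) (F : Multiplier V X Y) :
    Multiplier V X Z where
  L W := G.L W ∘ₗ F.L W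
  R W := F.R W ∘ₗ G.R W
  bound_L := by
    obtain ⟨C, hC⟩ := G.bound_L
    obtain ⟨D, hD⟩ := F.bound_L
    refine ⟨|C| * D, fun W h => (hC W _).trans ?_⟩
    calc C * ‖F.L W h‖ ≤ |C| * ‖F.L W h‖ := by gcongr; exact le_abs_self C
      _ ≤ |C| * (D * ‖h‖) := by gcongr; exact hD W h
      _ = |C| * D * ‖h‖ := by ring
  bound_R := by
    obtain ⟨C, hC⟩ := F.bound_R
    obtain ⟨D, hD⟩ := G.bound_R
    refine ⟨|C| * D, fun W h => (hC W _).trans ?_⟩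
    calc C * ‖G.R W h‖ ≤ |C| * ‖G.R W h‖ := by gcongr; exact le_abs_self C
      _ ≤ |C| * (D * ‖h‖) := by gcongr; exact hD W h
      _ = |C| * D * ‖h‖ := by ring
  L_comp h g := by simp only [LinearMap.comp_apply, F.L_comp, G.L_comp]
  R_comp f h := by simp only [LinearMap.comp_apply, F.R_comp, G.R_comp]
  compat f g := by simp only [LinearMap.comp_apply, G.compat, F.compat]

/-- The adjoint of a multiplier morphism: `L_{F*}(f) = R_F(f*)*` and `R_{F*}(f) = L_F(f*)*`. -/
protected def adj {X Y : V.Obj} (F : Multiplier V X Y) : Multiplier V Y X where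
  L W := V.adj ∘ₛₗ (F.R W) ∘ₛₗ V.adj
  R W := V.adj ∘ₛₗ (F.L W) ∘ₛₗ V.adj
  bound_L := by
    obtain ⟨C, hC⟩ := F.bound_R
    refine ⟨C, fun W h => ?_⟩
    have := hC W (V.adj h)
    rw [V.norm_adj] at this
    simpa only [LinearMap.comp_apply, V.norm_adj] using this
  bound_R := by
    obtain ⟨C, hC⟩ := F.bound_L
    refine ⟨C, fun W h => ?_⟩
    have := hC W (V.adj h)
    rw [V.norm_adj] at this
    simpa only [LinearMap.comp_apply, V.norm_adj] using this
  L_comp h g := by simp only [LinearMap.comp_apply, V.adj_comp, F.R_comp, V.adj_adj]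
  R_comp h g := by simp only [LinearMap.comp_apply, V.adj_comp, F.L_comp, V.adj_adj]
  compat f g := by
    have := congrArg V.adj (F.compat (V.adj g) (V.adj f))
    simpa only [LinearMap.comp_apply, V.adj_comp, V.adj_adj] using this.symm

/-- Unitary multiplier morphisms. -/
def IsUnitary {X Y : V.Obj} (F : Multiplier V X Y) : Prop :=
  F.adj.comp F = Multiplier.id V X ∧ F.comp F.adj = Multiplier.id V Y

/-- Projections in the multiplier algebra of an object. -/
def IsProjection {X : V.Obj} (p : Multiplier V X X) : Prop :=
  p.comp p = p ∧ p.adj = p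

lemma isProjection_id (X : V.Obj) : (Multiplier.id V X).IsProjection := by
  refine ⟨rfl, ?_⟩
  ext W f
  · exact V.adj_adj f
  · exact V.adj_adj f

end Multiplier

/-! ## The subobject completion -/

/-- The morphisms `(X, p) → (Y, q)` in the subobject completion: those `h : X → Y` such that
`h ∘ p = h = q ∘ h`. -/
def splitHom (V : CStarCat.{u, v}) {X Y : V.Obj} (p : Multiplier V X X) (q : Multiplier V Y Y) :
    Submodule ℂ (V.Hom X Y) where
  carrier := {h | p.R Y h = h ∧ q.L X h = h}
  add_mem' := fun ha hb => ⟨by rw [map_add, ha.1, hb.1], by rw [map_add, ha.2, hb.2]⟩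
  zero_mem' := ⟨map_zero _, map_zero _⟩
  smul_mem' := fun c _ ha => ⟨by rw [map_smul, ha.1], by rw [map_smul, ha.2]⟩

lemma isClosed_splitHom (V : CStarCat.{u, v}) {X Y : V.Obj} (p : Multiplier V X X)
    (q : Multiplier V Y Y) : IsClosed (splitHom V p q : Set (V.Hom X Y)) := by
  obtain ⟨C, hC⟩ := p.bound_R
  obtain ⟨D, hD⟩ := q.bound_L
  have h1 : Continuous (p.R Y) := ((p.R Y).mkContinuous C (hC Y)).continuous
  have h2 : Continuous (q.L X) := ((q.L X).mkContinuous D (hD X)).continuous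
  exact (isClosed_eq h1 continuous_id).inter (isClosed_eq h2 continuous_id)

/-- The subobject completion `Split(V)`: objects are pairs `(X, p)` with `p` a projection
in the multiplier algebra `MV(X, X)`. -/
def split (V : CStarCat.{u, v}) : CStarCat.{max u v, v} :=
  let B : BanachStarCat.{max u v, v} :=
    { Obj := Σ X : V.Obj, {p : Multiplier V X X // p.IsProjection}
      Hom := fun X Y => splitHom V X.2.1 Y.2.1
      complete := fun X Y => (isClosed_splitHom V X.2.1 Y.2.1).completeSpace_coe
      comp := fun {X Y Z} => LinearMap.mk₂ ℂ
        (fun g f => ⟨V.comp g.1 f.1, by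
          rw [X.2.1.R_comp, f.2.1], by rw [Z.2.1.L_comp, g.2.2]⟩)
        (fun g g' f => Subtype.ext (V.comp.map_add₂ g.1 g'.1 f.1))
        (fun c g f => Subtype.ext (V.comp.map_smul₂ c g.1 f.1))
        (fun g f f' => Subtype.ext ((V.comp g.1).map_add f.1 f'.1))
        (fun c g f => Subtype.ext ((V.comp g.1).map_smul c f.1))
      assoc := fun h g f => Subtype.ext (V.assoc h.1 g.1 f.1)
      adj := fun {X Y} =>
        { toFun := fun f => ⟨V.adj f.1, by
            have h1 := congrArg (fun m => m.R X.1 (V.adj f.1)) Y.2.2.2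
            have h2 := f.2.2
            simp only [Multiplier.adj, LinearMap.comp_apply, V.adj_adj] at h1
            rw [h2] at h1
            exact h1.symm, by
            have h1 := congrArg (fun m => m.L Y.1 (V.adj f.1)) X.2.2.2
            have h2 := f.2.1
            simp only [Multiplier.adj, LinearMap.comp_apply, V.adj_adj] at h1
            rw [h2] at h1
            exact h1.symm⟩
          map_add' := fun f g => Subtype.ext (V.adj.map_add f.1 g.1)
          map_smul' := fun c f => Subtype.ext (V.adj.map_smulₛₗ c f.1) }
      adj_adj := fun f => Subtype.ext (V.adj_adj f.1)
      adj_comp := fun g f => Subtype.ext (V.adj_comp g.1 f.1)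
      norm_comp_le := fun g f => V.norm_comp_le g.1 f.1
      norm_adj_comp_self := fun f => V.norm_adj_comp_self f.1 }
  { B with
    pos := B.pos_of_aniso fun f g h =>
      Subtype.ext (V.aniso f.1 g.1 (congrArg Subtype.val h)) }

/-! ## Functors, natural isomorphisms and equivalences -/

/-- A linear `*`-functor between `C*`-categories. -/
structure StarFunctor (V : CStarCat.{u₁, v₁}) (W : CStarCat.{u₂, v₂}) where
  obj : V.Obj → W.Obj
  map : ∀ {X Y : V.Obj}, V.Hom X Y →ₗ[ℂ] W.Hom (obj X) (obj Y)
  map_comp : ∀ {X Y Z : V.Obj} (g : V.Hom Y Z) (f : V.Hom X Y),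
    map (V.comp g f) = W.comp (map g) (map f)
  map_adj : ∀ {X Y : V.Obj} (f : V.Hom X Y), map (V.adj f) = W.adj (map f)

namespace StarFunctor

variable {V : CStarCat.{u₁, v₁}} {W : CStarCat.{u₂, v₂}}

/-- Nondegeneracy of a linear `*`-functor:
`[F(V(Y,Y)) ∘ W(FX, FY)] = W(FX, FY) = [W(FX, FY) ∘ F(V(X,X))]`. -/
def Nondegenerate (F : StarFunctor V W) : Prop :=
  ∀ X Y : V.Obj,
    (Submodule.span ℂ {k : W.Hom (F.obj X) (F.obj Y) |
      ∃ (e : V.Hom Y Y) (h : W.Hom (F.obj X) (F.obj Y)),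
        k = W.comp (F.map e) h}).topologicalClosure = ⊤ ∧
    (Submodule.span ℂ {k : W.Hom (F.obj X) (F.obj Y) |
      ∃ (h : W.Hom (F.obj X) (F.obj Y)) (e : V.Hom X X),
        k = W.comp h (F.map e)}).topologicalClosure = ⊤

/-- The identity functor. -/
protected def id (V : CStarCat.{u₁, v₁}) : StarFunctor V V where
  obj X := X
  map := LinearMap.id
  map_comp _ _ := rfl
  map_adj _ := rfl

/-- Composition of functors. -/
protected def comp {U : CStarCat.{u, v}} (G : StarFunctor W U) (F : StarFunctor V W) :
    StarFunctor V U where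
  obj X := G.obj (F.obj X)
  map := G.map ∘ₗ F.map
  map_comp g f := by simp only [LinearMap.comp_apply, F.map_comp, G.map_comp]
  map_adj f := by simp only [LinearMap.comp_apply, F.map_adj, G.map_adj]

/-- There is a unitary natural isomorphism `F ≅ G`: a family of unitary multiplier morphisms
`τ X : F X → G X` with `τ Y ∘ F f = G f ∘ τ X`. (Such a family is automatically uniformly
bounded by `1`.) -/
def UnitarilyIso (F G : StarFunctor V W) : Prop :=
  ∃ τ : ∀ X : V.Obj, Multiplier W (F.obj X) (G.obj X),
    (∀ X, (τ X).IsUnitary) ∧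
    ∀ (X Y : V.Obj) (f : V.Hom X Y), (τ Y).L _ (F.map f) = (τ X).R _ (G.map f)

/-- `F` is an equivalence of `C*`-categories: it is a nondegenerate linear `*`-functor, and there
is a nondegenerate linear `*`-functor in the opposite direction such that both composites are
(unitarily) naturally isomorphic to the identity functors, via multiplier morphisms. -/
def IsEquivalence (F : StarFunctor V W) : Prop :=
  F.Nondegenerate ∧ ∃ G : StarFunctor W V, G.Nondegenerate ∧
    (G.comp F).UnitarilyIso (StarFunctor.id V) ∧ (F.comp G).UnitarilyIso (StarFunctor.id W)

end StarFunctor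

/-! ## Representations on Hilbert spaces and completions of `*`-categories -/

/-- A linear `*`-functor from a `*`-category to the category of Hilbert spaces and bounded linear
operators (the multiplier category of the category of Hilbert spaces and compact operators). -/
structure Rep (V : StarCat.{u, v}) where
  H : V.Obj → Type w
  [normed : ∀ X, NormedAddCommGroup (H X)]
  [inner : ∀ X, InnerProductSpace ℂ (H X)]
  [complete : ∀ X, CompleteSpace (H X)]
  map : ∀ {X Y : V.Obj}, V.Hom X Y →ₗ[ℂ] (H X →L[ℂ] H Y)
  map_comp : ∀ {X Y Z : V.Obj} (g : V.Hom Y Z) (f : V.Hom X Y),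
    map (V.comp g f) = (map g).comp (map f)
  map_adj : ∀ {X Y : V.Obj} (f : V.Hom X Y), map (V.adj f) = (map f).adjoint

attribute [instance] Rep.normed Rep.inner Rep.complete

/-- Nondegeneracy of a representation: `[π(V(X, X)) H_X] = H_X` for all objects `X`. (This is the
same as `[π(V(Y,Y)) ∘ K(H_X,H_Y)] = K(H_X,H_Y) = [K(H_X,H_Y) ∘ π(V(X,X))]` for the spaces
`K(H_X,H_Y)` of compact operators.) -/
def Rep.Nondegenerate {V : StarCat.{u, v}} (π : Rep.{u, v, w} V) : Prop :=
  ∀ X : V.Obj, (Submodule.span ℂ {ξ : π.H X | ∃ (e : V.Hom X X) (η : π.H X),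
    ξ = π.map e η}).topologicalClosure = ⊤

/-- A realisation of a `C*`-category: a faithful nondegenerate representation on Hilbert spaces.
(Injectivity on objects, which can always be arranged, is not required.) -/
structure Realisation (V : CStarCat.{u, v}) extends Rep.{u, v, w} V.toStarCat where
  nondegenerate : toRep.Nondegenerate
  faithful : ∀ X Y : V.Obj, Function.Injective (toRep.map (X := X) (Y := Y))

/-- A seminorm on a `*`-category for which the completion is a `C*`-category. -/
structure CStarSeminorm (V : StarCat.{u, v}) where
  N : ∀ {X Y : V.Obj}, Seminorm ℂ (V.Hom X Y)
  comp_le : ∀ {X Y Z : V.Obj} (g : V.Hom Y Z) (f : V.Hom X Y), N (V.comp g f) ≤ N g * N f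
  adj_comp_self : ∀ {X Y : V.Obj} (f : V.Hom X Y), N (V.comp (V.adj f) f) = N f * N f
  le_add : ∀ {X Y : V.Obj} (f : V.Hom X Y) (g : V.Hom X X),
    N g * N g ≤ N (V.comp (V.adj f) f + V.comp (V.adj g) g)

namespace CStarSeminorm

variable {V : StarCat.{u, v}} (N : CStarSeminorm V)

lemma N_adj {X Y : V.Obj} (f : V.Hom X Y) : N.N (V.adj f) = N.N f := by
  have key : ∀ {X Y : V.Obj} (f : V.Hom X Y), N.N f ≤ N.N (V.adj f) := by
    intro X Y f
    rcases (apply_nonneg N.N f).eq_or_lt with h | h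
    · rw [← h]; exact apply_nonneg _ _
    · have h2 := N.comp_le (V.adj f) f
      rw [N.adj_comp_self f] at h2
      exact le_of_mul_le_mul_right h2 h
  refine le_antisymm ?_ (key f)
  simpa only [V.adj_adj] using key (V.adj f)

/-- The morphism space `V(X, Y)`, equipped with the seminorm `N`. -/
def SHom (_ : CStarSeminorm V) (X Y : V.Obj) : Type v := V.Hom X Y

instance (X Y : V.Obj) : SeminormedAddCommGroup (N.SHom X Y) :=
  AddGroupSeminorm.toSeminormedAddCommGroup (E := V.Hom X Y) N.N.toAddGroupSeminorm

instance (X Y : V.Obj) : NormedSpace ℂ (N.SHom X Y) where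
  toModule := V.module X Y
  norm_smul_le c f := (map_smul_eq_mul N.N c f).le

/-- The completion of `V(X, Y)` with respect to `N`. -/
abbrev CHom (X Y : V.Obj) : Type v := UniformSpace.Completion (N.SHom X Y)

/-- The canonical map from `V(X, Y)` to its completion. -/
def ι {X Y : V.Obj} : V.Hom X Y →ₗ[ℂ] N.CHom X Y :=
  (UniformSpace.Completion.toComplL (𝕜 := ℂ) (E := N.SHom X Y)).toLinearMap

lemma norm_ι {X Y : V.Obj} (f : V.Hom X Y) : ‖N.ι f‖ = N.N f :=
  UniformSpace.Completion.norm_coe (E := N.SHom X Y) f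

/-- The composition as a bounded bilinear map into the completion. -/
def sComp {X Y Z : V.Obj} : N.SHom X Y →L[ℂ] N.SHom Y Z →L[ℂ] N.CHom X Z :=
  let B : N.SHom X Y →ₗ[ℂ] N.SHom Y Z →ₗ[ℂ] N.CHom X Z :=
    ((V.comp (X := X) (Y := Y) (Z := Z)).compr₂ N.ι).flip
  B.mkContinuous₂ 1 (fun f g => by
    rw [one_mul, mul_comm]
    exact (N.norm_ι (V.comp g f)).trans_le (N.comp_le g f))

/-- Extension of the composition to the completions. -/
def cComp {X Y Z : V.Obj} : N.CHom Y Z →L[ℂ] N.CHom X Y →L[ℂ] N.CHom X Z :=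
  (N.sComp (X := X) (Y := Y) (Z := Z)).fromCompletion.flip.fromCompletion

@[simp] lemma cComp_ι {X Y Z : V.Obj} (g : V.Hom Y Z) (f : V.Hom X Y) :
    N.cComp (N.ι g) (N.ι f) = N.ι (V.comp g f) := by
  have h : ∀ (x : N.SHom Y Z) (y : N.SHom X Y),
      N.cComp (x : N.CHom Y Z) (y : N.CHom X Y) = N.sComp y x := by
    intro x y
    rw [cComp, ContinuousLinearMap.fromCompletion_apply_coe, ContinuousLinearMap.flip_apply,
      ContinuousLinearMap.fromCompletion_apply_coe]
  exact h g f

/-- Extension of the involution to the completions. -/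
def cAdj {X Y : V.Obj} : N.CHom X Y →L⋆[ℂ] N.CHom Y X :=
  let S : N.SHom X Y →L⋆[ℂ] N.SHom Y X :=
    LinearMap.mkContinuous (E := N.SHom X Y) (F := N.SHom Y X) (V.adj (X := X) (Y := Y)) 1
      (fun f => (N.N_adj f).le.trans (one_mul _).symm.le)
  S.completion

@[simp] lemma cAdj_ι {X Y : V.Obj} (f : V.Hom X Y) : N.cAdj (N.ι f) = N.ι (V.adj f) :=
  ContinuousLinearMap.completion_apply_coe (α := N.SHom X Y) (β := N.SHom Y X) _ f

lemma induction {X Y : V.Obj} {p : N.CHom X Y → Prop} (hc : IsClosed {a | p a})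
    (h : ∀ f : V.Hom X Y, p (N.ι f)) (a : N.CHom X Y) : p a :=
  UniformSpace.Completion.induction_on a hc h

/-- The `C*`-category obtained by completing the morphism spaces of `V` with respect to `N`. -/
def completion : CStarCat.{u, v} :=
  let B : BanachStarCat.{u, v} :=
    { Obj := V.Obj
      Hom := N.CHom
      comp := fun {X Y Z} => (N.cComp (X := X) (Y := Y) (Z := Z)).toLinearMap₁₂
      assoc := fun {W X Y Z} h g f => by
        change N.cComp (N.cComp h g) f = N.cComp h (N.cComp g f)
        induction h using N.induction with
        | hc => exact isClosed_eq (by fun_prop) (by fun_prop)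
        | h h =>
          induction g using N.induction with
          | hc => exact isClosed_eq (by fun_prop) (by fun_prop)
          | h g =>
            induction f using N.induction with
            | hc => exact isClosed_eq (by fun_prop) (by fun_prop)
            | h f => simp only [cComp_ι, V.assoc]
      adj := N.cAdj.toLinearMap
      adj_adj := fun f => by
        change N.cAdj (N.cAdj f) = f
        induction f using N.induction with
        | hc => exact isClosed_eq (by fun_prop) (by fun_prop)
        | h f => simp only [cAdj_ι, V.adj_adj]
      adj_comp := fun g f => by
        change N.cAdj (N.cComp g f) = N.cComp (N.cAdj f) (N.cAdj g)
        induction g using N.induction with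
        | hc => exact isClosed_eq (by fun_prop) (by fun_prop)
        | h g =>
          induction f using N.induction with
          | hc => exact isClosed_eq (by fun_prop) (by fun_prop)
          | h f => simp only [cAdj_ι, cComp_ι, V.adj_comp]
      norm_comp_le := fun g f => by
        change ‖N.cComp g f‖ ≤ _
        induction g using N.induction with
        | hc => exact isClosed_le (by fun_prop) (by fun_prop)
        | h g =>
          induction f using N.induction with
          | hc => exact isClosed_le (by fun_prop) (by fun_prop)
          | h f => simpa only [cComp_ι, norm_ι] using N.comp_le g f
      norm_adj_comp_self := fun f => by
        change ‖N.cComp (N.cAdj f) f‖ = _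
        induction f using N.induction with
        | hc => exact isClosed_eq (by fun_prop) (by fun_prop)
        | h f => simpa only [cAdj_ι, cComp_ι, norm_ι] using N.adj_comp_self f }
  { B with
    pos := B.pos_of_aniso fun {X Y} f g h => by
      have key : ∀ (f : N.CHom X Y) (g : N.CHom X X),
          ‖g‖ * ‖g‖ ≤ ‖N.cComp (N.cAdj f) f + N.cComp (N.cAdj g) g‖ := by
        intro f g
        induction f using N.induction with
        | hc => exact isClosed_le (by fun_prop) (by fun_prop)
        | h f =>
          induction g using N.induction with
          | hc => exact isClosed_le (by fun_prop) (by fun_prop)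
          | h g =>
            have := N.le_add f g
            simpa only [cAdj_ι, cComp_ι, ← map_add, norm_ι] using this
      have h' : N.cComp (N.cAdj f) f + N.cComp (N.cAdj g) g = 0 := h
      have := key f g
      rw [h', norm_zero] at this
      exact norm_eq_zero.mp (mul_self_eq_zero.mp (le_antisymm this (mul_self_nonneg _))) }

end CStarSeminorm

/-- The seminorm `f ↦ sup_i ‖π_i(f)‖` defined by a pointwise bounded family of
representations. -/
def supSeminorm {V : StarCat.{u, v}} {I : Type u₁} (π : I → Rep.{u, v, w} V)
    (hb : ∀ {X Y : V.Obj} (f : V.Hom X Y), BddAbove (Set.range fun i => ‖(π i).map f‖)) :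
    CStarSeminorm V where
  N {X Y} :=
    { toFun := fun f => ⨆ i, ‖(π i).map f‖
      map_zero' := by simp
      add_le' := fun f g => by
        refine Real.iSup_le (fun i => ?_) (add_nonneg (Real.iSup_nonneg fun _ => norm_nonneg _)
          (Real.iSup_nonneg fun _ => norm_nonneg _))
        rw [map_add]
        exact (norm_add_le _ _).trans (add_le_add (le_ciSup (hb f) i) (le_ciSup (hb g) i))
      neg' := fun f => by simp only [map_neg, norm_neg]
      smul' := fun c f => by
        simp only [map_smul, norm_smul]
        exact (Real.mul_iSup_of_nonneg (norm_nonneg c) _).symm }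
  comp_le {X Y Z} g f := by
    change (⨆ i, ‖(π i).map (V.comp g f)‖) ≤ (⨆ i, ‖(π i).map g‖) * ⨆ i, ‖(π i).map f‖
    refine Real.iSup_le (fun i => ?_) (mul_nonneg (Real.iSup_nonneg fun _ => norm_nonneg _)
      (Real.iSup_nonneg fun _ => norm_nonneg _))
    rw [(π i).map_comp]
    exact (ContinuousLinearMap.opNorm_comp_le _ _).trans
      (mul_le_mul (le_ciSup (hb g) i) (le_ciSup (hb f) i) (norm_nonneg _)
        (Real.iSup_nonneg fun _ => norm_nonneg _))
  adj_comp_self {X Y} f := by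
    change (⨆ i, ‖(π i).map (V.comp (V.adj f) f)‖) = (⨆ i, ‖(π i).map f‖) * ⨆ i, ‖(π i).map f‖
    have h : ∀ i, ‖(π i).map (V.comp (V.adj f) f)‖ = ‖(π i).map f‖ * ‖(π i).map f‖ := fun i => by
      rw [(π i).map_comp, (π i).map_adj]
      exact ContinuousLinearMap.norm_adjoint_comp_self _
    have h0 : 0 ≤ ⨆ i, ‖(π i).map f‖ := Real.iSup_nonneg fun _ => norm_nonneg _
    refine le_antisymm (Real.iSup_le (fun i => ?_) (mul_nonneg h0 h0)) ?_
    · rw [h i]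
      exact mul_le_mul (le_ciSup (hb f) i) (le_ciSup (hb f) i) (norm_nonneg _) h0
    · have hs : 0 ≤ ⨆ i, ‖(π i).map (V.comp (V.adj f) f)‖ :=
        Real.iSup_nonneg fun _ => norm_nonneg _
      rw [← sq, ← Real.le_sqrt h0 hs]
      refine Real.iSup_le (fun i => ?_) (Real.sqrt_nonneg _)
      refine Real.le_sqrt_of_sq_le ?_
      rw [sq, ← h i]
      exact le_ciSup (hb (V.comp (V.adj f) f)) i
  le_add {X Y} f g := by
    change (⨆ i, ‖(π i).map g‖) * (⨆ i, ‖(π i).map g‖) ≤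
      ⨆ i, ‖(π i).map (V.comp (V.adj f) f + V.comp (V.adj g) g)‖
    have h0 : 0 ≤ ⨆ i, ‖(π i).map g‖ := Real.iSup_nonneg fun _ => norm_nonneg _
    have hs : 0 ≤ ⨆ i, ‖(π i).map (V.comp (V.adj f) f + V.comp (V.adj g) g)‖ :=
      Real.iSup_nonneg fun _ => norm_nonneg _
    rw [← sq, ← Real.le_sqrt h0 hs]
    refine Real.iSup_le (fun i => ?_) (Real.sqrt_nonneg _)
    refine le_trans ?_ (Real.sqrt_le_sqrt
      (le_ciSup (hb (V.comp (V.adj f) f + V.comp (V.adj g) g)) i))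
    set T := (π i).map (V.comp (V.adj f) f + V.comp (V.adj g) g) with hT
    refine ContinuousLinearMap.opNorm_le_bound _ (Real.sqrt_nonneg _) fun x => ?_
    have h1 : ‖(π i).map f x‖ ^ 2 + ‖(π i).map g x‖ ^ 2 = RCLike.re (inner ℂ (T x) x) := by
      rw [hT, map_add, (π i).map_comp, (π i).map_comp, (π i).map_adj, (π i).map_adj,
        _root_.add_apply, inner_add_left, map_add,
        ContinuousLinearMap.apply_norm_sq_eq_inner_adjoint_left,
        ContinuousLinearMap.apply_norm_sq_eq_inner_adjoint_left]
    have h2 : ‖(π i).map g x‖ ^ 2 ≤ ‖T‖ * ‖x‖ ^ 2 := by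
      calc ‖(π i).map g x‖ ^ 2 ≤ RCLike.re (inner ℂ (T x) x) := by
            rw [← h1]; exact le_add_of_nonneg_left (sq_nonneg _)
        _ ≤ ‖T x‖ * ‖x‖ := re_inner_le_norm _ _
        _ ≤ ‖T‖ * ‖x‖ * ‖x‖ := by gcongr; exact T.le_opNorm x
        _ = ‖T‖ * ‖x‖ ^ 2 := by ring
    calc ‖(π i).map g x‖ = √(‖(π i).map g x‖ ^ 2) := (Real.sqrt_sq (norm_nonneg _)).symm
      _ ≤ √(‖T‖ * ‖x‖ ^ 2) := Real.sqrt_le_sqrt h2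
      _ = √‖T‖ * ‖x‖ := by rw [Real.sqrt_mul (norm_nonneg _), Real.sqrt_sq (norm_nonneg _)]

/-! ## Tensor products of `C*`-categories -/

/-- The algebraic tensor product of two `C*`-categories. -/
@[reducible] def boxdot (V₁ : CStarCat.{u₁, v₁}) (V₂ : CStarCat.{u₂, v₂}) :
    StarCat.{max u₁ u₂, max v₁ v₂} where
  Obj := V₁.Obj × V₂.Obj
  Hom X Y := V₁.Hom X.1 Y.1 ⊗[ℂ] V₂.Hom X.2 Y.2
  comp := TensorProduct.map₂ V₁.comp V₂.comp
  assoc h g f := by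
    induction h with
    | zero => simp
    | add h h' e e' => simp only [map_add, LinearMap.add_apply, e, e']
    | tmul h h' =>
      induction g with
      | zero => simp
      | add g g' e e' => simp only [map_add, LinearMap.add_apply, e, e']
      | tmul g g' =>
        induction f with
        | zero => simp
        | add f f' e e' => simp only [map_add, e, e']
        | tmul f f' => simp only [TensorProduct.map₂_apply_tmul, TensorProduct.map_tmul, V₁.assoc, V₂.assoc]
  adj := TensorProduct.map V₁.adj V₂.adj
  adj_adj f := by
    induction f with
    | zero => simp
    | add f f' e e' => simp only [map_add, e, e']
    | tmul f f' => simp only [TensorProduct.map_tmul, V₁.adj_adj, V₂.adj_adj]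
  adj_comp g f := by
    induction g with
    | zero => simp
    | add g g' e e' => simp only [map_add, LinearMap.add_apply, e, e']
    | tmul g g' =>
      induction f with
      | zero => simp
      | add f f' e e' => simp only [map_add, LinearMap.add_apply, e, e']
      | tmul f f' =>
        simp only [TensorProduct.map_tmul, TensorProduct.map₂_apply_tmul, V₁.adj_comp,
          V₂.adj_comp]

/-- The tensor product of bounded operators, acting on Hilbert space tensor products. -/
def hilbertMap {H H' K K' : Type*} [NormedAddCommGroup H] [InnerProductSpace ℂ H]
    [NormedAddCommGroup H'] [InnerProductSpace ℂ H'] [NormedAddCommGroup K]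
    [InnerProductSpace ℂ K] [NormedAddCommGroup K'] [InnerProductSpace ℂ K']
    (S : H →L[ℂ] H') (T : K →L[ℂ] K') :
    UniformSpace.Completion (H ⊗[ℂ] K) →L[ℂ] UniformSpace.Completion (H' ⊗[ℂ] K') :=
  (TensorProduct.mapL S T).completion

section hilbertMap

variable {H H' H'' K K' K'' : Type*} [NormedAddCommGroup H] [InnerProductSpace ℂ H]
    [NormedAddCommGroup H'] [InnerProductSpace ℂ H'] [NormedAddCommGroup K]
    [InnerProductSpace ℂ K] [NormedAddCommGroup K'] [InnerProductSpace ℂ K']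
    [NormedAddCommGroup H''] [InnerProductSpace ℂ H''] [NormedAddCommGroup K'']
    [InnerProductSpace ℂ K'']

lemma hilbertMap_coe (S : H →L[ℂ] H') (T : K →L[ℂ] K') (x : H ⊗[ℂ] K) :
    hilbertMap S T (x : UniformSpace.Completion (H ⊗[ℂ] K)) =
      (TensorProduct.mapL S T x : H' ⊗[ℂ] K') :=
  ContinuousLinearMap.completion_apply_coe _ x

lemma clm_ext_completion {E F : Type*} [NormedAddCommGroup E] [InnerProductSpace ℂ E]
    [NormedAddCommGroup F] [InnerProductSpace ℂ F]
    {S T : UniformSpace.Completion E →L[ℂ] F} (h : ∀ x : E, S x = T x) : S = T := by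
  ext x
  induction x using UniformSpace.Completion.induction_on with
  | hp => exact isClosed_eq S.continuous T.continuous
  | ih x => exact h x

/-- The tensor product of bounded operators as a bilinear map. -/
def hilbertMap₂ : (H →L[ℂ] H') →ₗ[ℂ] (K →L[ℂ] K') →ₗ[ℂ]
    (UniformSpace.Completion (H ⊗[ℂ] K) →L[ℂ] UniformSpace.Completion (H' ⊗[ℂ] K')) :=
  LinearMap.mk₂ ℂ hilbertMap
    (fun S S' T => clm_ext_completion fun x => by
      simp only [_root_.add_apply, hilbertMap_coe, TensorProduct.mapL_add_left,
        UniformSpace.Completion.coe_add])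
    (fun c S T => clm_ext_completion fun x => by
      simp only [_root_.smul_apply, hilbertMap_coe, TensorProduct.mapL_smul_left,
        UniformSpace.Completion.coe_smul])
    (fun S T T' => clm_ext_completion fun x => by
      simp only [_root_.add_apply, hilbertMap_coe, TensorProduct.mapL_add_right,
        UniformSpace.Completion.coe_add])
    (fun c S T => clm_ext_completion fun x => by
      simp only [_root_.smul_apply, hilbertMap_coe, TensorProduct.mapL_smul_right,
        UniformSpace.Completion.coe_smul])

lemma hilbertMap_comp (S' : H' →L[ℂ] H'') (T' : K' →L[ℂ] K'') (S : H →L[ℂ] H')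
    (T : K →L[ℂ] K') :
    hilbertMap (S'.comp S) (T'.comp T) = (hilbertMap S' T').comp (hilbertMap S T) :=
  clm_ext_completion fun x => by
    rw [ContinuousLinearMap.comp_apply, hilbertMap_coe, hilbertMap_coe, hilbertMap_coe,
      TensorProduct.mapL_comp, ContinuousLinearMap.comp_apply]

lemma hilbertMap_adjoint [CompleteSpace H] [CompleteSpace H'] [CompleteSpace K]
    [CompleteSpace K'] (S : H →L[ℂ] H') (T : K →L[ℂ] K') :
    hilbertMap S.adjoint T.adjoint = (hilbertMap S T).adjoint := by
  rw [ContinuousLinearMap.eq_adjoint_iff]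
  intro x y
  induction x using UniformSpace.Completion.induction_on with
  | hp => exact isClosed_eq (by fun_prop) (by fun_prop)
  | ih x =>
    induction y using UniformSpace.Completion.induction_on with
    | hp => exact isClosed_eq (by fun_prop) (by fun_prop)
    | ih y =>
      rw [hilbertMap_coe, hilbertMap_coe, UniformSpace.Completion.inner_coe,
        UniformSpace.Completion.inner_coe]
      induction x with
      | zero => simp
      | add x x' e e' => rw [map_add, inner_add_left, inner_add_left, e, e']
      | tmul x x' =>
        induction y with
        | zero => simp
        | add y y' e e' => rw [map_add, inner_add_right, inner_add_right, e, e']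
        | tmul y y' =>
          simp only [TensorProduct.mapL_tmul, TensorProduct.inner_tmul,
            ContinuousLinearMap.adjoint_inner_left]

end hilbertMap

/-- The tensor product of two representations, on the Hilbert spaces
`ι₁(V₁) ⊗ ι₂(V₂)`. -/
def Rep.tensor {V₁ : CStarCat.{u₁, v₁}} {V₂ : CStarCat.{u₂, v₂}}
    (π₁ : Rep.{u₁, v₁, w₁} V₁.toStarCat) (π₂ : Rep.{u₂, v₂, w₂} V₂.toStarCat) :
    Rep.{max u₁ u₂, max v₁ v₂, max w₁ w₂} (boxdot V₁ V₂) where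
  H X := UniformSpace.Completion (π₁.H X.1 ⊗[ℂ] π₂.H X.2)
  map {X Y} := TensorProduct.lift (hilbertMap₂.compl₁₂ (π₁.map (X := X.1) (Y := Y.1))
    (π₂.map (X := X.2) (Y := Y.2)))
  map_comp g f := by
    induction g using TensorProduct.induction_on with
    | zero => simp
    | add g g' e e' => simp only [map_add, LinearMap.add_apply, e, e', ContinuousLinearMap.add_comp]
    | tmul g g' =>
      induction f using TensorProduct.induction_on with
      | zero => simp
      | add f f' e e' => simp only [map_add, e, e', ContinuousLinearMap.comp_add]
      | tmul f f' =>
        change hilbertMap (π₁.map (V₁.comp g f)) (π₂.map (V₂.comp g' f')) =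
          (hilbertMap (π₁.map g) (π₂.map g')).comp (hilbertMap (π₁.map f) (π₂.map f'))
        rw [← hilbertMap_comp, ← π₁.map_comp, ← π₂.map_comp]
  map_adj f := by
    induction f using TensorProduct.induction_on with
    | zero => simp
    | add f f' e e' => simp only [map_add, e, e']
    | tmul f f' =>
      change hilbertMap (π₁.map (V₁.adj f)) (π₂.map (V₂.adj f')) =
        (hilbertMap (π₁.map f) (π₂.map f')).adjoint
      rw [← hilbertMap_adjoint, ← π₁.map_adj, ← π₂.map_adj]

/-- The minimal `C*`-norm on `V₁ ⊙ V₂`, given by the operator norm in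
`L(ι₁(V₁) ⊗ ι₂(V₂), ι₁(W₁) ⊗ ι₂(W₂))` for realisations `ι₁, ι₂`. -/
def minNorm {V₁ : CStarCat.{u₁, v₁}} {V₂ : CStarCat.{u₂, v₂}}
    (ι₁ : Realisation.{u₁, v₁, w₁} V₁) (ι₂ : Realisation.{u₂, v₂, w₂} V₂) :
    CStarSeminorm (boxdot V₁ V₂) :=
  supSeminorm (fun _ : Unit => ι₁.toRep.tensor ι₂.toRep) fun _ => (Set.finite_range _).bddAbove

section maxNorm

lemma norm_bimap_le {A B H : Type*} [NonUnitalCStarAlgebra A] [NonUnitalCStarAlgebra B]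
    [NormedAddCommGroup H] [InnerProductSpace ℂ H] [CompleteSpace H]
    (P : A →ₗ[ℂ] B →ₗ[ℂ] (H →L[ℂ] H))
    (hmul : ∀ a a' b b', P (a * a') (b * b') = (P a b).comp (P a' b'))
    (hstar : ∀ a b, P (star a) (star b) = (P a b).adjoint) (h x : A) (y : B) :
    ‖P (h * x) y‖ ≤ ‖h‖ * ‖P x y‖ := by
  let _ := CStarAlgebra.spectralOrder A
  have _ := CStarAlgebra.spectralOrderedRing A
  have hle : star x * (star h * h) * x ≤ ‖star h * h‖ • (star x * x) :=
    CStarAlgebra.star_left_conjugate_le_norm_smul (IsSelfAdjoint.star_mul_self h)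
  obtain ⟨d, hd⟩ := CStarAlgebra.nonneg_iff_eq_star_mul_self.mp (sub_nonneg.mpr hle)
  have hsq : ∀ (a : A) (ξ : H),
      (RCLike.re (inner ℂ (P (star a * a) (star y * y) ξ) ξ) : ℝ) = ‖P a y ξ‖ ^ 2 := by
    intro a ξ
    rw [hmul, hstar, ContinuousLinearMap.apply_norm_sq_eq_inner_adjoint_left]
  refine ContinuousLinearMap.opNorm_le_bound _ (by positivity) fun ξ => ?_
  have h1 : ‖P d y ξ‖ ^ 2 = ‖h‖ ^ 2 * ‖P x y ξ‖ ^ 2 - ‖P (h * x) y ξ‖ ^ 2 := by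
    rw [← hsq d, ← hd, ← hsq x, ← hsq (h * x)]
    have e : star x * (star h * h) * x = star (h * x) * (h * x) := by
      rw [star_mul]; simp only [mul_assoc]
    have e2 : (‖star h * h‖ • (star x * x) : A) = ((‖h‖ ^ 2 : ℝ) : ℂ) • (star x * x) := by
      rw [CStarRing.norm_star_mul_self, sq, Complex.coe_smul]
    rw [e, e2, map_sub, map_smul]
    simp only [LinearMap.sub_apply, LinearMap.smul_apply, _root_.sub_apply, _root_.smul_apply,
      inner_sub_left, map_sub, inner_smul_left, Complex.conj_ofReal, RCLike.re_to_complex,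
      Complex.re_ofReal_mul]
  have h2 : ‖P (h * x) y ξ‖ ^ 2 ≤ (‖h‖ * ‖P x y ξ‖) ^ 2 := by
    rw [mul_pow]; nlinarith [sq_nonneg ‖P d y ξ‖]
  calc ‖P (h * x) y ξ‖ ≤ ‖h‖ * ‖P x y ξ‖ := (sq_le_sq₀ (norm_nonneg _) (by positivity)).mp h2
    _ ≤ ‖h‖ * (‖P x y‖ * ‖ξ‖) := by gcongr; exact (P x y).le_opNorm ξ
    _ = ‖h‖ * ‖P x y‖ * ‖ξ‖ := by ring

lemma norm_bimap_le_mul {A B H : Type*} [NonUnitalCStarAlgebra A] [NonUnitalCStarAlgebra B]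
    [NormedAddCommGroup H] [InnerProductSpace ℂ H] [CompleteSpace H]
    (P : A →ₗ[ℂ] B →ₗ[ℂ] (H →L[ℂ] H))
    (hmul : ∀ a a' b b', P (a * a') (b * b') = (P a b).comp (P a' b'))
    (hstar : ∀ a b, P (star a) (star b) = (P a b).adjoint) {h : A} {k : B}
    (hh : star h = h) (hk : star k = k) : ‖P h k‖ ≤ ‖h‖ * ‖k‖ := by
  have h1 : ‖P h k‖ * ‖P h k‖ ≤ ‖h‖ * ‖k‖ * ‖P h k‖ := by
    calc ‖P h k‖ * ‖P h k‖ = ‖P (h * h) (k * k)‖ := by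
          rw [← ContinuousLinearMap.norm_adjoint_comp_self, ← hstar, hh, hk, hmul]
      _ ≤ ‖h‖ * ‖P h (k * k)‖ := norm_bimap_le P hmul hstar h h _
      _ ≤ ‖h‖ * (‖k‖ * ‖P h k‖) := by
          gcongr
          exact norm_bimap_le P.flip (fun a a' b b' => hmul b b' a a') (fun a b => hstar b a) k k h
      _ = ‖h‖ * ‖k‖ * ‖P h k‖ := by ring
  rcases (norm_nonneg (P h k)).eq_or_lt with h0 | h0
  · rw [← h0]; positivity
  · exact le_of_mul_le_mul_right h1 h0

variable {V₁ : CStarCat.{u₁, v₁}} {V₂ : CStarCat.{u₂, v₂}}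

lemma Rep.norm_map_tmul_le (π : Rep.{max u₁ u₂, max v₁ v₂, w} (boxdot V₁ V₂))
    {X Y : V₁.Obj × V₂.Obj} (f : V₁.Hom X.1 Y.1) (g : V₂.Hom X.2 Y.2) :
    ‖π.map (X := X) (Y := Y) (f ⊗ₜ[ℂ] g)‖ ≤ ‖f‖ * ‖g‖ := by
  let P : V₁.End X.1 →ₗ[ℂ] V₂.End X.2 →ₗ[ℂ] (π.H X →L[ℂ] π.H X) :=
    (TensorProduct.mk ℂ (V₁.Hom X.1 X.1) (V₂.Hom X.2 X.2)).compr₂ (π.map (X := X) (Y := X))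
  have hmul : ∀ a a' b b', P (a * a') (b * b') = (P a b).comp (P a' b') := fun a a' b b' =>
    π.map_comp (X := X) (Y := X) (Z := X) (a ⊗ₜ[ℂ] b) (a' ⊗ₜ[ℂ] b')
  have hstar : ∀ a b, P (star a) (star b) = (P a b).adjoint := fun a b =>
    π.map_adj (X := X) (Y := X) (a ⊗ₜ[ℂ] b)
  have h1 := norm_bimap_le_mul P hmul hstar (h := V₁.comp (V₁.adj f) f)
    (k := V₂.comp (V₂.adj g) g)
    (show V₁.adj _ = _ by rw [V₁.adj_comp, V₁.adj_adj])
    (show V₂.adj _ = _ by rw [V₂.adj_comp, V₂.adj_adj])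
  have h2 : P (V₁.comp (V₁.adj f) f) (V₂.comp (V₂.adj g) g) =
      (π.map (X := X) (Y := Y) (f ⊗ₜ[ℂ] g)).adjoint.comp (π.map (f ⊗ₜ[ℂ] g)) := by
    rw [← π.map_adj, ← π.map_comp]
    rfl
  rw [h2, ContinuousLinearMap.norm_adjoint_comp_self] at h1
  have h3 : ‖π.map (X := X) (Y := Y) (f ⊗ₜ[ℂ] g)‖ * ‖π.map (X := X) (Y := Y) (f ⊗ₜ[ℂ] g)‖ ≤
      (‖f‖ * ‖g‖) * (‖f‖ * ‖g‖) := by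
    refine h1.trans (le_of_eq ?_)
    have e1 : ‖V₁.comp (V₁.adj f) f‖ = ‖f‖ * ‖f‖ := V₁.norm_adj_comp_self f
    have e2 : ‖V₂.comp (V₂.adj g) g‖ = ‖g‖ * ‖g‖ := V₂.norm_adj_comp_self g
    calc _ = ‖V₁.comp (V₁.adj f) f‖ * ‖V₂.comp (V₂.adj g) g‖ := rfl
      _ = _ := by rw [e1, e2]; ring
  exact (abs_le_of_sq_le_sq' (by simpa only [sq] using h3) (by positivity)).2

lemma Rep.bddAbove_norm {I : Type u} (π : I → Rep.{max u₁ u₂, max v₁ v₂, w} (boxdot V₁ V₂))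
    {X Y : V₁.Obj × V₂.Obj} (f : V₁.Hom X.1 Y.1 ⊗[ℂ] V₂.Hom X.2 Y.2) :
    BddAbove (Set.range fun i => ‖(π i).map (X := X) (Y := Y) f‖) := by
  induction f with
  | zero => exact ⟨0, by rintro _ ⟨i, rfl⟩; simp⟩
  | add f g hf hg =>
    obtain ⟨C, hC⟩ := hf
    obtain ⟨D, hD⟩ := hg
    refine ⟨C + D, ?_⟩
    rintro _ ⟨i, rfl⟩
    simp only [map_add]
    exact (norm_add_le _ _).trans (add_le_add (hC ⟨i, rfl⟩) (hD ⟨i, rfl⟩))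
  | tmul f g => exact ⟨‖f‖ * ‖g‖, by rintro _ ⟨i, rfl⟩; exact (π i).norm_map_tmul_le f g⟩

variable (V₁ V₂)

/-- The maximal `C*`-norm `‖f‖ = sup_π ‖π(f)‖` on `V₁ ⊙ V₂`, where `π` runs over all nondegenerate
linear `*`-functors to Hilbert spaces. (Hilbert spaces in the universe of the morphism spaces are
sufficient to attain all values of `‖π(f)‖`.) -/
def maxNorm : CStarSeminorm (boxdot V₁ V₂) :=
  supSeminorm (I := {π : Rep.{max u₁ u₂, max v₁ v₂, max v₁ v₂} (boxdot V₁ V₂) // π.Nondegenerate})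
    (fun π => π.1) fun f => Rep.bddAbove_norm _ f

end maxNorm

section boxtimes

variable {V₁ : CStarCat.{u₁, v₁}} {V₂ : CStarCat.{u₂, v₂}}

/-- For a `C*`-norm `N` on the algebraic tensor product, the elementary tensor `f ⊗ g` in the
completed tensor product. -/
def CStarSeminorm.tmul (N : CStarSeminorm (boxdot V₁ V₂)) {X₁ Y₁ : V₁.Obj} {X₂ Y₂ : V₂.Obj}
    (f : V₁.Hom X₁ Y₁) (g : V₂.Hom X₂ Y₂) : N.completion.Hom (X₁, X₂) (Y₁, Y₂) :=
  N.ι (X := (X₁, X₂)) (Y := (Y₁, Y₂)) (f ⊗ₜ[ℂ] g)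

/-- The tensor product `V₁ ⊠ V₂` defined by a `C*`-norm `N` on the algebraic tensor product:
the subobject completion of the completed tensor product. -/
def boxtimes (N : CStarSeminorm (boxdot V₁ V₂)) : CStarCat := split N.completion

/-- The object `X ⊠ Y`. -/
def boxtimesObj (N : CStarSeminorm (boxdot V₁ V₂)) (X : V₁.Obj) (Y : V₂.Obj) :
    (boxtimes N).Obj :=
  ⟨(X, Y), Multiplier.id N.completion (X, Y), Multiplier.isProjection_id _⟩

/-- The morphism `f ⊠ g`. -/
def boxtimesMap (N : CStarSeminorm (boxdot V₁ V₂)) {X₁ Y₁ : V₁.Obj} {X₂ Y₂ : V₂.Obj}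
    (f : V₁.Hom X₁ Y₁) (g : V₂.Hom X₂ Y₂) :
    (boxtimes N).Hom (boxtimesObj N X₁ X₂) (boxtimesObj N Y₁ Y₂) :=
  ⟨N.tmul f g, rfl, rfl⟩

end boxtimes

/-- For a `C*`-norm `N` on `A ⊙ B`, the `C*`-algebra given by the completion of `A ⊙ B`. -/
def TensorAlgebra {A : Type v₁} {B : Type v₂} [NonUnitalCStarAlgebra A]
    [NonUnitalCStarAlgebra B] (N : CStarSeminorm (boxdot (ofAlgebra A) (ofAlgebra B))) :
    Type (max v₁ v₂) :=
  N.completion.End ((), ())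

instance {A : Type v₁} {B : Type v₂} [NonUnitalCStarAlgebra A] [NonUnitalCStarAlgebra B]
    (N : CStarSeminorm (boxdot (ofAlgebra A) (ofAlgebra B))) :
    NonUnitalCStarAlgebra (TensorAlgebra N) :=
  BanachStarCat.instEnd N.completion.toBanachStarCat ((), ())

/-- The element `a ⊗ b` of the completed tensor product. -/
def TensorAlgebra.tmul {A : Type v₁} {B : Type v₂} [NonUnitalCStarAlgebra A]
    [NonUnitalCStarAlgebra B] (N : CStarSeminorm (boxdot (ofAlgebra A) (ofAlgebra B)))
    (a : A) (b : B) : TensorAlgebra N :=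
  CStarSeminorm.tmul N (X₁ := ()) (Y₁ := ()) (X₂ := ()) (Y₂ := ()) a b

/-! ## Hilbert modules -/

/-- An `A`-valued inner product and a right action of the `C*`-algebra `A` on a complex vector
space `E`. The inner product is linear in the second variable. (That the action is associative and
bilinear follows from `inner_act` and `definite`.) -/
structure InnerCore (A : Type u) [NonUnitalCStarAlgebra A] (E : Type w) [AddCommGroup E]
    [Module ℂ E] where
  act : E → A → E
  inner : E → E → A
  inner_add_right : ∀ x y z, inner x (y + z) = inner x y + inner x z
  inner_smul_right : ∀ (x : E) (c : ℂ) (y : E), inner x (c • y) = c • inner x y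
  inner_act : ∀ x y a, inner x (act y a) = inner x y * a
  star_inner : ∀ x y, star (inner x y) = inner y x
  inner_self_pos : ∀ x, ∃ a, inner x x = star a * a
  definite : ∀ x, inner x x = 0 → x = 0

namespace InnerCore

variable {A : Type u} [NonUnitalCStarAlgebra A] {E : Type w} [AddCommGroup E] [Module ℂ E]
  (I : InnerCore A E)

lemma inner_add_left (x y z : E) : I.inner (x + y) z = I.inner x z + I.inner y z := by
  rw [← I.star_inner z (x + y), I.inner_add_right, star_add, I.star_inner, I.star_inner]

lemma inner_smul_left (c : ℂ) (x y : E) : I.inner (c • x) y = star c • I.inner x y := by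
  rw [← I.star_inner y (c • x), I.inner_smul_right, star_smul, I.star_inner]

lemma inner_act_left (x : E) (a : A) (y : E) : I.inner (I.act x a) y = star a * I.inner x y := by
  rw [← I.star_inner y (I.act x a), I.inner_act, star_mul, I.star_inner]

lemma inner_zero_right (x : E) : I.inner x 0 = 0 := by
  simpa using I.inner_smul_right x 0 0

lemma inner_zero_left (x : E) : I.inner 0 x = 0 := by
  simpa using I.inner_smul_left 0 0 x

lemma inner_neg_right (x y : E) : I.inner x (-y) = -I.inner x y := by
  simpa using I.inner_smul_right x (-1) y

lemma inner_sub_right (x y z : E) : I.inner x (y - z) = I.inner x y - I.inner x z := by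
  rw [sub_eq_add_neg, I.inner_add_right, I.inner_neg_right, sub_eq_add_neg]

lemma inner_sub_left (x y z : E) : I.inner (x - y) z = I.inner x z - I.inner y z := by
  rw [← I.star_inner z (x - y), I.inner_sub_right, star_sub, I.star_inner, I.star_inner]

lemma ext_inner {x y : E} (h : ∀ z, I.inner z x = I.inner z y) : x = y := by
  rw [← sub_eq_zero]
  apply I.definite
  rw [I.inner_sub_right, h, sub_self]

lemma act_add (x : E) (a b : A) : I.act x (a + b) = I.act x a + I.act x b :=
  I.ext_inner fun z => by rw [I.inner_add_right, I.inner_act, I.inner_act, I.inner_act, mul_add]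

lemma act_smul (x : E) (c : ℂ) (a : A) : I.act x (c • a) = c • I.act x a :=
  I.ext_inner fun z => by rw [I.inner_smul_right, I.inner_act, I.inner_act, mul_smul_comm]

/-- Right modules are the modules over the opposite algebra considered in Mathlib. -/
lemma nonempty_cstarModule : ∃ (_ : PartialOrder Aᵐᵒᵖ) (_ : StarOrderedRing Aᵐᵒᵖ)
    (_ : SMul Aᵐᵒᵖ E) (_ : Norm E) (C : CStarModule Aᵐᵒᵖ E),
    (∀ x y : E, C.inner x y = MulOpposite.op (I.inner x y)) ∧
    ∀ x : E, ‖x‖ = √‖I.inner x x‖ := by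
  let P : PartialOrder Aᵐᵒᵖ := CStarAlgebra.spectralOrder Aᵐᵒᵖ
  have hP : StarOrderedRing Aᵐᵒᵖ := CStarAlgebra.spectralOrderedRing Aᵐᵒᵖ
  let s : SMul Aᵐᵒᵖ E := ⟨fun a x => I.act x a.unop⟩
  let n : Norm E := ⟨fun x => √‖I.inner x x‖⟩
  refine ⟨P, hP, s, n,
    { inner := fun x y => MulOpposite.op (I.inner x y)
      inner_add_right := fun {x y z} => by rw [I.inner_add_right, MulOpposite.op_add]
      inner_self_nonneg := fun {x} => by
        obtain ⟨a, ha⟩ := I.inner_self_pos x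
        rw [ha, MulOpposite.op_mul, MulOpposite.op_star]
        exact mul_star_self_nonneg _
      inner_self := fun {x} => by
        rw [MulOpposite.op_eq_zero_iff]
        exact ⟨I.definite x, fun h => by rw [h, I.inner_zero_right]⟩
      inner_op_smul_right := fun {a x y} => by
        change MulOpposite.op (I.inner x (I.act y a.unop)) = _
        rw [I.inner_act, MulOpposite.op_mul, MulOpposite.op_unop]
      inner_smul_right_complex := fun {z x y} => by rw [I.inner_smul_right, MulOpposite.op_smul]
      star_inner := fun x y => by rw [← MulOpposite.op_star, I.star_inner]
      norm_eq_sqrt_norm_inner_self := fun x => rfl }, fun _ _ => rfl, fun _ => rfl⟩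

lemma norm_inner_le (x y : E) :
    ‖I.inner x y‖ ≤ √‖I.inner x x‖ * √‖I.inner y y‖ := by
  obtain ⟨P, hP, s, n, C, h1, h2⟩ := I.nonempty_cstarModule
  have := CStarModule.norm_inner_le (A := Aᵐᵒᵖ) E (x := x) (y := y)
  rw [h2, h2] at this
  have h3 : ‖C.inner x y‖ = ‖I.inner x y‖ := by rw [h1]; rfl
  rwa [← h3]

/-- The norm `‖x‖ = ‖⟨x, x⟩‖^{1/2}`. -/
@[reducible] def toNorm : Norm E := ⟨fun x => √‖I.inner x x‖⟩

lemma normCore : @NormedSpace.Core ℂ E _ _ _ I.toNorm := by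
  obtain ⟨P, hP, s, n, C, h1, h2⟩ := I.nonempty_cstarModule
  have hn : n = I.toNorm := by
    cases n; congr 1; exact funext h2
  rw [← hn]
  exact CStarModule.normedSpaceCore Aᵐᵒᵖ

end InnerCore

/-- A right Hilbert module over the `C*`-algebra `A`. -/
structure HilbertModule (A : Type u) [NonUnitalCStarAlgebra A] where
  carrier : Type w
  [normed : NormedAddCommGroup carrier]
  [normedSpace : NormedSpace ℂ carrier]
  [complete : CompleteSpace carrier]
  core : InnerCore A carrier
  norm_sq : ∀ x : carrier, ‖x‖ * ‖x‖ = ‖core.inner x x‖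

attribute [instance] HilbertModule.normed HilbertModule.normedSpace HilbertModule.complete

instance {A : Type u} [NonUnitalCStarAlgebra A] : CoeSort (HilbertModule.{u, w} A) (Type w) :=
  ⟨HilbertModule.carrier⟩

namespace HilbertModule

variable {A : Type u} [NonUnitalCStarAlgebra A]

/-- The `A`-valued inner product. -/
def inner (E : HilbertModule.{u, w} A) (x y : E) : A := E.core.inner x y

/-- The right action of `A`. -/
def act (E : HilbertModule.{u, w} A) (x : E) (a : A) : E := E.core.act x a

lemma norm_eq_sqrt (E : HilbertModule.{u, w} A) (x : E) : ‖x‖ = √‖E.inner x x‖ := by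
  rw [inner, ← E.norm_sq, Real.sqrt_mul_self (norm_nonneg _)]

lemma norm_inner_le (E : HilbertModule.{u, w} A) (x y : E) : ‖E.inner x y‖ ≤ ‖x‖ * ‖y‖ := by
  rw [E.norm_eq_sqrt x, E.norm_eq_sqrt y]
  exact E.core.norm_inner_le x y

lemma norm_act_le (E : HilbertModule.{u, w} A) (x : E) (a : A) :
    ‖E.act x a‖ ≤ ‖x‖ * ‖a‖ := by
  have h : ‖E.act x a‖ * ‖E.act x a‖ ≤ (‖x‖ * ‖a‖) * (‖x‖ * ‖a‖) := by
    rw [E.norm_sq, act, E.core.inner_act, E.core.inner_act_left]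
    calc ‖star a * E.core.inner x x * a‖ ≤ ‖star a * E.core.inner x x‖ * ‖a‖ := norm_mul_le _ _
      _ ≤ ‖star a‖ * ‖E.core.inner x x‖ * ‖a‖ := by gcongr; exact norm_mul_le _ _
      _ = _ := by rw [norm_star, ← E.norm_sq]; ring
  exact (abs_le_of_sq_le_sq' (by simpa only [sq] using h) (by positivity)).2

variable {E F G : HilbertModule.{u, w} A}

/-- `S` is an adjoint of `T`. -/
def IsAdjoint (T : E →L[ℂ] F) (S : F →L[ℂ] E) : Prop :=
  ∀ x y, F.inner (T x) y = E.inner x (S y)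

namespace IsAdjoint

lemma symm {T : E →L[ℂ] F} {S : F →L[ℂ] E} (h : IsAdjoint T S) : IsAdjoint S T := fun x y => by
  have := congrArg star (h y x)
  rw [inner, inner, F.core.star_inner, E.core.star_inner] at this
  exact this.symm

lemma unique {T : E →L[ℂ] F} {S S' : F →L[ℂ] E} (h : IsAdjoint T S) (h' : IsAdjoint T S') :
    S = S' :=
  ContinuousLinearMap.ext fun y => E.core.ext_inner fun x => (h x y).symm.trans (h' x y)

lemma add {T T' : E →L[ℂ] F} {S S' : F →L[ℂ] E} (h : IsAdjoint T S) (h' : IsAdjoint T' S') :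
    IsAdjoint (T + T') (S + S') := fun x y => by
  have e1 := h x y
  have e2 := h' x y
  simp only [inner, _root_.add_apply, F.core.inner_add_left, E.core.inner_add_right] at *
  rw [e1, e2]

lemma sub {T T' : E →L[ℂ] F} {S S' : F →L[ℂ] E} (h : IsAdjoint T S) (h' : IsAdjoint T' S') :
    IsAdjoint (T - T') (S - S') := fun x y => by
  have e1 := h x y
  have e2 := h' x y
  simp only [inner, _root_.sub_apply, F.core.inner_sub_left, E.core.inner_sub_right] at *
  rw [e1, e2]

lemma zero : IsAdjoint (0 : E →L[ℂ] F) (0 : F →L[ℂ] E) := fun x y =>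
  (F.core.inner_zero_left y).trans (E.core.inner_zero_right x).symm

lemma smul (c : ℂ) {T : E →L[ℂ] F} {S : F →L[ℂ] E} (h : IsAdjoint T S) :
    IsAdjoint (c • T) (star c • S) := fun x y => by
  have e1 := h x y
  simp only [inner, _root_.smul_apply, F.core.inner_smul_left, E.core.inner_smul_right] at *
  rw [e1]

lemma comp {T : E →L[ℂ] F} {S : F →L[ℂ] E} {T' : F →L[ℂ] G} {S' : G →L[ℂ] F}
    (h' : IsAdjoint T' S') (h : IsAdjoint T S) : IsAdjoint (T'.comp T) (S.comp S') := fun x y =>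
  (h' (T x) y).trans (h x (S' y))

lemma map_act {T : E →L[ℂ] F} {S : F →L[ℂ] E} (h : IsAdjoint T S) (x : E) (a : A) :
    T (E.act x a) = F.act (T x) a :=
  F.core.ext_inner fun z => by
    have e1 := h.symm z (E.act x a)
    have e2 := h.symm z x
    simp only [inner, act, E.core.inner_act, F.core.inner_act] at *
    rw [← e1, ← e2]

lemma norm_le_sqrt {T : E →L[ℂ] F} {S : F →L[ℂ] E} (h : IsAdjoint T S) :
    ‖T‖ ≤ √‖S.comp T‖ := by
  refine T.opNorm_le_bound (Real.sqrt_nonneg _) fun x => ?_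
  have h1 : ‖T x‖ ^ 2 ≤ ‖S.comp T‖ * ‖x‖ ^ 2 := by
    calc ‖T x‖ ^ 2 = ‖E.inner x (S (T x))‖ := by
          rw [sq, F.norm_sq]; exact congrArg norm (h x (T x))
      _ ≤ ‖x‖ * ‖(S.comp T) x‖ := E.norm_inner_le _ _
      _ ≤ ‖x‖ * (‖S.comp T‖ * ‖x‖) := by gcongr; exact (S.comp T).le_opNorm x
      _ = ‖S.comp T‖ * ‖x‖ ^ 2 := by ring
  calc ‖T x‖ = √(‖T x‖ ^ 2) := (Real.sqrt_sq (norm_nonneg _)).symm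
    _ ≤ √(‖S.comp T‖ * ‖x‖ ^ 2) := Real.sqrt_le_sqrt h1
    _ = √‖S.comp T‖ * ‖x‖ := by rw [Real.sqrt_mul (norm_nonneg _), Real.sqrt_sq (norm_nonneg _)]

lemma norm_le {T : E →L[ℂ] F} {S : F →L[ℂ] E} (h : IsAdjoint T S) : ‖T‖ ≤ ‖S‖ := by
  have h1 : ‖T‖ * ‖T‖ ≤ ‖S‖ * ‖T‖ := by
    calc ‖T‖ * ‖T‖ ≤ √‖S.comp T‖ * √‖S.comp T‖ :=
          mul_le_mul h.norm_le_sqrt h.norm_le_sqrt (norm_nonneg _) (Real.sqrt_nonneg _)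
      _ = ‖S.comp T‖ := Real.mul_self_sqrt (norm_nonneg _)
      _ ≤ ‖S‖ * ‖T‖ := S.opNorm_comp_le T
  rcases (norm_nonneg T).eq_or_lt with h0 | h0
  · rw [← h0]; exact norm_nonneg _
  · exact le_of_mul_le_mul_right h1 h0

lemma norm_eq {T : E →L[ℂ] F} {S : F →L[ℂ] E} (h : IsAdjoint T S) : ‖T‖ = ‖S‖ :=
  le_antisymm h.norm_le h.symm.norm_le

lemma norm_comp_self {T : E →L[ℂ] F} {S : F →L[ℂ] E} (h : IsAdjoint T S) :
    ‖S.comp T‖ = ‖T‖ * ‖T‖ := by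
  refine le_antisymm ((S.opNorm_comp_le T).trans (by rw [h.norm_eq])) ?_
  calc ‖T‖ * ‖T‖ ≤ √‖S.comp T‖ * √‖S.comp T‖ :=
        mul_le_mul h.norm_le_sqrt h.norm_le_sqrt (norm_nonneg _) (Real.sqrt_nonneg _)
    _ = ‖S.comp T‖ := Real.mul_self_sqrt (norm_nonneg _)

end IsAdjoint

/-- The rank one operator `z ↦ x ⟨y, z⟩`. -/
def rankOne (x : F) (y : E) : E →L[ℂ] F :=
  LinearMap.mkContinuous
    { toFun := fun z => F.act x (E.inner y z)
      map_add' := fun z z' => by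
        simp only [inner, act, E.core.inner_add_right, F.core.act_add]
      map_smul' := fun c z => by
        simp only [inner, act, E.core.inner_smul_right, F.core.act_smul, RingHom.id_apply] }
    (‖x‖ * ‖y‖) fun z => by
      refine (F.norm_act_le x _).trans ?_
      rw [mul_assoc]
      exact mul_le_mul_of_nonneg_left (E.norm_inner_le y z) (norm_nonneg _)

lemma isAdjoint_rankOne (x : F) (y : E) : IsAdjoint (rankOne x y) (rankOne y x) := fun z w => by
  change F.core.inner (F.core.act x (E.core.inner y z)) w =
    E.core.inner z (E.core.act y (F.core.inner x w))
  rw [F.core.inner_act_left, E.core.inner_act, E.core.star_inner]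

lemma comp_rankOne {T : F →L[ℂ] G} {S : G →L[ℂ] F} (h : IsAdjoint T S) (x : F) (y : E) :
    T.comp (rankOne x y) = rankOne (T x) y :=
  ContinuousLinearMap.ext fun _ => h.map_act x _

/-- The compact operators from `E` to `F`: the closed linear span of the rank one operators. -/
def compactOps (E F : HilbertModule.{u, w} A) : Submodule ℂ (E →L[ℂ] F) :=
  (Submodule.span ℂ {T | ∃ (x : F) (y : E), T = rankOne x y}).topologicalClosure

lemma isClosed_compactOps (E F : HilbertModule.{u, w} A) :
    IsClosed (compactOps E F : Set (E →L[ℂ] F)) :=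
  Submodule.isClosed_topologicalClosure _

lemma exists_adjoint_of_mem_span {T : E →L[ℂ] F}
    (hT : T ∈ Submodule.span ℂ {T : E →L[ℂ] F | ∃ (x : F) (y : E), T = rankOne x y}) :
    ∃ S ∈ compactOps F E, IsAdjoint T S := by
  induction hT using Submodule.span_induction with
  | mem T h =>
    obtain ⟨x, y, rfl⟩ := h
    exact ⟨rankOne y x, Submodule.le_topologicalClosure _ (Submodule.subset_span ⟨y, x, rfl⟩),
      isAdjoint_rankOne x y⟩
  | zero => exact ⟨0, zero_mem _, IsAdjoint.zero⟩
  | add T T' _ _ h h' =>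
    obtain ⟨S, hS, h⟩ := h
    obtain ⟨S', hS', h'⟩ := h'
    exact ⟨S + S', add_mem hS hS', h.add h'⟩
  | smul c T _ h =>
    obtain ⟨S, hS, h⟩ := h
    exact ⟨star c • S, Submodule.smul_mem _ _ hS, h.smul c⟩

lemma exists_adjoint {T : E →L[ℂ] F} (hT : T ∈ compactOps E F) :
    ∃ S ∈ compactOps F E, IsAdjoint T S := by
  obtain ⟨t, ht, hlim⟩ := mem_closure_iff_seq_limit.mp
    (show T ∈ closure (Submodule.span ℂ {T : E →L[ℂ] F | ∃ (x : F) (y : E), T = rankOne x y} :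
      Set (E →L[ℂ] F)) from hT)
  choose s hs hts using fun n => exists_adjoint_of_mem_span (ht n)
  have hc : CauchySeq s := by
    rw [Metric.cauchySeq_iff]
    intro ε hε
    obtain ⟨N, hN⟩ := Metric.cauchySeq_iff.mp hlim.cauchySeq ε hε
    refine ⟨N, fun m hm n hn => ?_⟩
    rw [dist_eq_norm, ← ((hts m).sub (hts n)).norm_eq, ← dist_eq_norm]
    exact hN m hm n hn
  obtain ⟨S, hS⟩ := cauchySeq_tendsto_of_complete hc
  refine ⟨S, (isClosed_compactOps F E).mem_of_tendsto hS (Filter.Eventually.of_forall hs), ?_⟩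
  intro x y
  have hl : Filter.Tendsto (fun n => F.inner (t n x) y) Filter.atTop (nhds (F.inner (T x) y)) := by
    rw [tendsto_iff_norm_sub_tendsto_zero]
    have h1 : Filter.Tendsto (fun n => ‖t n - T‖ * ‖x‖ * ‖y‖) Filter.atTop (nhds 0) := by
      simpa using ((tendsto_iff_norm_sub_tendsto_zero.mp hlim).mul_const ‖x‖).mul_const ‖y‖
    refine squeeze_zero (fun _ => norm_nonneg _) (fun n => ?_) h1
    have : F.inner (t n x) y - F.inner (T x) y = F.inner ((t n - T) x) y :=
      (F.core.inner_sub_left _ _ _).symm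
    rw [this]
    exact (F.norm_inner_le _ _).trans (by gcongr; exact (t n - T).le_opNorm x)
  have hr : Filter.Tendsto (fun n => E.inner x (s n y)) Filter.atTop (nhds (E.inner x (S y))) := by
    rw [tendsto_iff_norm_sub_tendsto_zero]
    have h1 : Filter.Tendsto (fun n => ‖x‖ * (‖s n - S‖ * ‖y‖)) Filter.atTop (nhds 0) := by
      simpa using ((tendsto_iff_norm_sub_tendsto_zero.mp hS).mul_const ‖y‖).const_mul ‖x‖
    refine squeeze_zero (fun _ => norm_nonneg _) (fun n => ?_) h1
    have : E.inner x (s n y) - E.inner x (S y) = E.inner x ((s n - S) y) :=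
      (E.core.inner_sub_right _ _ _).symm
    rw [this]
    exact (E.norm_inner_le _ _).trans (by gcongr; exact (s n - S).le_opNorm y)
  exact tendsto_nhds_unique hl (hr.congr fun n => (hts n x y).symm)

lemma comp_mem_compactOps {T : F →L[ℂ] G} {T' : E →L[ℂ] F} (hT : T ∈ compactOps F G)
    (hT' : T' ∈ compactOps E F) : T.comp T' ∈ compactOps E G := by
  obtain ⟨S, -, hS⟩ := exists_adjoint hT
  let Φ : (E →L[ℂ] F) →L[ℂ] (E →L[ℂ] G) := ContinuousLinearMap.compL ℂ E F G T
  have hle : compactOps E F ≤ (compactOps E G).comap Φ.toLinearMap := by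
    refine Submodule.topologicalClosure_minimal _ (Submodule.span_le.mpr ?_)
      ((isClosed_compactOps E G).preimage Φ.continuous)
    rintro _ ⟨x, y, rfl⟩
    refine Submodule.le_topologicalClosure _ (Submodule.subset_span ⟨T x, y, ?_⟩)
    exact comp_rankOne hS x y
  exact hle hT'

/-- The adjoint of a compact operator. -/
def compactAdj : compactOps E F →ₗ⋆[ℂ] compactOps F E where
  toFun T := ⟨(exists_adjoint T.2).choose, (exists_adjoint T.2).choose_spec.1⟩
  map_add' T T' := Subtype.ext <|
    (exists_adjoint (T + T').2).choose_spec.2.unique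
      ((exists_adjoint T.2).choose_spec.2.add (exists_adjoint T'.2).choose_spec.2)
  map_smul' c T := Subtype.ext <|
    (exists_adjoint (c • T).2).choose_spec.2.unique
      ((exists_adjoint T.2).choose_spec.2.smul c)

lemma isAdjoint_compactAdj (T : compactOps E F) : IsAdjoint T.1 (compactAdj T).1 :=
  (exists_adjoint T.2).choose_spec.2

end HilbertModule

open HilbertModule in
/-- The `C*`-category of Hilbert `A`-modules (in a given universe) and compact operators. -/
def HILB (A : Type u) [NonUnitalCStarAlgebra A] : CStarCat.{max u (w + 1), w} :=
  let B : BanachStarCat.{max u (w + 1), w} :=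
    { Obj := HilbertModule.{u, w} A
      Hom := fun E F => compactOps E F
      complete := fun E F => (isClosed_compactOps E F).completeSpace_coe
      comp := LinearMap.mk₂ ℂ (fun T S => ⟨T.1.comp S.1, comp_mem_compactOps T.2 S.2⟩)
        (fun T T' S => Subtype.ext (ContinuousLinearMap.add_comp T.1 T'.1 S.1))
        (fun c T S => Subtype.ext (ContinuousLinearMap.smul_comp c T.1 S.1))
        (fun T S S' => Subtype.ext (ContinuousLinearMap.comp_add T.1 S.1 S'.1))
        (fun c T S => Subtype.ext (ContinuousLinearMap.comp_smul T.1 c S.1))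
      assoc := fun _ _ _ => rfl
      adj := compactAdj
      adj_adj := fun T => Subtype.ext <|
        (isAdjoint_compactAdj (compactAdj T)).unique (isAdjoint_compactAdj T).symm
      adj_comp := fun T S => Subtype.ext <|
        (isAdjoint_compactAdj _).unique ((isAdjoint_compactAdj T).comp (isAdjoint_compactAdj S))
      norm_comp_le := fun T S => T.1.opNorm_comp_le S.1
      norm_adj_comp_self := fun T => (isAdjoint_compactAdj T).norm_comp_self }
  { B with
    pos := B.pos_of_aniso fun {E F} T S h => by
      let _ := CStarAlgebra.spectralOrder A
      have _ := CStarAlgebra.spectralOrderedRing A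
      refine Subtype.ext (ContinuousLinearMap.ext fun x => E.core.definite _ ?_)
      have h1 := congrArg (fun R : compactOps E E => E.core.inner x (R.1 x)) h
      have h2 : E.core.inner x ((compactAdj T).1 (T.1 x) + (compactAdj S).1 (S.1 x)) = 0 :=
        h1.trans (E.core.inner_zero_right x)
      rw [E.core.inner_add_right] at h2
      have h3 : F.core.inner (T.1 x) (T.1 x) + E.core.inner (S.1 x) (S.1 x) = 0 := by
        rw [← h2]
        exact congrArg₂ (· + ·) (isAdjoint_compactAdj T x (T.1 x))
          (isAdjoint_compactAdj S x (S.1 x))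
      obtain ⟨a, ha⟩ := F.core.inner_self_pos (T.1 x)
      obtain ⟨b, hb⟩ := E.core.inner_self_pos (S.1 x)
      rw [ha, hb] at h3
      rw [hb]
      refine le_antisymm ?_ (star_mul_self_nonneg b)
      rw [← h3]
      exact le_add_of_nonneg_left (star_mul_self_nonneg a) }

/-! ## The standard Hilbert module `H_A = ⨁_{n ∈ ℕ} A` -/

namespace StdModule

variable (A : Type u) [NonUnitalCStarAlgebra A]

lemma summable_of_le {f g : ℕ → A} (P : PartialOrder A) (hP : StarOrderedRing A)
    (hf : ∀ n, 0 ≤ f n) (hfg : ∀ n, f n ≤ g n) (hg : Summable g) : Summable f := by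
  rw [summable_iff_vanishing_norm] at hg ⊢
  intro ε hε
  obtain ⟨s, hs⟩ := hg ε hε
  refine ⟨s, fun t ht => lt_of_le_of_lt ?_ (hs t ht)⟩
  exact CStarAlgebra.norm_le_norm_of_nonneg_of_le (Finset.sum_nonneg fun i _ => hf i)
    (Finset.sum_le_sum fun i _ => hfg i)

lemma star_mul_self_add_le (P : PartialOrder A) (hP : StarOrderedRing A) (a b : A) :
    star (a + b) * (a + b) ≤ (star a * a + star a * a) + (star b * b + star b * b) := by
  rw [← sub_nonneg]
  have : (star a * a + star a * a) + (star b * b + star b * b) - star (a + b) * (a + b) =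
      star (a - b) * (a - b) := by
    simp only [star_add, star_sub]
    noncomm_ring
  rw [this]
  exact star_mul_self_nonneg _

/-- The sequences `(a_n)` in `A` such that `∑ a_n* a_n` converges. -/
def sqSummable : Submodule ℂ (ℕ → A) where
  carrier := {a | Summable fun n => star (a n) * a n}
  add_mem' {a b} ha hb := by
    let P := CStarAlgebra.spectralOrder A
    have hP := CStarAlgebra.spectralOrderedRing A
    exact summable_of_le A P hP (fun n => star_mul_self_nonneg _)
      (fun n => star_mul_self_add_le A P hP _ _) ((ha.add ha).add (hb.add hb))
  zero_mem' := by
    change Summable fun n => star ((0 : ℕ → A) n) * (0 : ℕ → A) n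
    simp
  smul_mem' c a ha := by
    have : (fun n => star ((c • a) n) * (c • a) n) = fun n => (star c * c) • (star (a n) * a n) := by
      funext n
      simp only [Pi.smul_apply, star_smul, smul_mul_smul_comm]
    change Summable _
    rw [this]
    exact Summable.const_smul _ ha

/-- The underlying space of `H_A` (not carrying the product topology). -/
def Carrier : Type u := sqSummable A

instance : AddCommGroup (Carrier A) := inferInstanceAs (AddCommGroup (sqSummable A))

instance : Module ℂ (Carrier A) := inferInstanceAs (Module ℂ (sqSummable A))

variable {A}

lemma summable_inner (a b : Carrier A) : Summable fun n => star (a.1 n) * b.1 n := by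
  have key : ∀ x y : A, star x * y = (1 / 4 : ℂ) • ((star (x + y) * (x + y)
      - star (x - y) * (x - y)) + Complex.I • (star (x - Complex.I • y) * (x - Complex.I • y)
      - star (x + Complex.I • y) * (x + Complex.I • y))) := by
    intro x y
    have hI : star Complex.I = -Complex.I := Complex.conj_I
    simp only [star_add, star_sub, star_smul, hI, mul_add, add_mul, mul_sub, sub_mul, smul_mul_assoc,
      mul_smul_comm, smul_add, smul_sub, smul_smul, neg_smul, neg_mul, smul_neg,
      Complex.I_mul_I]
    module
  have h1 := (a + b).2
  have h2 := (a - b).2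
  have h3 := (a - Complex.I • b).2
  have h4 := (a + Complex.I • b).2
  exact (((h1.sub h2).add ((h3.sub h4).const_smul Complex.I)).const_smul (1 / 4 : ℂ)).congr
    fun n => (key _ _).symm

/-- The inner product `⟨a, b⟩ = ∑ a_n* b_n` and the right action `(a_n) a = (a_n a)`. -/
def core : InnerCore A (Carrier A) where
  act a x := ⟨fun n => a.1 n * x, by
    have := (Summable.mul_left (star x) a.2).mul_right x
    refine this.congr fun n => ?_
    simp only [star_mul, mul_assoc]⟩
  inner a b := ∑' n, star (a.1 n) * b.1 n
  inner_add_right a b c := by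
    rw [← (summable_inner a b).tsum_add (summable_inner a c)]
    exact tsum_congr fun n => mul_add _ _ _
  inner_smul_right a c b := by
    rw [← (summable_inner a b).tsum_const_smul]
    exact tsum_congr fun n => mul_smul_comm _ _ _
  inner_act a b x := by
    rw [← (summable_inner a b).tsum_mul_right]
    exact tsum_congr fun n => (mul_assoc _ _ _).symm
  star_inner a b := by
    rw [tsum_star]
    exact tsum_congr fun n => by rw [star_mul, star_star]
  inner_self_pos a := by
    let P := CStarAlgebra.spectralOrder A
    have hP := CStarAlgebra.spectralOrderedRing A
    refine CStarAlgebra.nonneg_iff_eq_star_mul_self.mp ?_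
    exact CStarAlgebra.isClosed_nonneg.mem_of_tendsto a.2.hasSum
      (Filter.Eventually.of_forall fun s =>
        Finset.sum_nonneg (f := fun n => star (a.1 n) * a.1 n) fun i _ => star_mul_self_nonneg _)
  definite a h := by
    let P := CStarAlgebra.spectralOrder A
    have hP := CStarAlgebra.spectralOrderedRing A
    refine Subtype.ext (funext fun n => ?_)
    have h1 : 0 ≤ (∑' n, star (a.1 n) * a.1 n) - star (a.1 n) * a.1 n := by
      refine CStarAlgebra.isClosed_nonneg.mem_of_tendsto (a.2.hasSum.sub_const _) ?_
      filter_upwards [Filter.eventually_ge_atTop {n}] with s hs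
      exact sub_nonneg.mpr (Finset.single_le_sum (f := fun n => star (a.1 n) * a.1 n)
        (fun i _ => star_mul_self_nonneg _) (hs (Finset.mem_singleton_self n)))
    rw [h, zero_sub, Left.nonneg_neg_iff] at h1
    exact (CStarRing.star_mul_self_eq_zero_iff _).mp (le_antisymm h1 (star_mul_self_nonneg _))

instance : NormedAddCommGroup (Carrier A) :=
  letI := (core (A := A)).toNorm
  NormedAddCommGroup.ofCore (core (A := A)).normCore

instance : NormedSpace ℂ (Carrier A) :=
  letI := (core (A := A)).toNorm
  NormedSpace.ofCore (core (A := A)).normCore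

lemma norm_sq (a : Carrier A) : ‖a‖ * ‖a‖ = ‖∑' n, star (a.1 n) * a.1 n‖ :=
  Real.mul_self_sqrt (norm_nonneg (∑' n, star (a.1 n) * a.1 n))

lemma norm_sum_le (a : Carrier A) (s : Finset ℕ) :
    ‖∑ n ∈ s, star (a.1 n) * a.1 n‖ ≤ ‖a‖ * ‖a‖ := by
  let P := CStarAlgebra.spectralOrder A
  have hP := CStarAlgebra.spectralOrderedRing A
  rw [norm_sq]
  refine CStarAlgebra.norm_le_norm_of_nonneg_of_le
    (Finset.sum_nonneg fun i _ => star_mul_self_nonneg _) ?_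
  rw [← sub_nonneg]
  refine CStarAlgebra.isClosed_nonneg.mem_of_tendsto (a.2.hasSum.sub_const _) ?_
  filter_upwards [Filter.eventually_ge_atTop s] with t ht
  exact sub_nonneg.mpr (Finset.sum_le_sum_of_subset_of_nonneg ht
    fun i _ _ => star_mul_self_nonneg _)

instance : CompleteSpace (Carrier A) := by
  let P := CStarAlgebra.spectralOrder A
  have hP := CStarAlgebra.spectralOrderedRing A
  refine Metric.complete_of_cauchySeq_tendsto fun (u : ℕ → Carrier A) hu => ?_
  have hpt : ∀ n : ℕ, CauchySeq fun k : ℕ => (u k).1 n := by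
    intro n
    refine Metric.cauchySeq_iff.mpr fun ε hε => ?_
    obtain ⟨N, hN⟩ := Metric.cauchySeq_iff.mp hu ε hε
    refine ⟨N, fun k hk l hl => lt_of_le_of_lt ?_ (hN k hk l hl)⟩
    have h1 := norm_sum_le (u k - u l) {n}
    rw [Finset.sum_singleton, CStarRing.norm_star_mul_self] at h1
    rw [dist_eq_norm, dist_eq_norm]
    exact (mul_self_le_mul_self_iff (norm_nonneg ((u k).1 n - (u l).1 n))
      (norm_nonneg (u k - u l))).mpr h1
  choose a ha using fun n => cauchySeq_tendsto_of_complete (hpt n)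
  have hfin : ∀ ε > 0, ∃ N, ∀ k ≥ N, ∀ s : Finset ℕ,
      ‖∑ n ∈ s, star (a n - (u k).1 n) * (a n - (u k).1 n)‖ ≤ ε * ε := by
    intro ε hε
    obtain ⟨N, hN⟩ := Metric.cauchySeq_iff.mp hu ε hε
    refine ⟨N, fun k hk s => ?_⟩
    have hl : Filter.Tendsto (fun l => ‖∑ n ∈ s, star ((u l).1 n - (u k).1 n) *
        ((u l).1 n - (u k).1 n)‖) Filter.atTop
        (nhds ‖∑ n ∈ s, star (a n - (u k).1 n) * (a n - (u k).1 n)‖) := by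
      refine (tendsto_finsetSum _ fun n _ => ?_).norm
      exact (((ha n).sub_const _).star).mul ((ha n).sub_const _)
    refine le_of_tendsto hl ?_
    filter_upwards [Filter.eventually_ge_atTop N] with l hl
    refine (norm_sum_le (u l - u k) s).trans ?_
    have := (hN l hl k hk).le
    rw [dist_eq_norm] at this
    gcongr
  have hmem : Summable fun n => star (a n) * a n := by
    rw [summable_iff_vanishing_norm]
    intro ε hε
    obtain ⟨N, hN⟩ := hfin (√(ε / 8)) (by positivity)
    obtain ⟨s, hs⟩ := summable_iff_vanishing_norm.mp (u N).2 (ε / 8) (by positivity)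
    refine ⟨s, fun t ht => ?_⟩
    have h1 := hN N le_rfl t
    rw [Real.mul_self_sqrt (by positivity)] at h1
    have h2 := hs t ht
    set p := ∑ n ∈ t, star (a n - (u N).1 n) * (a n - (u N).1 n) with hp
    set q := ∑ n ∈ t, star ((u N).1 n) * (u N).1 n with hq
    have h3 : ∑ n ∈ t, star (a n) * a n ≤ (p + p) + (q + q) := by
      rw [hp, hq, ← Finset.sum_add_distrib, ← Finset.sum_add_distrib, ← Finset.sum_add_distrib]
      refine Finset.sum_le_sum fun n _ => ?_
      simpa using star_mul_self_add_le A P hP (a n - (u N).1 n) ((u N).1 n)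
    have h4 := CStarAlgebra.norm_le_norm_of_nonneg_of_le
      (Finset.sum_nonneg fun n _ => star_mul_self_nonneg (a n)) h3
    have h5 := norm_add_le (p + p) (q + q)
    have h6 := norm_add_le p p
    have h7 := norm_add_le q q
    linarith
  let l : Carrier A := ⟨a, hmem⟩
  refine ⟨l, Metric.tendsto_atTop.mpr fun ε hε => ?_⟩
  obtain ⟨N, hN⟩ := hfin (ε / 2) (by positivity)
  refine ⟨N, fun k hk => ?_⟩
  rw [dist_comm, dist_eq_norm]
  let d : Carrier A := l - u k
  have h1 : ‖d‖ * ‖d‖ ≤ (ε / 2) * (ε / 2) := by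
    rw [norm_sq]
    exact le_of_tendsto d.2.hasSum.norm (Filter.Eventually.of_forall fun s => hN k hk s)
  have h2 : ‖d‖ ≤ ε / 2 := (mul_self_le_mul_self_iff (norm_nonneg _) (by positivity)).mpr h1
  exact lt_of_le_of_lt h2 (by linarith)

end StdModule

/-- The standard Hilbert module `H_A = ⨁_{n ∈ ℕ} A`, consisting of the sequences `(a_n)` in `A`
such that `∑ a_n* a_n` converges. -/
def stdModule (A : Type u) [NonUnitalCStarAlgebra A] : HilbertModule.{u, u} A where
  carrier := StdModule.Carrier A
  core := StdModule.core
  norm_sq a := StdModule.norm_sq a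

/-- `E` is isomorphic to a direct summand of the standard Hilbert module `H_A`: there is an
adjointable isometry from `E` to `H_A`. -/
def HilbertModule.IsSummandOfStd {A : Type u} [NonUnitalCStarAlgebra A]
    (E : HilbertModule.{u, u} A) : Prop :=
  ∃ (V : E →L[ℂ] stdModule A) (S : stdModule A →L[ℂ] E),
    HilbertModule.IsAdjoint V S ∧ S.comp V = ContinuousLinearMap.id ℂ E

/-- The `C*`-category `Hilb_A`: the full subcategory of `HILB_A` consisting of the Hilbert
`A`-modules which are isomorphic to direct summands of the standard Hilbert module `H_A`. -/
def Hilb (A : Type u) [NonUnitalCStarAlgebra A] : CStarCat.{u + 1, u} where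
  Obj := {E : HilbertModule.{u, u} A // E.IsSummandOfStd}
  Hom E F := (HILB A).Hom E.1 F.1
  normed E F := (HILB A).normed E.1 F.1
  normedSpace E F := (HILB A).normedSpace E.1 F.1
  complete E F := (HILB A).complete E.1 F.1
  comp := (HILB A).comp
  assoc := (HILB A).assoc
  adj := (HILB A).adj
  adj_adj := (HILB A).adj_adj
  adj_comp := (HILB A).adj_comp
  norm_comp_le := (HILB A).norm_comp_le
  norm_adj_comp_self := (HILB A).norm_adj_comp_self
  pos := (HILB A).pos

section Hilb

variable {A : Type u} [NonUnitalCStarAlgebra A]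

/-- The Hilbert module underlying an object of `Hilb_A`. -/
def Hilb.mod (E : (Hilb A).Obj) : HilbertModule.{u, u} A :=
  (show {E : HilbertModule.{u, u} A // E.IsSummandOfStd} from E).1

/-- The operator underlying a morphism of `Hilb_A`. -/
def Hilb.op {E F : (Hilb A).Obj} (T : (Hilb A).Hom E F) : Hilb.mod E →L[ℂ] Hilb.mod F :=
  (show HilbertModule.compactOps (Hilb.mod E) (Hilb.mod F) from T).1

end Hilb

/-! ## Exterior tensor products -/

section exterior

variable {A : Type u} {B : Type v} [NonUnitalCStarAlgebra A] [NonUnitalCStarAlgebra B]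

/-- For Hilbert modules `E` over `A` and `F` over `B` and a Hilbert module `G` over the completion
`A ⊗ B` of `A ⊙ B` with respect to the `C*`-norm `M`, the bilinear map `τ : E × F → G` exhibits `G`
as exterior tensor product of `E` and `F`, that is, as the completion of `E ⊙ F` with respect to the
`A ⊗ B`-valued inner product `⟨ξ ⊗ η, ζ ⊗ κ⟩ = ⟨ξ, ζ⟩ ⊗ ⟨η, κ⟩`. -/
structure IsExteriorTensor (M : CStarSeminorm (boxdot (ofAlgebra A) (ofAlgebra B)))
    (E : HilbertModule.{u, u} A) (F : HilbertModule.{v, v} B)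
    (G : HilbertModule.{max u v, max u v} (TensorAlgebra M)) (τ : E →ₗ[ℂ] F →ₗ[ℂ] G) : Prop where
  inner_eq : ∀ (ξ ζ : E) (η κ : F),
    G.inner (τ ξ η) (τ ζ κ) = TensorAlgebra.tmul M (E.inner ξ ζ) (F.inner η κ)
  dense : (Submodule.span ℂ {x : G | ∃ (ξ : E) (η : F), x = τ ξ η}).topologicalClosure = ⊤

/-- The functor `Φ : Hilb_A ⊠ Hilb_B → Hilb_{A ⊗ B}` is induced by the exterior tensor product of
Hilbert modules: it maps the object `E ⊠ F` to the exterior tensor product `E ⊗ F`, and the morphism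
`S ⊠ T` to the operator `ξ ⊗ η ↦ S ξ ⊗ T η`. -/
def IsInducedByExteriorTensor (N : CStarSeminorm (boxdot (Hilb A) (Hilb B)))
    (M : CStarSeminorm (boxdot (ofAlgebra A) (ofAlgebra B)))
    (Φ : StarFunctor (boxtimes N) (Hilb (TensorAlgebra M))) : Prop :=
  ∃ τ : ∀ (E : (Hilb A).Obj) (F : (Hilb B).Obj),
      Hilb.mod E →ₗ[ℂ] Hilb.mod F →ₗ[ℂ] Hilb.mod (Φ.obj (boxtimesObj N E F)),
    (∀ E F, IsExteriorTensor M (Hilb.mod E) (Hilb.mod F) _ (τ E F)) ∧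
    ∀ (E E' : (Hilb A).Obj) (F F' : (Hilb B).Obj) (S : (Hilb A).Hom E E') (T : (Hilb B).Hom F F')
      (ξ : Hilb.mod E) (η : Hilb.mod F),
      Hilb.op (Φ.map (boxtimesMap N S T)) (τ E F ξ η) = τ E' F' (Hilb.op S ξ) (Hilb.op T η)

end exterior

end CStarTensor

end

/-!
The equivalences come from a description of categories of Hilbert modules by one generating object.

Call an object `P` of a `C*`-category `C` *generating* if the morphisms `g ∘ h*` with `g : P → Y` and
`h : P → X` span a dense subspace of `C(X, Y)` for all `X`, `Y` (`IsGenerating`). If the algebra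
`C(P, P)` is identified with `T`, then every space `C(P, X)` becomes a Hilbert `T`-module with inner
product `⟨g, h⟩ = g* ∘ h`, and `X ↦ C(P, X)` is a fully faithful functor to Hilbert `T`-modules:
finite-rank operators correspond to the morphisms `g ∘ h*`, so density on both sides suffices
(`homFunctor_fullyFaithful`). For `C` the completion of `Hilb_A ⊙ Hilb_B`, or its subobject
completion, `P = (A, B)` is generating because `A` generates `Hilb_A`. Its endomorphism algebra is
the completion of `K(A) ⊙ K(B) = A ⊙ B`, provided that the given norm on `Hilb_A ⊙ Hilb_B` extends
the given norm on `A ⊙ B` (`CStarSeminorm.Extends`, `tensorEndIso`). Under this identification the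
module `C((A, B), (E, F))` is the exterior tensor product `E ⊗ F`, since `E = K(A, E)` and
`F = K(B, F)`. A unitary between `H_A ⊗ H_B` and `H_{A ⊗ B}`, given by a bijection
`ℕ × ℕ ≃ ℕ`, shows that all modules obtained in this way are direct summands of `H_{A ⊗ B}` and, with
the passage to subobjects, that every such summand occurs. This proves the theorem for any two
compatible norms (`exists_isEquivalence_of_extends`); it only uses `‖f ⊗ g‖ ≤ ‖f‖ ‖g‖`.

It remains to compare norms. For the minimal norms this amounts to the independence of the spatial
norm on `A ⊙ B` of the choice of faithful representations (`norm_spatial_eq`). Exchanging the two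
factors, it is enough to vary the representation of `A`. On vectors in `H ⊙ N` with `N ⊆ K` finite
dimensional, an element of `A ⊙ B` acts, up to compression to `N`, as a matrix with entries in `A`,
and injective representations of `M_n(A)` are isometric.

For the maximal norms, every representation of `Hilb_A ⊙ Hilb_B` restricts to `A ⊙ B`. Conversely a
representation `π` of `A ⊙ B` on `H` is induced to `Hilb_A ⊙ Hilb_B`, acting on the Hilbert spaces
`(E ⊗ F) ⊗_π H` (`TensorRep.induce`). The inner product is positive because the space embeds in
`ℓ²(ℕ × ℕ, H)` by `ξ ⊗ η ⊗ h ↦ (π(ξ_m ⊗ η_n) h)_{m,n}`. The operators `S ⊗ T ⊗ 1` are bounded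
because the formally self-adjoint operator `R = S* S ⊗ T* T ⊗ 1` satisfies `‖R^k x‖ ≤ C_x r^k` with
`r = ‖S* S‖ ‖T* T‖`, which implies `‖R x‖ ≤ r ‖x‖` (`le_mul_of_sq_le`).
-/

noncomputable section

set_option linter.checkUnivs false

namespace CStarTensor

open HilbertModule

/-! ### Approximate units and fully faithful functors -/

lemma exists_selfAdjoint_norm_conj_lt {A : Type u} [NonUnitalCStarAlgebra A] (c : A) {ε : ℝ}
    (hε : 0 < ε) : ∃ e : A, star e = e ∧ ‖e‖ ≤ 1 ∧ ‖c - c * e - e * c + e * (c * e)‖ < ε := by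
  let _ := CStarAlgebra.spectralOrder A
  have _ := CStarAlgebra.spectralOrderedRing A
  have hl := CStarAlgebra.increasingApproximateUnit A
  have h1 := (hl.tendsto_mul_left c)
  have h2 : ∀ᶠ e in CStarAlgebra.approximateUnit A, dist (c * e) c < ε / 2 :=
    Metric.tendsto_nhds.mp h1 _ (half_pos hε)
  have := hl.neBot
  obtain ⟨e, he, hn, hs⟩ := (h2.and (hl.eventually_norm.and hl.eventually_star_eq)).exists
  refine ⟨e, hs, hn, ?_⟩
  rw [dist_comm, dist_eq_norm] at he
  have e1 : c - c * e - e * c + e * (c * e) = (c - c * e) - e * (c - c * e) := by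
    rw [mul_sub]; abel
  rw [e1]
  calc _ ≤ ‖c - c * e‖ + ‖e * (c - c * e)‖ := norm_sub_le _ _
    _ ≤ ‖c - c * e‖ + 1 * ‖c - c * e‖ := by
        gcongr
        exact (norm_mul_le _ _).trans (by gcongr)
    _ < ε := by linarith

namespace CStarCat

variable (V : CStarCat.{u, v})

lemma exists_norm_sub_comp_lt {X Y : V.Obj} (f : V.Hom X Y) {ε : ℝ} (hε : 0 < ε) :
    ∃ e : V.Hom X X, ‖f - V.comp f e‖ < ε := by
  obtain ⟨e, he', -, h2⟩ : ∃ e : V.Hom X X, V.adj e = e ∧ ‖e‖ ≤ 1 ∧ ‖V.comp (V.adj f) f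
      - V.comp (V.comp (V.adj f) f) e - V.comp e (V.comp (V.adj f) f)
        + V.comp e (V.comp (V.comp (V.adj f) f) e)‖ < ε * ε :=
    exists_selfAdjoint_norm_conj_lt (A := V.End X) (V.comp (V.adj f) f : V.Hom X X) (mul_pos hε hε)
  refine ⟨e, ?_⟩
  have h1 : V.comp (V.adj (f - V.comp f e)) (f - V.comp f e) =
      V.comp (V.adj f) f - V.comp (V.comp (V.adj f) f) e - V.comp e (V.comp (V.adj f) f)
        + V.comp e (V.comp (V.comp (V.adj f) f) e) := by
    simp only [map_sub, LinearMap.sub_apply, V.adj_comp, V.assoc, he']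
    abel
  rw [← h1, V.norm_adj_comp_self] at h2
  exact lt_of_mul_self_lt_mul_self₀ hε.le h2

lemma exists_norm_sub_comp_lt' {X Y : V.Obj} (f : V.Hom X Y) {ε : ℝ} (hε : 0 < ε) :
    ∃ e : V.Hom Y Y, ‖f - V.comp e f‖ < ε := by
  obtain ⟨e, he⟩ := V.exists_norm_sub_comp_lt (V.adj f) hε
  refine ⟨V.adj e, ?_⟩
  rwa [← V.norm_adj, map_sub, V.adj_comp, V.adj_adj]

lemma eq_of_comp_eq {X Y : V.Obj} {f g : V.Hom X Y}
    (h : ∀ k : V.Hom X X, V.comp f k = V.comp g k) : f = g := by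
  rw [← sub_eq_zero, ← norm_eq_zero]
  refine le_antisymm (le_of_forall_pos_le_add fun ε hε => ?_) (norm_nonneg _)
  obtain ⟨e, he⟩ := V.exists_norm_sub_comp_lt (f - g) hε
  rw [V.comp.map_sub₂, h, sub_self, sub_zero] at he
  linarith

end CStarCat

namespace Multiplier

variable {V : CStarCat.{u, v}} {X Y Z W : V.Obj}

lemma adj_L (m : Multiplier V X Y) (f : V.Hom Z Y) : m.adj.L Z f = V.adj (m.R Z (V.adj f)) := rfl

lemma adj_R (m : Multiplier V X Y) (f : V.Hom X Z) : m.adj.R Z f = V.adj (m.L Z (V.adj f)) := rfl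

/-- Left and right multiplication commute, although neither is given by a morphism. -/
lemma L_R_comm (m : Multiplier V Y Z) (n : Multiplier V W X) (f : V.Hom X Y) :
    m.L W (n.R Y f) = n.R Z (m.L X f) :=
  V.eq_of_comp_eq fun k => by
    rw [← m.L_comp, ← n.compat, ← n.compat, m.L_comp]

lemma IsUnitary.adj_L_L {m : Multiplier V X Y} (h : m.IsUnitary) (f : V.Hom Z X) :
    m.adj.L Z (m.L Z f) = f := congrArg (fun n => n.L Z f) h.1

lemma IsUnitary.L_adj_L {m : Multiplier V X Y} (h : m.IsUnitary) (f : V.Hom Z Y) :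
    m.L Z (m.adj.L Z f) = f := congrArg (fun n => n.L Z f) h.2

lemma IsUnitary.R_adj_R {m : Multiplier V X Y} (h : m.IsUnitary) (f : V.Hom X Z) :
    m.R Z (m.adj.R Z f) = f := congrArg (fun n => n.R Z f) h.1

lemma IsUnitary.adj_R_R {m : Multiplier V X Y} (h : m.IsUnitary) (f : V.Hom Y Z) :
    m.adj.R Z (m.R Z f) = f := congrArg (fun n => n.R Z f) h.2

end Multiplier

namespace StarFunctor

variable {V : CStarCat.{u₁, v₁}} {W : CStarCat.{u₂, v₂}} (F : StarFunctor V W)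

/-- The `*`-homomorphism between endomorphism algebras defined by a `*`-functor. -/
def endHom (X : V.Obj) : V.End X →⋆ₙₐ[ℂ] W.End (F.obj X) where
  toFun f := F.map (X := X) (Y := X) f
  map_smul' c f := (F.map (X := X) (Y := X)).map_smul c f
  map_zero' := (F.map (X := X) (Y := X)).map_zero
  map_add' f g := (F.map (X := X) (Y := X)).map_add f g
  map_mul' f g := F.map_comp (X := X) (Y := X) (Z := X) f g
  map_star' f := F.map_adj (X := X) (Y := X) f

lemma norm_map_of_injective (hF : ∀ X : V.Obj, Function.Injective (F.map (X := X) (Y := X)))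
    {X Y : V.Obj} (f : V.Hom X Y) : ‖F.map f‖ = ‖f‖ := by
  have h1 : ‖F.map (V.comp (V.adj f) f)‖ = ‖V.comp (V.adj f) f‖ :=
    NonUnitalStarAlgHom.norm_map (A := V.End X) (B := W.End (F.obj X)) (F.endHom X) (hF X)
      (V.comp (V.adj f) f : V.Hom X X)
  rw [F.map_comp, F.map_adj, W.norm_adj_comp_self, V.norm_adj_comp_self] at h1
  exact (mul_self_inj (norm_nonneg _) (norm_nonneg _)).mp h1

/-- A `*`-functor is fully faithful if it is bijective on the spaces of morphisms. -/
def FullyFaithful : Prop :=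
  ∀ X Y : V.Obj, Function.Bijective (F.map (X := X) (Y := Y))

variable {F}

lemma FullyFaithful.nondegenerate (hF : F.FullyFaithful) : F.Nondegenerate := by
  intro X Y
  refine ⟨?_, ?_⟩ <;> refine (eq_top_iff).mpr fun h _ => Metric.mem_closure_iff.mpr fun ε hε => ?_
  · obtain ⟨e, he⟩ := W.exists_norm_sub_comp_lt' h hε
    obtain ⟨e', rfl⟩ := (hF Y Y).2 e
    exact ⟨_, Submodule.subset_span ⟨e', h, rfl⟩, by rwa [dist_eq_norm]⟩
  · obtain ⟨e, he⟩ := W.exists_norm_sub_comp_lt h hε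
    obtain ⟨e', rfl⟩ := (hF X X).2 e
    exact ⟨_, Submodule.subset_span ⟨h, e', rfl⟩, by rwa [dist_eq_norm]⟩

/-- The linear isomorphisms between spaces of morphisms defined by a fully faithful functor. -/
def FullyFaithful.homEquiv (hF : F.FullyFaithful) (X Y : V.Obj) :
    V.Hom X Y ≃ₗ[ℂ] W.Hom (F.obj X) (F.obj Y) :=
  LinearEquiv.ofBijective F.map (hF X Y)

lemma FullyFaithful.map_symm (hF : F.FullyFaithful) {X Y : V.Obj}
    (f : W.Hom (F.obj X) (F.obj Y)) : F.map ((hF.homEquiv X Y).symm f) = f :=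
  (hF.homEquiv X Y).apply_symm_apply f

lemma FullyFaithful.norm_map (hF : F.FullyFaithful) {X Y : V.Obj} (f : V.Hom X Y) :
    ‖F.map f‖ = ‖f‖ :=
  F.norm_map_of_injective (fun X => (hF X X).1) f

/-- Multiplier morphisms can be pulled back along fully faithful functors. -/
def FullyFaithful.pullback (hF : F.FullyFaithful) {X Y : V.Obj}
    (m : Multiplier W (F.obj X) (F.obj Y)) : Multiplier V X Y where
  L Z := (hF.homEquiv Z Y).symm.toLinearMap ∘ₗ m.L (F.obj Z) ∘ₗ F.map
  R Z := (hF.homEquiv X Z).symm.toLinearMap ∘ₗ m.R (F.obj Z) ∘ₗ F.map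
  bound_L := by
    obtain ⟨C, hC⟩ := m.bound_L
    refine ⟨C, fun Z h => ?_⟩
    rw [← hF.norm_map, ← hF.norm_map h]
    simpa only [LinearMap.comp_apply, LinearEquiv.coe_coe, hF.map_symm] using hC _ (F.map h)
  bound_R := by
    obtain ⟨C, hC⟩ := m.bound_R
    refine ⟨C, fun Z h => ?_⟩
    rw [← hF.norm_map, ← hF.norm_map h]
    simpa only [LinearMap.comp_apply, LinearEquiv.coe_coe, hF.map_symm] using hC _ (F.map h)
  L_comp h g := (hF _ _).1 <| by
    simp only [LinearMap.comp_apply, LinearEquiv.coe_coe, hF.map_symm, F.map_comp, m.L_comp]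
  R_comp h g := (hF _ _).1 <| by
    simp only [LinearMap.comp_apply, LinearEquiv.coe_coe, hF.map_symm, F.map_comp, m.R_comp]
  compat f g := (hF _ _).1 <| by
    simp only [LinearMap.comp_apply, LinearEquiv.coe_coe, hF.map_symm, F.map_comp, m.compat]

lemma FullyFaithful.map_pullback_L (hF : F.FullyFaithful) {X Y Z : V.Obj}
    (m : Multiplier W (F.obj X) (F.obj Y)) (f : V.Hom Z X) :
    F.map ((hF.pullback m).L Z f) = m.L _ (F.map f) := hF.map_symm _

lemma FullyFaithful.map_pullback_R (hF : F.FullyFaithful) {X Y Z : V.Obj}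
    (m : Multiplier W (F.obj X) (F.obj Y)) (f : V.Hom Y Z) :
    F.map ((hF.pullback m).R Z f) = m.R _ (F.map f) := hF.map_symm _

lemma FullyFaithful.pullback_adj (hF : F.FullyFaithful) {X Y : V.Obj}
    (m : Multiplier W (F.obj X) (F.obj Y)) : (hF.pullback m).adj = hF.pullback m.adj := by
  ext Z f <;> refine (hF _ _).1 ?_
  · rw [Multiplier.adj_L, F.map_adj, hF.map_pullback_R, F.map_adj, hF.map_pullback_L,
      Multiplier.adj_L]
  · rw [Multiplier.adj_R, F.map_adj, hF.map_pullback_L, F.map_adj, hF.map_pullback_R,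
      Multiplier.adj_R]

lemma FullyFaithful.pullback_comp (hF : F.FullyFaithful) {X Y Z : V.Obj}
    (m : Multiplier W (F.obj Y) (F.obj Z)) (n : Multiplier W (F.obj X) (F.obj Y)) :
    (hF.pullback m).comp (hF.pullback n) = hF.pullback (m.comp n) := by
  ext U f <;> refine (hF _ _).1 ?_
  · change F.map ((hF.pullback m).L _ ((hF.pullback n).L _ f)) = _
    rw [hF.map_pullback_L, hF.map_pullback_L, hF.map_pullback_L]
    rfl
  · change F.map ((hF.pullback n).R _ ((hF.pullback m).R _ f)) = _
    rw [hF.map_pullback_R, hF.map_pullback_R, hF.map_pullback_R]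
    rfl

lemma FullyFaithful.pullback_id (hF : F.FullyFaithful) (X : V.Obj) :
    hF.pullback (Multiplier.id W (F.obj X)) = Multiplier.id V X := by
  ext U f <;> refine (hF _ _).1 ?_
  · exact hF.map_pullback_L _ _
  · exact hF.map_pullback_R _ _

lemma FullyFaithful.isUnitary_pullback (hF : F.FullyFaithful) {X Y : V.Obj}
    {m : Multiplier W (F.obj X) (F.obj Y)} (hm : m.IsUnitary) : (hF.pullback m).IsUnitary :=
  ⟨by rw [hF.pullback_adj, hF.pullback_comp, hm.1, hF.pullback_id],
    by rw [hF.pullback_adj, hF.pullback_comp, hm.2, hF.pullback_id]⟩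

lemma FullyFaithful.isProjection_pullback (hF : F.FullyFaithful) {X : V.Obj}
    {m : Multiplier W (F.obj X) (F.obj X)} (hm : m.IsProjection) :
    (hF.pullback m).IsProjection :=
  ⟨by rw [hF.pullback_comp, hm.1], by rw [hF.pullback_adj, hm.2]⟩

/-- The quasi-inverse of a fully faithful functor `F`, defined by a choice of unitary
multipliers `F X → Y`. -/
def FullyFaithful.inverse (hF : F.FullyFaithful) (o : W.Obj → V.Obj)
    (m : ∀ Y, Multiplier W (F.obj (o Y)) Y) (hm : ∀ Y, (m Y).IsUnitary) : StarFunctor W V where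
  obj := o
  map {Y Y'} := (hF.homEquiv (o Y) (o Y')).symm.toLinearMap ∘ₗ (m Y').adj.L _ ∘ₗ (m Y).R Y'
  map_comp {X Y Z} g f := (hF _ _).1 <| by
    simp only [LinearMap.comp_apply, LinearEquiv.coe_coe, hF.map_symm, F.map_comp]
    rw [(m X).R_comp, (m Z).adj.L_comp, (m Z).adj.L_R_comm, ← (m Y).compat, (hm Y).L_adj_L]
  map_adj {X Y} f := (hF _ _).1 <| by
    simp only [LinearMap.comp_apply, LinearEquiv.coe_coe, hF.map_symm, F.map_adj]
    rw [Multiplier.L_R_comm, Multiplier.adj_L, W.adj_adj, Multiplier.adj_L, W.adj_adj]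

lemma FullyFaithful.map_inverse (hF : F.FullyFaithful) (o : W.Obj → V.Obj)
    (m : ∀ Y, Multiplier W (F.obj (o Y)) Y) (hm : ∀ Y, (m Y).IsUnitary) {Y Y' : W.Obj}
    (f : W.Hom Y Y') :
    F.map ((hF.inverse o m hm).map f) = (m Y').adj.L _ ((m Y).R Y' f) :=
  hF.map_symm _

lemma FullyFaithful.L_map_inverse (hF : F.FullyFaithful) (o : W.Obj → V.Obj)
    (m : ∀ Y, Multiplier W (F.obj (o Y)) Y) (hm : ∀ Y, (m Y).IsUnitary) {Y Y' : W.Obj}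
    (f : W.Hom Y Y') :
    (m Y').L (F.obj (o Y)) (F.map ((hF.inverse o m hm).map f)) = (m Y).R Y' f :=
  (congrArg _ (hF.map_inverse o m hm f)).trans ((hm Y').L_adj_L _)

/-- A fully faithful and essentially surjective `*`-functor is an equivalence. -/
theorem FullyFaithful.isEquivalence (hF : F.FullyFaithful)
    (hs : ∀ Y : W.Obj, ∃ (X : V.Obj) (m : Multiplier W (F.obj X) Y), m.IsUnitary) :
    F.IsEquivalence := by
  choose o m hm using hs
  have hG : (hF.inverse o m hm).FullyFaithful := by
    refine fun X Y => ⟨fun f g h => ?_, fun f => ⟨(m Y).L _ ((m X).adj.R _ (F.map f)), ?_⟩⟩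
    · have h' := congrArg F.map h
      rw [hF.map_inverse, hF.map_inverse] at h'
      have h2 := congrArg ((m Y).L _) h'
      rw [(hm Y).L_adj_L, (hm Y).L_adj_L] at h2
      have h3 := congrArg ((m X).adj.R _) h2
      rwa [(hm X).adj_R_R, (hm X).adj_R_R] at h3
    · refine (hF _ _).1 ?_
      rw [hF.map_inverse, Multiplier.L_R_comm, (hm Y).adj_L_L, (hm X).R_adj_R]
      rfl
  refine ⟨hF.nondegenerate, hF.inverse o m hm, hG.nondegenerate,
    ⟨fun X => hF.pullback (m (F.obj X)), fun X => hF.isUnitary_pullback (hm _), ?_⟩,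
    ⟨m, hm, ?_⟩⟩
  · intro X Y f
    refine (hF _ _).1 ?_
    exact (hF.map_pullback_L _ _).trans
      ((hF.L_map_inverse o m hm _).trans (hF.map_pullback_R _ _).symm)
  · intro X Y f
    exact hF.L_map_inverse o m hm f

end StarFunctor

/-! ### Adjointable operators as multipliers of `Hilb_A` -/

namespace HilbertModule

variable {A : Type u} [NonUnitalCStarAlgebra A] {E F G : HilbertModule.{u, w} A}

lemma rankOne_mem_compactOps (x : F) (y : E) : rankOne x y ∈ compactOps E F :=
  Submodule.le_topologicalClosure _ (Submodule.subset_span ⟨x, y, rfl⟩)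

lemma IsAdjoint.comp_compactOps {T : F →L[ℂ] G} {S : G →L[ℂ] F} (h : IsAdjoint T S)
    {K : E →L[ℂ] F} (hK : K ∈ compactOps E F) : T.comp K ∈ compactOps E G := by
  let Φ : (E →L[ℂ] F) →L[ℂ] (E →L[ℂ] G) := ContinuousLinearMap.compL ℂ E F G T
  have hle : compactOps E F ≤ (compactOps E G).comap Φ.toLinearMap := by
    refine Submodule.topologicalClosure_minimal _ (Submodule.span_le.mpr ?_)
      ((isClosed_compactOps E G).preimage Φ.continuous)
    rintro _ ⟨x, y, rfl⟩
    have h1 : Φ (rankOne x y) = rankOne (T x) y := comp_rankOne h x y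
    exact (congrArg (· ∈ compactOps E G) h1).mpr (rankOne_mem_compactOps _ _)
  exact hle hK

lemma rankOne_comp {T : E →L[ℂ] F} {S : F →L[ℂ] E} (h : IsAdjoint T S) (x : G) (y : F) :
    (rankOne x y).comp T = rankOne x (S y) :=
  ContinuousLinearMap.ext fun z => congrArg (G.act x) (h.symm y z).symm

lemma IsAdjoint.compactOps_comp {T : E →L[ℂ] F} {S : F →L[ℂ] E} (h : IsAdjoint T S)
    {K : F →L[ℂ] G} (hK : K ∈ compactOps F G) : K.comp T ∈ compactOps E G := by
  let Φ : (F →L[ℂ] G) →L[ℂ] (E →L[ℂ] G) := (ContinuousLinearMap.compL ℂ E F G).flip T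
  have hle : compactOps F G ≤ (compactOps E G).comap Φ.toLinearMap := by
    refine Submodule.topologicalClosure_minimal _ (Submodule.span_le.mpr ?_)
      ((isClosed_compactOps E G).preimage Φ.continuous)
    rintro _ ⟨x, y, rfl⟩
    have h1 : Φ (rankOne x y) = rankOne x (S y) := rankOne_comp h x y
    exact (congrArg (· ∈ compactOps E G) h1).mpr (rankOne_mem_compactOps _ _)
  exact hle hK

lemma isAdjoint_id : IsAdjoint (ContinuousLinearMap.id ℂ E) (ContinuousLinearMap.id ℂ E) :=
  fun _ _ => rfl

end HilbertModule

section adjointable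

variable {A : Type u} [NonUnitalCStarAlgebra A]

/-- The morphism of `Hilb_A` given by a compact operator. -/
def Hilb.ofCompact {E F : (Hilb A).Obj} (K : Hilb.mod E →L[ℂ] Hilb.mod F)
    (hK : K ∈ compactOps (Hilb.mod E) (Hilb.mod F)) : (Hilb A).Hom E F :=
  (⟨K, hK⟩ : compactOps (Hilb.mod E) (Hilb.mod F))

lemma Hilb.op_mem {E F : (Hilb A).Obj} (K : (Hilb A).Hom E F) :
    Hilb.op K ∈ compactOps (Hilb.mod E) (Hilb.mod F) :=
  (show compactOps (Hilb.mod E) (Hilb.mod F) from K).2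

lemma Hilb.op_injective {E F : (Hilb A).Obj} :
    Function.Injective (Hilb.op : (Hilb A).Hom E F → _) := fun _ _ h => Subtype.ext h

lemma Hilb.op_comp {E F G : (Hilb A).Obj} (K : (Hilb A).Hom F G) (K' : (Hilb A).Hom E F) :
    Hilb.op ((Hilb A).comp K K') = (Hilb.op K).comp (Hilb.op K') := rfl

lemma Hilb.isAdjoint_op {E F : (Hilb A).Obj} (K : (Hilb A).Hom E F) :
    IsAdjoint (Hilb.op K) (Hilb.op ((Hilb A).adj K)) :=
  isAdjoint_compactAdj (show compactOps (Hilb.mod E) (Hilb.mod F) from K)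

/-- An adjointable operator defines a multiplier morphism in `Hilb_A`. -/
def Hilb.multiplier {E F : (Hilb A).Obj} {T : Hilb.mod E →L[ℂ] Hilb.mod F}
    {S : Hilb.mod F →L[ℂ] Hilb.mod E} (h : IsAdjoint T S) : Multiplier (Hilb A) E F where
  L _ :=
    { toFun := fun K => Hilb.ofCompact (T.comp (Hilb.op K)) (h.comp_compactOps (Hilb.op_mem K))
      map_add' := fun K K' => Subtype.ext (ContinuousLinearMap.comp_add T (Hilb.op K) (Hilb.op K'))
      map_smul' := fun c K => Subtype.ext (ContinuousLinearMap.comp_smul T c (Hilb.op K)) }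
  R _ :=
    { toFun := fun K => Hilb.ofCompact ((Hilb.op K).comp T) (h.compactOps_comp (Hilb.op_mem K))
      map_add' := fun K K' => Subtype.ext (ContinuousLinearMap.add_comp (Hilb.op K) (Hilb.op K') T)
      map_smul' := fun c K => Subtype.ext (ContinuousLinearMap.smul_comp c (Hilb.op K) T) }
  bound_L := ⟨‖T‖, fun _ K => T.opNorm_comp_le (Hilb.op K)⟩
  bound_R := ⟨‖T‖, fun _ K => ((Hilb.op K).opNorm_comp_le T).trans (mul_comm _ _).le⟩
  L_comp _ _ := rfl
  R_comp _ _ := rfl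
  compat _ _ := rfl

lemma Hilb.op_multiplier_L {E F Z : (Hilb A).Obj} {T : Hilb.mod E →L[ℂ] Hilb.mod F}
    {S : Hilb.mod F →L[ℂ] Hilb.mod E} (h : IsAdjoint T S) (K : (Hilb A).Hom Z E) :
    Hilb.op ((Hilb.multiplier h).L Z K) = T.comp (Hilb.op K) := rfl

lemma Hilb.op_multiplier_R {E F Z : (Hilb A).Obj} {T : Hilb.mod E →L[ℂ] Hilb.mod F}
    {S : Hilb.mod F →L[ℂ] Hilb.mod E} (h : IsAdjoint T S) (K : (Hilb A).Hom F Z) :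
    Hilb.op ((Hilb.multiplier h).R Z K) = (Hilb.op K).comp T := rfl

lemma Hilb.adj_multiplier {E F : (Hilb A).Obj} {T : Hilb.mod E →L[ℂ] Hilb.mod F}
    {S : Hilb.mod F →L[ℂ] Hilb.mod E} (h : IsAdjoint T S) :
    (Hilb.multiplier h).adj = Hilb.multiplier h.symm := by
  ext Z K <;> refine Hilb.op_injective ?_
  · rw [Multiplier.adj_L, Hilb.op_multiplier_L]
    refine (Hilb.isAdjoint_op _).unique ?_
    rw [Hilb.op_multiplier_R]
    exact ((Hilb.isAdjoint_op K).symm.comp h)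
  · rw [Multiplier.adj_R, Hilb.op_multiplier_R]
    refine (Hilb.isAdjoint_op _).unique ?_
    rw [Hilb.op_multiplier_L]
    exact h.comp (Hilb.isAdjoint_op K).symm

lemma Hilb.isUnitary_multiplier {E F : (Hilb A).Obj} {T : Hilb.mod E →L[ℂ] Hilb.mod F}
    {S : Hilb.mod F →L[ℂ] Hilb.mod E} (h : IsAdjoint T S)
    (h1 : S.comp T = ContinuousLinearMap.id ℂ _) (h2 : T.comp S = ContinuousLinearMap.id ℂ _) :
    (Hilb.multiplier h).IsUnitary := by
  rw [Multiplier.IsUnitary, Hilb.adj_multiplier]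
  refine ⟨?_, ?_⟩ <;> ext Z K <;> refine Hilb.op_injective ?_
  · exact congrArg (fun R => R.comp (Hilb.op K)) h1
  · exact congrArg (fun R => (Hilb.op K).comp R) h1
  · exact congrArg (fun R => R.comp (Hilb.op K)) h2
  · exact congrArg (fun R => (Hilb.op K).comp R) h2

lemma Hilb.isProjection_multiplier {E : (Hilb A).Obj} {Q : Hilb.mod E →L[ℂ] Hilb.mod E}
    (h : IsAdjoint Q Q) (h1 : Q.comp Q = Q) : (Hilb.multiplier h).IsProjection := by
  rw [Multiplier.IsProjection, Hilb.adj_multiplier]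
  refine ⟨?_, rfl⟩
  ext Z K <;> refine Hilb.op_injective ?_
  · exact congrArg (fun R => R.comp (Hilb.op K)) h1
  · exact congrArg (fun R => (Hilb.op K).comp R) h1

end adjointable

/-! ### The Hilbert modules of morphisms out of a generating object -/

/-- An identification of a `C*`-algebra `T` with the endomorphism algebra of an object `P`. -/
structure EndIso (C : CStarCat.{u, v}) (P : C.Obj) (T : Type w) [NonUnitalCStarAlgebra T] where
  hom : T →ₗ[ℂ] C.Hom P P
  inv : C.Hom P P →ₗ[ℂ] T
  inv_hom : ∀ a, inv (hom a) = a
  hom_inv : ∀ f, hom (inv f) = f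
  hom_mul : ∀ a b, hom (a * b) = C.comp (hom a) (hom b)
  hom_star : ∀ a, hom (star a) = C.adj (hom a)

namespace EndIso

variable {C : CStarCat.{u, v}} {P : C.Obj} {T : Type w} [NonUnitalCStarAlgebra T]
  (φ : EndIso C P T)

lemma norm_hom (a : T) : ‖φ.hom a‖ = ‖a‖ :=
  NonUnitalStarAlgHom.norm_map (A := T) (B := C.End P)
    ({ toFun := fun a => φ.hom a
       map_smul' := fun c a => φ.hom.map_smul c a
       map_zero' := φ.hom.map_zero
       map_add' := fun a b => φ.hom.map_add a b
       map_mul' := φ.hom_mul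
       map_star' := φ.hom_star } : T →⋆ₙₐ[ℂ] C.End P)
    (fun a b h => by rw [← φ.inv_hom a, ← φ.inv_hom b]; exact congrArg φ.inv h) a

lemma norm_inv (f : C.Hom P P) : ‖φ.inv f‖ = ‖f‖ := by
  rw [← φ.norm_hom, φ.hom_inv]

lemma inv_comp (f g : C.Hom P P) : φ.inv (C.comp f g) = φ.inv f * φ.inv g := by
  rw [← φ.inv_hom (φ.inv f * φ.inv g), φ.hom_mul, φ.hom_inv, φ.hom_inv]

lemma inv_adj (f : C.Hom P P) : φ.inv (C.adj f) = star (φ.inv f) := by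
  rw [← φ.inv_hom (star (φ.inv f)), φ.hom_star, φ.hom_inv]

end EndIso

section homModule

variable {C : CStarCat.{u, w}} {P : C.Obj} {T : Type w} [NonUnitalCStarAlgebra T]
  (φ : EndIso C P T)

/-- The Hilbert module `C(P, X)` over `T ≅ C(P, P)`, with inner product `⟨g, h⟩ = g* ∘ h`. -/
def homModule (X : C.Obj) : HilbertModule.{w, w} T where
  carrier := C.Hom P X
  core :=
    { act := fun g t => C.comp g (φ.hom t)
      inner := fun g h => φ.inv (C.comp (C.adj g) h)
      inner_add_right := fun x y z => by rw [map_add, map_add]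
      inner_smul_right := fun x c y => by rw [map_smul, map_smul]
      inner_act := fun x y a => by rw [← C.assoc, φ.inv_comp, φ.inv_hom]
      star_inner := fun x y => by rw [← φ.inv_adj, C.adj_comp, C.adj_adj]
      inner_self_pos := fun x => by
        obtain ⟨g, hg⟩ := C.pos x
        exact ⟨φ.inv g, by rw [hg, φ.inv_comp, φ.inv_adj]⟩
      definite := fun x h => by
        have h1 := C.norm_adj_comp_self x
        rw [← φ.norm_inv, h, norm_zero] at h1
        exact norm_eq_zero.mp (mul_self_eq_zero.mp h1.symm) }
  norm_sq x := by rw [φ.norm_inv, C.norm_adj_comp_self]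

/-- An element of `C(P, X)`, considered as morphism. -/
def homModule.hom {X : C.Obj} (g : homModule φ X) : C.Hom P X := g

/-- A morphism `P → X`, considered as element of the Hilbert module `C(P, X)`. -/
def homModule.of {X : C.Obj} (g : C.Hom P X) : homModule φ X := g

/-- Left composition with a morphism `X → Y` as an operator `C(P, X) → C(P, Y)`. -/
def leftComp (X Y : C.Obj) : C.Hom X Y →L[ℂ] (homModule φ X →L[ℂ] homModule φ Y) :=
  LinearMap.mkContinuous₂ (C.comp (X := P) (Y := X) (Z := Y)) 1 fun f g =>
    (C.norm_comp_le f g).trans (by rw [one_mul]; rfl)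

open HilbertModule

lemma isAdjoint_leftComp {X Y : C.Obj} (f : C.Hom X Y) :
    IsAdjoint (leftComp φ X Y f) (leftComp φ Y X (C.adj f)) := by
  have key : ∀ (x : C.Hom P X) (y : C.Hom P Y), φ.inv (C.comp (C.adj (C.comp f x)) y) =
      φ.inv (C.comp (C.adj x) (C.comp (C.adj f) y)) := fun x y => by
    rw [C.adj_comp, C.assoc]
  exact key

lemma leftComp_comp_adj {X Y : C.Obj} (g : C.Hom P Y) (h : C.Hom P X) :
    leftComp φ X Y (C.comp g (C.adj h)) = rankOne (homModule.of φ g) (homModule.of φ h) := by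
  have key : ∀ z : C.Hom P X, C.comp (C.comp g (C.adj h)) z =
      C.comp g (φ.hom (φ.inv (C.comp (C.adj h) z))) := fun z => by
    rw [φ.hom_inv, C.assoc]
  exact ContinuousLinearMap.ext key

variable (P) in
/-- The object `P` generates `C`: every morphism is a limit of linear combinations of morphisms
`g ∘ h*` with `g` and `h` defined on `P`. -/
def IsGenerating : Prop :=
  ∀ X Y : C.Obj, (Submodule.span ℂ {f : C.Hom X Y | ∃ (g : C.Hom P Y) (h : C.Hom P X),
    f = C.comp g (C.adj h)}).topologicalClosure = ⊤

variable {φ}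

lemma IsGenerating.induction (hP : IsGenerating P) {X Y : C.Obj} {S : Submodule ℂ (C.Hom X Y)}
    (hS : IsClosed (S : Set (C.Hom X Y)))
    (h : ∀ (g : C.Hom P Y) (h : C.Hom P X), C.comp g (C.adj h) ∈ S) (f : C.Hom X Y) : f ∈ S := by
  have h1 : (⊤ : Submodule ℂ (C.Hom X Y)) ≤ S := by
    rw [← hP X Y]
    refine Submodule.topologicalClosure_minimal _ (Submodule.span_le.mpr ?_) hS
    rintro _ ⟨g, k, rfl⟩
    exact h g k
  exact h1 trivial

lemma IsGenerating.leftComp_mem (hP : IsGenerating P) {X Y : C.Obj} (f : C.Hom X Y) :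
    leftComp φ X Y f ∈ compactOps (homModule φ X) (homModule φ Y) := by
  refine hP.induction (S := (compactOps (homModule φ X) (homModule φ Y)).comap
    (leftComp φ X Y).toLinearMap)
    ((isClosed_compactOps _ _).preimage (leftComp φ X Y).continuous) (fun g h => ?_) f
  exact (congrArg (· ∈ compactOps _ _) (leftComp_comp_adj φ g h)).mpr (rankOne_mem_compactOps _ _)

lemma IsGenerating.leftComp_injective (hP : IsGenerating P) (X Y : C.Obj) :
    Function.Injective (leftComp φ X Y) := by
  refine (injective_iff_map_eq_zero (leftComp φ X Y)).mpr fun f hf => ?_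
  refine C.eq_of_comp_eq fun k => ?_
  have hc : Continuous (C.comp (X := X) f) :=
    ((C.comp (X := X) f).mkContinuous ‖f‖ fun k => C.norm_comp_le f k).continuous
  rw [C.comp.map_zero₂]
  refine hP.induction (S := LinearMap.ker (C.comp (X := X) f))
    (isClosed_singleton.preimage hc) (fun g h => ?_) k
  have h1 : C.comp f g = 0 := congrArg (fun R => R (homModule.of φ g)) hf
  rw [LinearMap.mem_ker, ← C.assoc, h1, C.comp.map_zero₂]

variable (hP : IsGenerating P) (hstd : ∀ X, (homModule φ X).IsSummandOfStd)

/-- The Hilbert module `C(P, X)` as an object of `Hilb_T`. -/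
def homObj (X : C.Obj) : (Hilb T).Obj :=
  (⟨homModule φ X, hstd X⟩ : {E : HilbertModule.{w, w} T // E.IsSummandOfStd})

/-- The functor `X ↦ C(P, X)` to Hilbert modules. -/
def homFunctor (φ : EndIso C P T) (hP : IsGenerating P)
    (hstd : ∀ X, (homModule φ X).IsSummandOfStd) : StarFunctor C (Hilb T) where
  obj X := homObj hstd X
  map {X Y} :=
    { toFun := fun f => Hilb.ofCompact (E := homObj hstd X) (F := homObj hstd Y)
        (leftComp φ X Y f) (hP.leftComp_mem f)
      map_add' := fun f g => Subtype.ext ((leftComp φ X Y).map_add f g)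
      map_smul' := fun c f => Subtype.ext ((leftComp φ X Y).map_smul c f) }
  map_comp {X Y Z} g f := by
    refine Hilb.op_injective (E := homObj hstd X) (F := homObj hstd Z) ?_
    exact ContinuousLinearMap.ext fun z => C.assoc g f z
  map_adj {X Y} f := by
    refine Hilb.op_injective (E := homObj hstd Y) (F := homObj hstd X) ?_
    exact (isAdjoint_leftComp φ f).unique
      (Hilb.isAdjoint_op (E := homObj hstd X) (F := homObj hstd Y)
        (Hilb.ofCompact (leftComp φ X Y f) (hP.leftComp_mem f)))

/-- `C` acts faithfully and by all compact operators on the modules `C(P, X)`. -/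
theorem homFunctor_fullyFaithful : (homFunctor φ hP hstd).FullyFaithful := by
  have hinj : ∀ X Y, Function.Injective ((homFunctor φ hP hstd).map (X := X) (Y := Y)) :=
    fun X Y f g h => hP.leftComp_injective X Y (congrArg Hilb.op h)
  refine fun X Y => ⟨hinj X Y, fun K => ?_⟩
  have hiso : Isometry (leftComp φ X Y) := by
    refine AddMonoidHomClass.isometry_of_norm _ fun f => ?_
    exact (homFunctor φ hP hstd).norm_map_of_injective (fun X => hinj X X) f
  have hle : compactOps (homModule φ X) (homModule φ Y) ≤
      LinearMap.range (leftComp φ X Y).toLinearMap := by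
    refine Submodule.topologicalClosure_minimal _ (Submodule.span_le.mpr ?_)
      hiso.isClosedEmbedding.isClosed_range
    rintro _ ⟨x, y, rfl⟩
    exact ⟨_, leftComp_comp_adj φ (homModule.hom φ x) (homModule.hom φ y)⟩
  obtain ⟨f, hf⟩ := hle (Hilb.op_mem K)
  exact ⟨f, Hilb.op_injective hf⟩

end homModule

/-! ### The algebra as a Hilbert module over itself -/

namespace HilbertModule

variable {A : Type u} [NonUnitalCStarAlgebra A] (E : HilbertModule.{u, w} A)

lemma act_act (x : E) (a b : A) : E.act (E.act x a) b = E.act x (a * b) :=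
  E.core.ext_inner fun z => by
    simp only [act, E.core.inner_act, mul_assoc]

lemma add_act (x y : E) (a : A) : E.act (x + y) a = E.act x a + E.act y a :=
  E.core.ext_inner fun z => by
    simp only [act, E.core.inner_act, E.core.inner_add_right, add_mul]

lemma smul_act (c : ℂ) (x : E) (a : A) : E.act (c • x) a = c • E.act x a :=
  E.core.ext_inner fun z => by
    simp only [act, E.core.inner_act, E.core.inner_smul_right, smul_mul_assoc]

lemma exists_norm_sub_act_lt (x : E) {ε : ℝ} (hε : 0 < ε) :
    ∃ e : A, ‖e‖ ≤ 1 ∧ ‖x - E.act x e‖ < ε := by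
  obtain ⟨e, he, hn, h⟩ := exists_selfAdjoint_norm_conj_lt (E.core.inner x x) (mul_pos hε hε)
  refine ⟨e, hn, lt_of_mul_self_lt_mul_self₀ hε.le ?_⟩
  rw [E.norm_sq]
  refine lt_of_eq_of_lt (congrArg norm ?_) h
  simp only [act, E.core.inner_sub_left, E.core.inner_sub_right, E.core.inner_act,
    E.core.inner_act_left, he, mul_assoc]
  abel

end HilbertModule

variable (A : Type u) [NonUnitalCStarAlgebra A]

/-- The `C*`-algebra `A` as a Hilbert module over itself. -/
def selfModule : HilbertModule.{u, u} A where
  carrier := A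
  core :=
    { act := fun x a => x * a
      inner := fun x y => star x * y
      inner_add_right := fun x y z => mul_add _ _ _
      inner_smul_right := fun x c y => mul_smul_comm _ _ _
      inner_act := fun x y a => (mul_assoc _ _ _).symm
      star_inner := fun x y => by rw [star_mul, star_star]
      inner_self_pos := fun x => ⟨x, rfl⟩
      definite := fun x h => (CStarRing.star_mul_self_eq_zero_iff x).mp h }
  norm_sq x := CStarRing.norm_star_mul_self.symm

namespace StdModule

variable {A}

lemma norm_apply_le (a : Carrier A) (n : ℕ) : ‖a.1 n‖ ≤ ‖a‖ := by
  have h1 := norm_sum_le a {n}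
  rw [Finset.sum_singleton, CStarRing.norm_star_mul_self] at h1
  exact (mul_self_le_mul_self_iff (norm_nonneg (a.1 n)) (norm_nonneg a)).mpr h1

lemma star_single_mul (n : ℕ) (x : A) (b : ℕ → A) (m : ℕ) :
    star ((Pi.single n x : ℕ → A) m) * b m = (Pi.single n (star x * b n) : ℕ → A) m := by
  rcases eq_or_ne m n with rfl | h
  · simp
  · simp [Pi.single_eq_of_ne h]

/-- The sequence with entry `x` at `n` and zeros elsewhere. -/
def single (n : ℕ) : A →ₗ[ℂ] Carrier A where
  toFun x := ⟨Pi.single n x, by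
    refine (hasSum_pi_single n (star x * x)).summable.congr fun m => ?_
    rw [star_single_mul, Pi.single_eq_same]⟩
  map_add' x y := Subtype.ext (Pi.single_add (f := fun _ : ℕ => A) n x y)
  map_smul' c x := Subtype.ext (Pi.single_smul (f := fun _ : ℕ => A) n c x)

lemma single_val (n : ℕ) (x : A) : (single n x).1 = Pi.single n x := rfl

lemma inner_single (n : ℕ) (x : A) (b : Carrier A) :
    (core (A := A)).inner (single n x) b = star x * b.1 n := by
  change ∑' m, star ((Pi.single n x : ℕ → A) m) * b.1 m = _
  rw [tsum_congr fun m => star_single_mul n x b.1 m]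
  exact tsum_pi_single n _

lemma norm_single (n : ℕ) (x : A) : ‖single n x‖ = ‖x‖ := by
  rw [← mul_self_inj (norm_nonneg _) (norm_nonneg _), ← CStarRing.norm_star_mul_self]
  refine (norm_sq (single n x)).trans (congrArg norm ((inner_single n x _).trans ?_))
  rw [single_val, Pi.single_eq_same]

/-- Finitely supported sequences are dense. -/
lemma mem_of_single_mem {S : Submodule ℂ (Carrier A)} (hS : IsClosed (S : Set (Carrier A)))
    (h : ∀ n x, single n x ∈ S) (a : Carrier A) : a ∈ S := by
  have hmem : ∀ s : Finset ℕ, ∑ n ∈ s, single n (a.1 n) ∈ S := fun s =>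
    S.sum_mem fun n _ => h n _
  refine hS.mem_of_tendsto (f := fun s : Finset ℕ => ∑ n ∈ s, single n (a.1 n))
    (b := Filter.atTop) ?_ (Filter.Eventually.of_forall hmem)
  have hval : ∀ (s : Finset ℕ) (m : ℕ), (a - ∑ n ∈ s, single n (a.1 n)).1 m =
      if m ∈ s then 0 else a.1 m := by
    intro s m
    have h1 : (∑ n ∈ s, single n (a.1 n)).1 m = ∑ n ∈ s, (Pi.single n (a.1 n) : ℕ → A) m := by
      have : (∑ n ∈ s, single n (a.1 n)).1 = ∑ n ∈ s, (Pi.single n (a.1 n) : ℕ → A) :=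
        map_sum (sqSummable A).subtype (fun n => single n (a.1 n)) s
      rw [this, Finset.sum_apply]
    have h2 : (a - ∑ n ∈ s, single n (a.1 n)).1 m = a.1 m - (∑ n ∈ s, single n (a.1 n)).1 m := rfl
    rw [h2, h1]
    simp only [Pi.single_apply, Finset.sum_ite_eq]
    split_ifs <;> simp
  rw [tendsto_iff_norm_sub_tendsto_zero]
  have hsq : ∀ s : Finset ℕ, ‖∑ n ∈ s, single n (a.1 n) - a‖ =
      √‖(∑' n, star (a.1 n) * a.1 n) - ∑ n ∈ s, star (a.1 n) * a.1 n‖ := by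
    intro s
    rw [norm_sub_rev, ← Real.sqrt_mul_self (norm_nonneg (a - _)), norm_sq]
    congr 2
    have h3 : HasSum (fun m => star ((a - ∑ n ∈ s, single n (a.1 n)).1 m) *
        (a - ∑ n ∈ s, single n (a.1 n)).1 m)
        ((∑' n, star (a.1 n) * a.1 n) - ∑ n ∈ s, star (a.1 n) * a.1 n) := by
      have h4 := a.2.hasSum.sub (hasSum_sum_of_ne_finset_zero
        (f := fun m => if m ∈ s then star (a.1 m) * a.1 m else 0) (s := s)
        fun m hm => if_neg hm)
      rw [Finset.sum_ite_mem, Finset.inter_self] at h4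
      refine h4.congr_fun fun m => ?_
      rw [hval]
      split_ifs <;> simp
    exact h3.tsum_eq
  simp only [hsq]
  have h5 : Filter.Tendsto (fun s : Finset ℕ =>
      (∑' n, star (a.1 n) * a.1 n) - ∑ n ∈ s, star (a.1 n) * a.1 n) Filter.atTop (nhds 0) := by
    simpa using (tendsto_const_nhds (x := ∑' n, star (a.1 n) * a.1 n)).sub a.2.hasSum
  simpa using h5.norm.sqrt

end StdModule

lemma isSummandOfStd_selfModule : (selfModule A).IsSummandOfStd := by
  let V : selfModule A →L[ℂ] stdModule A :=
    LinearMap.mkContinuous (E := selfModule A) (F := stdModule A) (StdModule.single (A := A) 0) 1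
      fun x : A => (StdModule.norm_single 0 x).le.trans (one_mul _).symm.le
  let S : stdModule A →L[ℂ] selfModule A :=
    LinearMap.mkContinuous (E := stdModule A) (F := selfModule A)
      ((LinearMap.proj 0).comp (StdModule.sqSummable A).subtype) 1
      fun x => (StdModule.norm_apply_le x 0).trans (one_mul _).symm.le
  refine ⟨V, S, fun (x : A) y => StdModule.inner_single 0 x y, ContinuousLinearMap.ext fun x : A => ?_⟩
  exact (congrFun (StdModule.single_val 0 x) 0).trans (Pi.single_eq_same _ _)

/-- The `C*`-algebra `A` as an object of `Hilb_A`. -/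
def selfObj : (Hilb A).Obj :=
  (⟨selfModule A, isSummandOfStd_selfModule A⟩ : {E : HilbertModule.{u, u} A // E.IsSummandOfStd})

/-- The standard module as an object of `Hilb_A`. -/
def stdObj : (Hilb A).Obj :=
  (⟨stdModule A, ContinuousLinearMap.id ℂ _, ContinuousLinearMap.id ℂ _, isAdjoint_id, rfl⟩ :
    {E : HilbertModule.{u, u} A // E.IsSummandOfStd})

variable {A}

/-- The operator `a ↦ ξ a` from `A` to a Hilbert module `E ∋ ξ`. -/
def ketL (E : HilbertModule.{u, u} A) : E →L[ℂ] (selfModule A →L[ℂ] E) :=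
  LinearMap.mkContinuous₂
    (LinearMap.mk₂ ℂ (fun (x : E) (a : A) => E.act x a)
      (fun x y a => E.add_act x y a) (fun c x a => E.smul_act c x a)
      (fun x a b => E.core.act_add x a b) (fun c x a => E.core.act_smul x c a) :
        E →ₗ[ℂ] selfModule A →ₗ[ℂ] E) 1
    fun x a => (E.norm_act_le x a).trans (by rw [one_mul]; rfl)

/-- The operator `ζ ↦ ⟨ξ, ζ⟩` from a Hilbert module `E ∋ ξ` to `A`. -/
def braL (E : HilbertModule.{u, u} A) (x : E) : E →L[ℂ] selfModule A :=
  LinearMap.mkContinuous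
    ({ toFun := fun y => E.inner x y
       map_add' := fun y z => E.core.inner_add_right x y z
       map_smul' := fun c y => E.core.inner_smul_right x c y } : E →ₗ[ℂ] selfModule A) ‖x‖
    fun y => E.norm_inner_le x y

lemma isAdjoint_ketL (E : HilbertModule.{u, u} A) (x : E) : IsAdjoint (ketL E x) (braL E x) :=
  fun a y => E.core.inner_act_left x a y

lemma norm_ketL (E : HilbertModule.{u, u} A) (x : E) : ‖ketL E x‖ = ‖x‖ := by
  refine le_antisymm (((ketL E x).opNorm_le_bound (norm_nonneg x)) fun a => E.norm_act_le x a) ?_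
  refine le_of_forall_pos_le_add fun ε hε => ?_
  obtain ⟨e, hn, he⟩ := E.exists_norm_sub_act_lt x hε
  have h1 : ‖E.act x e‖ ≤ ‖ketL E x‖ * ‖e‖ := (ketL E x).le_opNorm (e : A)
  have h2 : ‖x‖ ≤ ‖x - E.act x e‖ + ‖E.act x e‖ := by
    simpa using norm_add_le (x - E.act x e) (E.act x e)
  have h3 : ‖ketL E x‖ * ‖e‖ ≤ ‖ketL E x‖ * 1 := by gcongr
  linarith

lemma ketL_act (E : HilbertModule.{u, u} A) (x : E) (a : A) :
    ketL E (E.act x a) = rankOne x ((star a : A) : selfModule A) := by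
  refine ContinuousLinearMap.ext fun b : A => (E.act_act x a b).trans (congrArg (E.act x) ?_)
  change a * b = star (star a) * b
  rw [star_star]

lemma ketL_mem_compactOps (E : HilbertModule.{u, u} A) (x : E) :
    ketL E x ∈ compactOps (selfModule A) E := by
  have hcl : IsClosed {y : E | ketL E y ∈ compactOps (selfModule A) E} :=
    (isClosed_compactOps _ _).preimage (ketL E).continuous
  refine hcl.closure_subset (Metric.mem_closure_iff.mpr fun ε hε => ?_)
  obtain ⟨e, -, he⟩ := E.exists_norm_sub_act_lt x hε
  refine ⟨E.act x e, ?_, by rwa [dist_eq_norm]⟩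
  exact (congrArg (· ∈ compactOps (selfModule A) E) (ketL_act E x e)).mpr
    (rankOne_mem_compactOps _ _)

/-- All compact operators `A → E` are of the form `a ↦ ξ a`. -/
lemma exists_ketL_eq (E : HilbertModule.{u, u} A) {K : selfModule A →L[ℂ] E}
    (hK : K ∈ compactOps (selfModule A) E) : ∃ x, ketL E x = K := by
  have hiso : Isometry (ketL E) := AddMonoidHomClass.isometry_of_norm _ (norm_ketL E)
  have hle : compactOps (selfModule A) E ≤ LinearMap.range (ketL E).toLinearMap := by
    refine Submodule.topologicalClosure_minimal _ (Submodule.span_le.mpr ?_)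
      hiso.isClosedEmbedding.isClosed_range
    rintro _ ⟨x, (a : A), rfl⟩
    exact ⟨E.act x (star a : A), (ketL_act E x _).trans (congrArg (rankOne x) (star_star (a : A)))⟩
  exact hle hK

/-- The identification of a Hilbert module `E` with the space of compact operators `A → E`. -/
def ket (E : (Hilb A).Obj) : Hilb.mod E ≃ₗ[ℂ] (Hilb A).Hom (selfObj A) E :=
  LinearEquiv.ofBijective
    ({ toFun := fun x => Hilb.ofCompact (E := selfObj A) (ketL (Hilb.mod E) x)
        (ketL_mem_compactOps _ x)
       map_add' := fun x y => Subtype.ext ((ketL (Hilb.mod E)).map_add x y)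
       map_smul' := fun c x => Subtype.ext ((ketL (Hilb.mod E)).map_smul c x) } :
      Hilb.mod E →ₗ[ℂ] (Hilb A).Hom (selfObj A) E)
    ⟨fun x y h => by
      have hiso : Isometry (ketL (Hilb.mod E)) :=
        AddMonoidHomClass.isometry_of_norm _ (norm_ketL (Hilb.mod E))
      exact hiso.injective (congrArg Hilb.op h),
    fun K => by
      obtain ⟨x, hx⟩ := exists_ketL_eq (Hilb.mod E) (Hilb.op_mem K)
      exact ⟨x, Hilb.op_injective hx⟩⟩

lemma norm_ket {E : (Hilb A).Obj} (x : Hilb.mod E) : ‖ket E x‖ = ‖x‖ := norm_ketL _ x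

lemma comp_ket {E F : (Hilb A).Obj} (K : (Hilb A).Hom E F) (x : Hilb.mod E) :
    (Hilb A).comp K (ket E x) = ket F (Hilb.op K x) :=
  Hilb.op_injective <| ContinuousLinearMap.ext fun a => (Hilb.isAdjoint_op K).map_act x a

lemma op_adj_ket {E : (Hilb A).Obj} (x : Hilb.mod E) :
    Hilb.op ((Hilb A).adj (ket E x)) = braL (Hilb.mod E) x :=
  (Hilb.isAdjoint_op (ket E x)).unique (isAdjoint_ketL (Hilb.mod E) x)

lemma ket_comp_adj_ket {E F : (Hilb A).Obj} (x : Hilb.mod F) (y : Hilb.mod E) :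
    Hilb.op ((Hilb A).comp (ket F x) ((Hilb A).adj (ket E y))) = rankOne x y := by
  rw [Hilb.op_comp, op_adj_ket]
  rfl

variable (A) in
/-- The identification of `A` with the algebra of compact operators on the Hilbert module `A`. -/
def lmul : A ≃ₗ[ℂ] (Hilb A).Hom (selfObj A) (selfObj A) := ket (selfObj A)

lemma adj_ket_comp_ket {E : (Hilb A).Obj} (x y : Hilb.mod E) :
    (Hilb A).comp ((Hilb A).adj (ket E x)) (ket E y) = lmul A ((Hilb.mod E).inner x y) := by
  rw [comp_ket, op_adj_ket]
  rfl

lemma ket_comp_lmul {E : (Hilb A).Obj} (x : Hilb.mod E) (a : A) :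
    (Hilb A).comp (ket E x) (lmul A a) = ket E ((Hilb.mod E).act x a) :=
  comp_ket (E := selfObj A) (ket E x) a

lemma lmul_mul (a b : A) : lmul A (a * b) = (Hilb A).comp (lmul A a) (lmul A b) :=
  (ket_comp_lmul (E := selfObj A) a b).symm

lemma lmul_star (a : A) : lmul A (star a) = (Hilb A).adj (lmul A a) :=
  Hilb.op_injective ((op_adj_ket (E := selfObj A) a).symm.trans rfl |>.symm.trans rfl).symm

/-- The module `A` generates `Hilb_A`. -/
lemma isGenerating_selfObj : IsGenerating (C := Hilb A) (selfObj A) := by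
  refine fun E F => eq_top_iff.mpr fun K _ => Metric.mem_closure_iff.mpr fun ε hε => ?_
  obtain ⟨K', hK', hd⟩ := Metric.mem_closure_iff.mp (Hilb.op_mem K) ε hε
  suffices h : ∃ K'' : (Hilb A).Hom E F, Hilb.op K'' = K' ∧ K'' ∈ Submodule.span ℂ
      {f : (Hilb A).Hom E F | ∃ (g : (Hilb A).Hom (selfObj A) F) (h : (Hilb A).Hom (selfObj A) E),
        f = (Hilb A).comp g ((Hilb A).adj h)} by
    obtain ⟨K'', rfl, h⟩ := h
    exact ⟨K'', h, hd⟩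
  clear hd
  induction hK' using Submodule.span_induction with
  | mem K' h =>
    obtain ⟨x, y, rfl⟩ := h
    exact ⟨_, ket_comp_adj_ket x y, Submodule.subset_span ⟨_, _, rfl⟩⟩
  | zero => exact ⟨0, rfl, zero_mem _⟩
  | add K K' _ _ h h' =>
    obtain ⟨L, rfl, hL⟩ := h
    obtain ⟨L', rfl, hL'⟩ := h'
    exact ⟨L + L', rfl, add_mem hL hL'⟩
  | smul c K _ h =>
    obtain ⟨L, rfl, hL⟩ := h
    exact ⟨c • L, rfl, Submodule.smul_mem _ c hL⟩

/-! ### Generating objects of completed tensor products and subobject completions -/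

section tmul

variable {V₁ : CStarCat.{u₁, v₁}} {V₂ : CStarCat.{u₂, v₂}}

/-- A seminorm on the algebraic tensor product is subcross if `‖f ⊗ g‖ ≤ ‖f‖ ‖g‖`. -/
def CStarSeminorm.IsSubcross (N : CStarSeminorm (boxdot V₁ V₂)) : Prop :=
  ∀ (X₁ Y₁ : V₁.Obj) (X₂ Y₂ : V₂.Obj) (f : V₁.Hom X₁ Y₁) (g : V₂.Hom X₂ Y₂),
    N.N (X := (X₁, X₂)) (Y := (Y₁, Y₂)) (f ⊗ₜ[ℂ] g) ≤ ‖f‖ * ‖g‖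

lemma minNorm_isSubcross (ι₁ : Realisation.{u₁, v₁, w₁} V₁) (ι₂ : Realisation.{u₂, v₂, w₂} V₂) :
    (minNorm ι₁ ι₂).IsSubcross := fun X₁ Y₁ X₂ Y₂ f g =>
  Real.iSup_le (fun _ => (ι₁.toRep.tensor ι₂.toRep).norm_map_tmul_le
    (X := (X₁, X₂)) (Y := (Y₁, Y₂)) f g) (by positivity)

lemma maxNorm_isSubcross : (maxNorm V₁ V₂).IsSubcross := fun X₁ Y₁ X₂ Y₂ f g =>
  Real.iSup_le (fun π => π.1.norm_map_tmul_le
    (X := (X₁, X₂)) (Y := (Y₁, Y₂)) f g) (by positivity)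

variable (N : CStarSeminorm (boxdot V₁ V₂))

/-- The object `(X₁, X₂)` of the completed tensor product. -/
def CStarSeminorm.pair (X₁ : V₁.Obj) (X₂ : V₂.Obj) : N.completion.Obj := (X₁, X₂)

/-- The morphism `f₁ ⊗ f₂` of the completed tensor product. -/
def CStarSeminorm.tens {X₁ Y₁ : V₁.Obj} {X₂ Y₂ : V₂.Obj} (f₁ : V₁.Hom X₁ Y₁)
    (f₂ : V₂.Hom X₂ Y₂) : N.completion.Hom (N.pair X₁ X₂) (N.pair Y₁ Y₂) := N.tmul f₁ f₂

/-- The canonical map from the algebraic to the completed tensor product. -/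
def CStarSeminorm.tensMap (X₁ Y₁ : V₁.Obj) (X₂ Y₂ : V₂.Obj) :
    V₁.Hom X₁ Y₁ ⊗[ℂ] V₂.Hom X₂ Y₂ →ₗ[ℂ] N.completion.Hom (N.pair X₁ X₂) (N.pair Y₁ Y₂) :=
  N.ι (X := (X₁, X₂)) (Y := (Y₁, Y₂))

lemma CStarSeminorm.norm_tensMap {X₁ Y₁ : V₁.Obj} {X₂ Y₂ : V₂.Obj}
    (t : V₁.Hom X₁ Y₁ ⊗[ℂ] V₂.Hom X₂ Y₂) :
    ‖N.tensMap X₁ Y₁ X₂ Y₂ t‖ = N.N (X := (X₁, X₂)) (Y := (Y₁, Y₂)) t :=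
  N.norm_ι (X := (X₁, X₂)) (Y := (Y₁, Y₂)) t

lemma CStarSeminorm.denseRange_tensMap (X₁ Y₁ : V₁.Obj) (X₂ Y₂ : V₂.Obj) :
    DenseRange (N.tensMap X₁ Y₁ X₂ Y₂) := fun k =>
  N.induction (X := (X₁, X₂)) (Y := (Y₁, Y₂))
    (p := fun k => k ∈ closure (Set.range (N.tensMap X₁ Y₁ X₂ Y₂))) isClosed_closure
    (fun t => subset_closure ⟨t, rfl⟩) k

lemma CStarSeminorm.comp_tens {X₁ Y₁ Z₁ : V₁.Obj} {X₂ Y₂ Z₂ : V₂.Obj} (g₁ : V₁.Hom Y₁ Z₁)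
    (g₂ : V₂.Hom Y₂ Z₂) (f₁ : V₁.Hom X₁ Y₁) (f₂ : V₂.Hom X₂ Y₂) :
    N.completion.comp (N.tens g₁ g₂) (N.tens f₁ f₂) = N.tens (V₁.comp g₁ f₁) (V₂.comp g₂ f₂) :=
  N.cComp_ι (X := (X₁, X₂)) (Y := (Y₁, Y₂)) (Z := (Z₁, Z₂)) (g₁ ⊗ₜ[ℂ] g₂) (f₁ ⊗ₜ[ℂ] f₂)

lemma CStarSeminorm.adj_tens {X₁ Y₁ : V₁.Obj} {X₂ Y₂ : V₂.Obj} (f₁ : V₁.Hom X₁ Y₁)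
    (f₂ : V₂.Hom X₂ Y₂) :
    N.completion.adj (N.tens f₁ f₂) = N.tens (V₁.adj f₁) (V₂.adj f₂) :=
  N.cAdj_ι (X := (X₁, X₂)) (Y := (Y₁, Y₂)) (f₁ ⊗ₜ[ℂ] f₂)

variable {N}

/-- The map `(f, g) ↦ f ⊗ g` as bounded bilinear map. -/
def tensL (hN : N.IsSubcross) (X₁ Y₁ : V₁.Obj) (X₂ Y₂ : V₂.Obj) :
    V₁.Hom X₁ Y₁ →L[ℂ] V₂.Hom X₂ Y₂ →L[ℂ] N.completion.Hom (N.pair X₁ X₂) (N.pair Y₁ Y₂) :=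
  LinearMap.mkContinuous₂ ((TensorProduct.mk ℂ (V₁.Hom X₁ Y₁) (V₂.Hom X₂ Y₂)).compr₂
    (N.tensMap X₁ Y₁ X₂ Y₂)) 1 fun f g => by
      rw [one_mul]
      exact (N.norm_tensMap (f ⊗ₜ[ℂ] g)).trans_le (hN _ _ _ _ f g)

/-- Tensor products of generating objects are generating. -/
lemma isGenerating_completion (hN : N.IsSubcross) {P₁ : V₁.Obj} {P₂ : V₂.Obj}
    (h₁ : IsGenerating P₁) (h₂ : IsGenerating P₂) :
    IsGenerating (C := N.completion) (N.pair P₁ P₂) := by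
  rintro ⟨X₁, X₂⟩ ⟨Y₁, Y₂⟩
  change (Submodule.span ℂ {f : N.completion.Hom (N.pair X₁ X₂) (N.pair Y₁ Y₂) |
    ∃ (g : N.completion.Hom (N.pair P₁ P₂) (N.pair Y₁ Y₂))
      (h : N.completion.Hom (N.pair P₁ P₂) (N.pair X₁ X₂)),
    f = N.completion.comp g (N.completion.adj h)}).topologicalClosure = ⊤
  set S := (Submodule.span ℂ {f : N.completion.Hom (N.pair X₁ X₂) (N.pair Y₁ Y₂) |
    ∃ (g : N.completion.Hom (N.pair P₁ P₂) (N.pair Y₁ Y₂))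
      (h : N.completion.Hom (N.pair P₁ P₂) (N.pair X₁ X₂)),
    f = N.completion.comp g (N.completion.adj h)}).topologicalClosure
  have hS : IsClosed (S : Set (N.completion.Hom (N.pair X₁ X₂) (N.pair Y₁ Y₂))) :=
    Submodule.isClosed_topologicalClosure _
  refine eq_top_iff.mpr fun k _ => ?_
  refine (N.denseRange_tensMap X₁ Y₁ X₂ Y₂).induction_on (p := fun k => k ∈ S) k hS fun t => ?_
  induction t using TensorProduct.induction_on with
  | zero => exact (map_zero (N.tensMap X₁ Y₁ X₂ Y₂)).symm ▸ S.zero_mem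
  | add t t' ht ht' => exact (map_add (N.tensMap X₁ Y₁ X₂ Y₂) t t').symm ▸ S.add_mem ht ht'
  | tmul f g =>
    refine h₁.induction (S := S.comap ((tensL hN X₁ Y₁ X₂ Y₂).flip g).toLinearMap)
      (hS.preimage ((tensL hN X₁ Y₁ X₂ Y₂).flip g).continuous) (fun a b => ?_) f
    refine h₂.induction (S := S.comap (tensL hN X₁ Y₁ X₂ Y₂ _).toLinearMap)
      (hS.preimage (tensL hN X₁ Y₁ X₂ Y₂ _).continuous) (fun c d => ?_) g
    refine Submodule.le_topologicalClosure _ (Submodule.subset_span ⟨N.tens a c, N.tens b d, ?_⟩)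
    rw [N.adj_tens, N.comp_tens]
    rfl

end tmul

section split

variable {C : CStarCat.{u, v}}

/-- The object `(X, 1)` of the subobject completion. -/
def splitObj (X : C.Obj) : (split C).Obj := ⟨X, Multiplier.id C X, Multiplier.isProjection_id X⟩

/-- The morphism `g : X → Y`, cut down to a morphism `(X, 1) → (Y, q)`. -/
def splitProj (X : C.Obj) (Y : (split C).Obj) : C.Hom X Y.1 →L[ℂ] (split C).Hom (splitObj X) Y :=
  LinearMap.mkContinuousOfExistsBound
    ({ toFun := fun g => ⟨Y.2.1.L X g, rfl, congrArg (fun m => m.L X g) Y.2.2.1⟩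
       map_add' := fun f g => Subtype.ext ((Y.2.1.L X).map_add f g)
       map_smul' := fun c f => Subtype.ext ((Y.2.1.L X).map_smul c f) } :
      C.Hom X Y.1 →ₗ[ℂ] (split C).Hom (splitObj X) Y)
    (by
      obtain ⟨D, hD⟩ := Y.2.1.bound_L
      exact ⟨D, fun g => hD X g⟩)

/-- The underlying morphism of `C` of a morphism of the subobject completion. -/
def splitIncl (X Y : (split C).Obj) : (split C).Hom X Y →L[ℂ] C.Hom X.1 Y.1 :=
  (splitHom C X.2.1 Y.2.1).subtypeL

lemma splitIncl_injective (X Y : (split C).Obj) : Function.Injective (splitIncl X Y) :=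
  Subtype.val_injective

lemma L_splitIncl {X Y : (split C).Obj} (f : (split C).Hom X Y) :
    Y.2.1.L _ (splitIncl _ _ f) = splitIncl _ _ f :=
  (show splitHom C X.2.1 Y.2.1 from f).2.2

lemma R_splitIncl {X Y : (split C).Obj} (f : (split C).Hom X Y) :
    X.2.1.R _ (splitIncl _ _ f) = splitIncl _ _ f :=
  (show splitHom C X.2.1 Y.2.1 from f).2.1

lemma Multiplier.IsProjection.R_adj {X Y : C.Obj} {p : Multiplier C X X} (hp : p.IsProjection)
    (f : C.Hom Y X) : p.R Y (C.adj f) = C.adj (p.L Y f) := by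
  have h := p.adj_R (C.adj f)
  rw [hp.2, C.adj_adj] at h
  exact h

/-- Generating objects remain generating in the subobject completion. -/
lemma isGenerating_split {P : C.Obj} (hP : IsGenerating P) :
    IsGenerating (C := split C) (splitObj P) := by
  refine fun X Y => eq_top_iff.mpr fun k _ => ?_
  set S := (Submodule.span ℂ {f : (split C).Hom X Y |
    ∃ (g : (split C).Hom (splitObj P) Y) (h : (split C).Hom (splitObj P) X),
    f = (split C).comp g ((split C).adj h)}).topologicalClosure
  have hS : IsClosed (S : Set ((split C).Hom X Y)) := Submodule.isClosed_topologicalClosure _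
  -- the compression `f ↦ q f p`
  let e : C.Hom X.1 Y.1 →ₗ[ℂ] (split C).Hom X Y :=
    { toFun := fun f => ⟨Y.2.1.L _ (X.2.1.R _ f),
        by rw [← Multiplier.L_R_comm]; exact congrArg (Y.2.1.L _) (congrArg (fun m => m.R _ f) X.2.2.1),
        congrArg (fun m => m.L _ (X.2.1.R _ f)) Y.2.2.1⟩
      map_add' := fun f g => Subtype.ext
        (((Y.2.1.L X.1).comp (X.2.1.R Y.1)).map_add f g)
      map_smul' := fun c f => Subtype.ext
        (((Y.2.1.L X.1).comp (X.2.1.R Y.1)).map_smul c f) }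
  have he : Continuous e := by
    obtain ⟨C₁, h₁⟩ := Y.2.1.bound_L
    obtain ⟨C₂, h₂⟩ := X.2.1.bound_R
    refine Continuous.subtype_mk (f := fun f => Y.2.1.L _ (X.2.1.R _ f)) ?_ _
    exact ((Y.2.1.L X.1).mkContinuous C₁ (h₁ X.1)).continuous.comp
      ((X.2.1.R Y.1).mkContinuous C₂ (h₂ Y.1)).continuous
  have hk : e (splitIncl _ _ k) = k := by
    refine splitIncl_injective _ _ ?_
    change Y.2.1.L _ (X.2.1.R _ (splitIncl _ _ k)) = _
    rw [R_splitIncl, L_splitIncl]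
  rw [← hk]
  refine hP.induction (S := S.comap e) (hS.preimage he) (fun g h => ?_) (splitIncl _ _ k)
  refine Submodule.le_topologicalClosure _ (Submodule.subset_span
    ⟨splitProj P Y g, splitProj P X h, splitIncl_injective _ _ ?_⟩)
  change Y.2.1.L _ (X.2.1.R _ (C.comp g (C.adj h))) = _
  rw [X.2.1.R_comp, Y.2.1.L_comp, X.2.2.R_adj]
  rfl

/-- The endomorphism algebra of an object does not change in the subobject completion. -/
def EndIso.split {P : C.Obj} {T : Type w} [NonUnitalCStarAlgebra T] (φ : EndIso C P T) :
    EndIso (split C) (splitObj P) T where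
  hom := (splitProj P (splitObj P)).toLinearMap ∘ₗ φ.hom
  inv := φ.inv ∘ₗ (splitIncl (splitObj P) (splitObj P)).toLinearMap
  inv_hom a := φ.inv_hom a
  hom_inv f := splitIncl_injective _ _ (φ.hom_inv (splitIncl _ _ f))
  hom_mul a b := splitIncl_injective _ _ (φ.hom_mul a b)
  hom_star a := splitIncl_injective _ _ (φ.hom_star a)

end split

/-! ### Dense maps into Hilbert modules -/

section extension

variable {T : Type u} [NonUnitalCStarAlgebra T] {G G' : HilbertModule.{u, w} T}
  {D D' : Type*} [AddCommGroup D] [Module ℂ D] [AddCommGroup D'] [Module ℂ D']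

lemma isAdjoint_of_denseRange {j : D →ₗ[ℂ] G} {j' : D' →ₗ[ℂ] G'} (hj : DenseRange j)
    (hj' : DenseRange j') {V : G →L[ℂ] G'} {S : G' →L[ℂ] G}
    (h : ∀ x y, G'.inner (V (j x)) (j' y) = G.inner (j x) (S (j' y))) : IsAdjoint V S := by
  have hr : ∀ {E : HilbertModule.{u, w} T} (x : E), Continuous fun y => E.inner x y := fun {E} x =>
    (({ toFun := fun y => E.inner x y
        map_add' := fun y z => E.core.inner_add_right x y z
        map_smul' := fun c y => E.core.inner_smul_right x c y } : E →ₗ[ℂ] T).mkContinuous ‖x‖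
      fun y => E.norm_inner_le x y).continuous
  have hl : ∀ {E : HilbertModule.{u, w} T} (y : E), Continuous fun x => E.inner x y := fun {E} y =>
    (continuous_star.comp (hr y)).congr fun x => E.core.star_inner y x
  intro x y
  refine hj.induction_on (p := fun x => G'.inner (V x) y = G.inner x (S y)) x
    (isClosed_eq ((hl y).comp V.continuous) (hl (S y))) fun x => ?_
  exact hj'.induction_on (p := fun y => G'.inner (V (j x)) y = G.inner (j x) (S y)) y
    (isClosed_eq (hr _) ((hr _).comp S.continuous)) fun y => h x y

/-- A pair of formally adjoint maps between dense subspaces, one of which is a left inverse of the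
other, extends to an adjointable isometry and its adjoint. -/
lemma exists_isometry_of_denseRange {j : D →ₗ[ℂ] G} {j' : D' →ₗ[ℂ] G'} (hj : DenseRange j)
    (hj' : DenseRange j') (R : D →ₗ[ℂ] D') (R' : D' →ₗ[ℂ] D)
    (h : ∀ x y, G'.inner (j' (R x)) (j' y) = G.inner (j x) (j (R' y)))
    (hR : ∀ x, R' (R x) = x) :
    ∃ (V : G →L[ℂ] G') (S : G' →L[ℂ] G), IsAdjoint V S ∧
      S.comp V = ContinuousLinearMap.id ℂ G ∧
      ((∀ y, R (R' y) = y) → V.comp S = ContinuousLinearMap.id ℂ G') := by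
  have h1 : ∀ x, ‖j' (R x)‖ = ‖j x‖ := fun x => by
    have := congrArg norm (h x (R x))
    rw [hR] at this
    rw [G'.norm_eq_sqrt, G.norm_eq_sqrt, this]
  have h2 : ∀ y, ‖j (R' y)‖ ≤ ‖j' y‖ := fun y => by
    have h3 : ‖j (R' y)‖ * ‖j (R' y)‖ ≤ ‖j (R' y)‖ * ‖j' y‖ := by
      rw [G.norm_sq]
      have h4 := congrArg norm (h (R' y) y)
      refine (h4.symm.trans_le (G'.norm_inner_le _ _)).trans ?_
      rw [h1]
    rcases (norm_nonneg (j (R' y))).eq_or_lt with h0 | h0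
    · rw [← h0]; exact norm_nonneg _
    · exact le_of_mul_le_mul_left h3 h0
  have b1 : ∃ K : ℝ, ∀ x, ‖(j' ∘ₗ R) x‖ ≤ K * ‖j x‖ := ⟨1, fun x => by
    rw [one_mul]; exact (h1 x).le⟩
  have b2 : ∃ K : ℝ, ∀ y, ‖(j ∘ₗ R') y‖ ≤ K * ‖j' y‖ := ⟨1, fun y => by
    rw [one_mul]; exact h2 y⟩
  have e1 : ∀ x, (j' ∘ₗ R).extendOfNorm j (j x) = j' (R x) :=
    LinearMap.extendOfNorm_eq hj b1
  have e2 : ∀ y, (j ∘ₗ R').extendOfNorm j' (j' y) = j (R' y) :=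
    LinearMap.extendOfNorm_eq hj' b2
  refine ⟨(j' ∘ₗ R).extendOfNorm j, (j ∘ₗ R').extendOfNorm j', ?_, ?_, fun hR' => ?_⟩
  · exact isAdjoint_of_denseRange hj hj' fun x y => by rw [e1, e2, h]
  · refine ContinuousLinearMap.ext fun x => ?_
    refine hj.induction_on x (isClosed_eq (ContinuousLinearMap.continuous _)
      (ContinuousLinearMap.continuous _)) fun x => ?_
    rw [ContinuousLinearMap.comp_apply, e1, e2, hR]
    rfl
  · refine ContinuousLinearMap.ext fun y => ?_
    refine hj'.induction_on y (isClosed_eq (ContinuousLinearMap.continuous _)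
      (ContinuousLinearMap.continuous _)) fun y => ?_
    rw [ContinuousLinearMap.comp_apply, e2, e1, hR']
    rfl

lemma inner_eq_of_tmul {D₁ D₂ D₁' D₂' : Type*} [AddCommGroup D₁] [Module ℂ D₁] [AddCommGroup D₂]
    [Module ℂ D₂] [AddCommGroup D₁'] [Module ℂ D₁'] [AddCommGroup D₂'] [Module ℂ D₂']
    {j : D₁ ⊗[ℂ] D₂ →ₗ[ℂ] G} {j' : D₁' ⊗[ℂ] D₂' →ₗ[ℂ] G'} {R : D₁ ⊗[ℂ] D₂ →ₗ[ℂ] D₁' ⊗[ℂ] D₂'}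
    {R' : D₁' ⊗[ℂ] D₂' →ₗ[ℂ] D₁ ⊗[ℂ] D₂}
    (h : ∀ x y a b, G'.inner (j' (R (x ⊗ₜ[ℂ] y))) (j' (a ⊗ₜ[ℂ] b)) =
      G.inner (j (x ⊗ₜ[ℂ] y)) (j (R' (a ⊗ₜ[ℂ] b)))) (x : D₁ ⊗[ℂ] D₂) (y : D₁' ⊗[ℂ] D₂') :
    G'.inner (j' (R x)) (j' y) = G.inner (j x) (j (R' y)) := by
  simp only [HilbertModule.inner] at *
  induction x with
  | zero => simp only [map_zero, InnerCore.inner_zero_left]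
  | add x x' hx hx' => simp only [map_add, InnerCore.inner_add_left, hx, hx']
  | tmul ξ η =>
    induction y with
    | zero => simp only [map_zero, InnerCore.inner_zero_right]
    | add x x' hx hx' => simp only [map_add, InnerCore.inner_add_right, hx, hx']
    | tmul a b => exact h ξ η a b

end extension

/-! ### The completed tensor product of two `C*`-algebras -/

namespace CStarCat

variable (C : CStarCat.{u, v})

lemma continuous_comp_right {X Y Z : C.Obj} (f : C.Hom Y Z) :
    Continuous (C.comp (X := X) f) :=
  ((C.comp (X := X) f).mkContinuous ‖f‖ fun k => C.norm_comp_le f k).continuous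

lemma continuous_comp_left {X Y Z : C.Obj} (g : C.Hom X Y) :
    Continuous fun f : C.Hom Y Z => C.comp f g :=
  (((C.comp (X := X) (Y := Y) (Z := Z)).flip g).mkContinuous ‖g‖ fun k =>
    (C.norm_comp_le k g).trans (mul_comm _ _).le).continuous

lemma continuous_adj {X Y : C.Obj} : Continuous (C.adj (X := X) (Y := Y)) :=
  AddMonoidHomClass.continuous_of_bound (C.adj (X := X) (Y := Y)) 1 fun f => by
    rw [C.norm_adj, one_mul]

end CStarCat

namespace TensorAlgebra

variable {A : Type u} {B : Type v} [NonUnitalCStarAlgebra A] [NonUnitalCStarAlgebra B]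
  (M : CStarSeminorm (boxdot (ofAlgebra A) (ofAlgebra B)))

/-- The canonical map `A ⊙ B → A ⊗ B`. -/
def coe : A ⊗[ℂ] B →ₗ[ℂ] TensorAlgebra M := M.ι (X := ((), ())) (Y := ((), ()))

/-- The given seminorm on `A ⊙ B`. -/
def algNorm (t : A ⊗[ℂ] B) : ℝ := M.N (X := ((), ())) (Y := ((), ())) t

lemma norm_coe (t : A ⊗[ℂ] B) : ‖coe M t‖ = algNorm M t :=
  M.norm_ι (X := ((), ())) (Y := ((), ())) t

lemma coe_tmul (a : A) (b : B) : coe M (a ⊗ₜ[ℂ] b) = tmul M a b := rfl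

lemma denseRange_coe : DenseRange (coe M) := fun k =>
  M.induction (X := ((), ())) (Y := ((), ()))
    (p := fun k => k ∈ closure (Set.range (coe M))) isClosed_closure
    (fun t => subset_closure ⟨t, rfl⟩) k

lemma tmul_mul_tmul (a a' : A) (b b' : B) :
    tmul M a b * tmul M a' b' = tmul M (a * a') (b * b') :=
  M.cComp_ι (X := ((), ())) (Y := ((), ())) (Z := ((), ())) (a ⊗ₜ[ℂ] b) (a' ⊗ₜ[ℂ] b')

lemma star_tmul (a : A) (b : B) : star (tmul M a b) = tmul M (star a) (star b) :=
  M.cAdj_ι (X := ((), ())) (Y := ((), ())) (a ⊗ₜ[ℂ] b)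

variable {M}

/-- The map `(a, b) ↦ a ⊗ b` as bounded bilinear map. -/
def tmulL (hM : M.IsSubcross) : A →L[ℂ] B →L[ℂ] TensorAlgebra M :=
  LinearMap.mkContinuous₂ ((TensorProduct.mk ℂ A B).compr₂ (coe M)) 1 fun a b => by
    rw [one_mul]
    exact (norm_coe M (a ⊗ₜ[ℂ] b)).trans_le (hM () () () () a b)

end TensorAlgebra

section compatible

variable {A : Type u} {B : Type v} [NonUnitalCStarAlgebra A] [NonUnitalCStarAlgebra B]

/-- A seminorm on `Hilb_A ⊙ Hilb_B` extends a seminorm on `A ⊙ B` if the two agree under the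
identifications of `A` and `B` with algebras of compact operators. -/
def CStarSeminorm.Extends (N : CStarSeminorm (boxdot (Hilb A) (Hilb B)))
    (M : CStarSeminorm (boxdot (ofAlgebra A) (ofAlgebra B))) : Prop :=
  ∀ t : A ⊗[ℂ] B, N.N (X := (selfObj A, selfObj B)) (Y := (selfObj A, selfObj B))
    (TensorProduct.congr (lmul A) (lmul B) t) = TensorAlgebra.algNorm M t

variable {N : CStarSeminorm (boxdot (Hilb A) (Hilb B))}
  {M : CStarSeminorm (boxdot (ofAlgebra A) (ofAlgebra B))}

variable (N) in
/-- The object `(A, B)` of the completion of `Hilb_A ⊙ Hilb_B`. -/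
abbrev CStarSeminorm.genObj : N.completion.Obj := N.pair (selfObj A) (selfObj B)

lemma denseRange_comp_of_surjective {D D' G : Type*} [TopologicalSpace G] {j : D' → G}
    (hj : DenseRange j) {e : D → D'} (he : Function.Surjective e) : DenseRange (j ∘ e) := by
  rwa [DenseRange, he.range_comp]

/-- If `N` extends `M`, then `A ⊗ B` is the endomorphism algebra of the object `(A, B)`. -/
def tensorEndIso (h : N.Extends M) : EndIso N.completion N.genObj (TensorAlgebra M) :=
  let i : A ⊗[ℂ] B →ₗ[ℂ] N.completion.Hom N.genObj N.genObj :=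
    N.tensMap (selfObj A) (selfObj A) (selfObj B) (selfObj B) ∘ₗ
      (TensorProduct.congr (lmul A) (lmul B)).toLinearMap
  have hn : ∀ t, ‖i t‖ = ‖TensorAlgebra.coe M t‖ := fun t =>
    (N.norm_tensMap _).trans ((h t).trans (TensorAlgebra.norm_coe M t).symm)
  have hi : DenseRange i := denseRange_comp_of_surjective
    (N.denseRange_tensMap (selfObj A) (selfObj A) (selfObj B) (selfObj B))
    (TensorProduct.congr (lmul A) (lmul B)).surjective
  have hc := TensorAlgebra.denseRange_coe M
  have e1 : ∀ t, i.extendOfNorm (TensorAlgebra.coe M) (TensorAlgebra.coe M t) = i t :=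
    LinearMap.extendOfNorm_eq hc ⟨1, fun t => by rw [one_mul, hn]⟩
  have e2 : ∀ t, (TensorAlgebra.coe M).extendOfNorm i (i t) = TensorAlgebra.coe M t :=
    LinearMap.extendOfNorm_eq hi ⟨1, fun t => by rw [one_mul, hn]⟩
  have hcont := (i.extendOfNorm (TensorAlgebra.coe M)).continuous
  have i_tmul : ∀ (a : A) (b : B), i (a ⊗ₜ[ℂ] b) = N.tens (lmul A a) (lmul B b) := fun _ _ => rfl
  { hom := (i.extendOfNorm (TensorAlgebra.coe M)).toLinearMap
    inv := ((TensorAlgebra.coe M).extendOfNorm i).toLinearMap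
    inv_hom := fun a => hc.induction_on a
      (isClosed_eq (((TensorAlgebra.coe M).extendOfNorm i).continuous.comp hcont) continuous_id)
      fun t => (congrArg _ (e1 t)).trans (e2 t)
    hom_inv := fun f => hi.induction_on f
      (isClosed_eq (hcont.comp ((TensorAlgebra.coe M).extendOfNorm i).continuous) continuous_id)
      fun t => (congrArg _ (e2 t)).trans (e1 t)
    hom_mul := fun a b => by
      simp only [ContinuousLinearMap.coe_coe]
      refine hc.induction_on a (isClosed_eq (hcont.comp (continuous_mul_const b))
        ((N.completion.continuous_comp_left _).comp hcont)) fun s => ?_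
      refine hc.induction_on b (isClosed_eq (hcont.comp (continuous_const_mul _))
        ((N.completion.continuous_comp_right _).comp hcont)) fun t => ?_
      induction s with
      | zero => simp
      | add s s' hs hs' => simp only [map_add, add_mul, LinearMap.add_apply, hs, hs']
      | tmul a b =>
        induction t with
        | zero => simp
        | add t t' ht ht' => simp only [map_add, mul_add, ht, ht']
        | tmul a' b' =>
          rw [e1, e1, i_tmul, i_tmul, N.comp_tens, ← lmul_mul, ← lmul_mul, ← i_tmul, ← e1]
          exact congrArg _ (TensorAlgebra.tmul_mul_tmul M a a' b b')
    hom_star := fun a => by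
      simp only [ContinuousLinearMap.coe_coe]
      refine hc.induction_on a (isClosed_eq (hcont.comp continuous_star)
        ((N.completion.continuous_adj).comp hcont)) fun s => ?_
      induction s with
      | zero => simp
      | add s s' hs hs' => simp only [map_add, star_add, hs, hs']
      | tmul a b =>
        rw [e1, i_tmul, N.adj_tens, ← lmul_star, ← lmul_star, ← i_tmul, ← e1]
        exact congrArg _ (TensorAlgebra.star_tmul M a b) }

lemma tensorEndIso_inv (h : N.Extends M) (a : A) (b : B) :
    (tensorEndIso h).inv (N.tens (lmul A a) (lmul B b)) = TensorAlgebra.tmul M a b := by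
  have h1 : (tensorEndIso h).hom (TensorAlgebra.tmul M a b) = N.tens (lmul A a) (lmul B b) := by
    refine LinearMap.extendOfNorm_eq (TensorAlgebra.denseRange_coe M) ⟨1, fun t => ?_⟩
      (a ⊗ₜ[ℂ] b)
    rw [one_mul]
    exact ((N.norm_tensMap _).trans ((h t).trans (TensorAlgebra.norm_coe M t).symm)).le
  rw [← h1, (tensorEndIso h).inv_hom]

end compatible

/-! ### The standard module over a tensor product -/

section stdTensor

lemma tendsto_product_atTop :
    Filter.Tendsto (fun s : Finset ℕ => s ×ˢ s) Filter.atTop Filter.atTop := by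
  refine Filter.tendsto_atTop_atTop.mpr fun F => ?_
  refine ⟨F.image Prod.fst ∪ F.image Prod.snd, fun s hs => ?_⟩
  intro x hx
  exact Finset.mem_product.mpr
    ⟨hs (Finset.mem_union_left _ (Finset.mem_image_of_mem _ hx)),
      hs (Finset.mem_union_right _ (Finset.mem_image_of_mem _ hx))⟩

/-- A double series of positive elements converges if its square partial sums do. -/
lemma hasSum_of_tendsto_square {T : Type u} [NonUnitalCStarAlgebra T] {f : ℕ × ℕ → T}
    (hf : ∀ i, ∃ t, f i = star t * t) {L : T}
    (hL : Filter.Tendsto (fun s : Finset ℕ => ∑ i ∈ s ×ˢ s, f i) Filter.atTop (nhds L)) :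
    HasSum f L := by
  let _ := CStarAlgebra.spectralOrder T
  have _ := CStarAlgebra.spectralOrderedRing T
  have hpos : ∀ i, 0 ≤ f i := fun i => by
    obtain ⟨t, ht⟩ := hf i
    rw [ht]
    exact star_mul_self_nonneg t
  have hle : ∀ F : Finset (ℕ × ℕ), 0 ≤ L - ∑ i ∈ F, f i := fun F => by
    refine CStarAlgebra.isClosed_nonneg.mem_of_tendsto (hL.sub_const _) ?_
    filter_upwards [tendsto_product_atTop.eventually (Filter.eventually_ge_atTop F)] with s hs
    exact sub_nonneg.mpr (Finset.sum_le_sum_of_subset_of_nonneg hs fun i _ _ => hpos i)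
  refine Metric.tendsto_atTop.mpr fun ε hε => ?_
  obtain ⟨s, hs⟩ := Metric.tendsto_atTop.mp hL ε hε
  refine ⟨s ×ˢ s, fun F hF => lt_of_le_of_lt ?_ (hs s le_rfl)⟩
  rw [dist_comm, dist_eq_norm, dist_comm, dist_eq_norm]
  exact CStarAlgebra.norm_le_norm_of_nonneg_of_le (hle F)
    (sub_le_sub_left (Finset.sum_le_sum_of_subset_of_nonneg hF fun i _ _ => hpos i) L)

variable {A : Type u} {B : Type v} [NonUnitalCStarAlgebra A] [NonUnitalCStarAlgebra B]
  {M : CStarSeminorm (boxdot (ofAlgebra A) (ofAlgebra B))}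

lemma tendsto_bilin {E F G I : Type*} [NormedAddCommGroup E] [NormedSpace ℂ E]
    [NormedAddCommGroup F] [NormedSpace ℂ F] [NormedAddCommGroup G] [NormedSpace ℂ G]
    (β : E →L[ℂ] F →L[ℂ] G) {l : Filter I} {x : I → E} {y : I → F} {a : E} {b : F}
    (hx : Filter.Tendsto x l (nhds a)) (hy : Filter.Tendsto y l (nhds b)) :
    Filter.Tendsto (fun i => β (x i) (y i)) l (nhds (β a b)) :=
  (β.continuous₂.tendsto (a, b)).comp (hx.prodMk_nhds hy)

lemma tendsto_square_tmul (hM : M.IsSubcross) {x : ℕ → A} {y : ℕ → B} {a : A} {b : B}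
    (hx : HasSum x a) (hy : HasSum y b) :
    Filter.Tendsto (fun s : Finset ℕ => ∑ i ∈ s ×ˢ s, TensorAlgebra.tmul M (x i.1) (y i.2))
      Filter.atTop (nhds (TensorAlgebra.tmul M a b)) := by
  have hx' : Filter.Tendsto (fun s : Finset ℕ => ∑ m ∈ s, x m) Filter.atTop (nhds a) := hx
  have hy' : Filter.Tendsto (fun s : Finset ℕ => ∑ n ∈ s, y n) Filter.atTop (nhds b) := hy
  have h1 : Filter.Tendsto (fun s : Finset ℕ => TensorAlgebra.tmulL hM (∑ m ∈ s, x m)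
      (∑ n ∈ s, y n)) Filter.atTop (nhds (TensorAlgebra.tmulL hM a b)) :=
    tendsto_bilin (TensorAlgebra.tmulL hM) hx' hy'
  refine h1.congr fun s => ?_
  rw [Finset.sum_product, map_sum (TensorAlgebra.tmulL hM), _root_.sum_apply]
  exact Finset.sum_congr rfl fun m _ => map_sum (TensorAlgebra.tmulL hM (x m)) _ _

lemma hasSum_tmul_sq (hM : M.IsSubcross) (a : StdModule.Carrier A) (b : StdModule.Carrier B) :
    HasSum (fun i : ℕ × ℕ => star (TensorAlgebra.tmul M (a.1 i.1) (b.1 i.2)) *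
        TensorAlgebra.tmul M (a.1 i.1) (b.1 i.2))
      (TensorAlgebra.tmul M ((stdModule A).inner a a) ((stdModule B).inner b b)) := by
  refine hasSum_of_tendsto_square (fun i => ⟨_, rfl⟩) ?_
  refine (tendsto_square_tmul hM a.2.hasSum b.2.hasSum).congr fun s => ?_
  refine Finset.sum_congr rfl fun i _ => ?_
  rw [TensorAlgebra.star_tmul, TensorAlgebra.tmul_mul_tmul]

/-- The element `(a_m ⊗ b_n)_{m,n}` of the standard module over `A ⊗ B`, where pairs of natural
numbers are encoded as natural numbers. -/
def stdTensor (hM : M.IsSubcross) : StdModule.Carrier A →ₗ[ℂ] StdModule.Carrier B →ₗ[ℂ]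
    StdModule.Carrier (TensorAlgebra M) :=
  LinearMap.mk₂ ℂ (fun a b =>
      ⟨fun k => TensorAlgebra.tmul M (a.1 k.unpair.1) (b.1 k.unpair.2),
        (Nat.pairEquiv.symm.summable_iff (f := fun i : ℕ × ℕ =>
          star (TensorAlgebra.tmul M (a.1 i.1) (b.1 i.2)) *
            TensorAlgebra.tmul M (a.1 i.1) (b.1 i.2))).mpr (hasSum_tmul_sq hM a b).summable⟩)
    (fun a a' b => Subtype.ext <| funext fun k =>
      (TensorAlgebra.tmulL hM).map_add₂ (a.1 k.unpair.1) (a'.1 k.unpair.1) (b.1 k.unpair.2))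
    (fun c a b => Subtype.ext <| funext fun k =>
      (TensorAlgebra.tmulL hM).map_smul₂ c (a.1 k.unpair.1) (b.1 k.unpair.2))
    (fun a b b' => Subtype.ext <| funext fun k =>
      (TensorAlgebra.tmulL hM (a.1 k.unpair.1)).map_add (b.1 k.unpair.2) (b'.1 k.unpair.2))
    (fun c a b => Subtype.ext <| funext fun k =>
      (TensorAlgebra.tmulL hM (a.1 k.unpair.1)).map_smul c (b.1 k.unpair.2))

lemma stdTensor_apply (hM : M.IsSubcross) (a : StdModule.Carrier A) (b : StdModule.Carrier B)
    (k : ℕ) : (stdTensor hM a b).1 k =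
      TensorAlgebra.tmul M (a.1 k.unpair.1) (b.1 k.unpair.2) := rfl

lemma inner_stdTensor (hM : M.IsSubcross) (a a' : StdModule.Carrier A)
    (b b' : StdModule.Carrier B) :
    (stdModule (TensorAlgebra M)).inner (stdTensor hM a b) (stdTensor hM a' b') =
      TensorAlgebra.tmul M ((stdModule A).inner a a') ((stdModule B).inner b b') := by
  have h1 := (StdModule.summable_inner (stdTensor hM a b) (stdTensor hM a' b')).hasSum
  have h2 := (Nat.pairEquiv.hasSum_iff).mpr h1
  refine tendsto_nhds_unique (h2.comp tendsto_product_atTop) ?_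
  refine (tendsto_square_tmul hM (StdModule.summable_inner a a').hasSum
    (StdModule.summable_inner b b').hasSum).congr fun s => ?_
  refine Finset.sum_congr rfl fun i _ => ?_
  simp only [Function.comp_apply, stdTensor_apply, Nat.pairEquiv_apply,
    Function.uncurry_def, Nat.unpair_pair, TensorAlgebra.star_tmul, TensorAlgebra.tmul_mul_tmul]

lemma stdTensor_single (hM : M.IsSubcross) (m n : ℕ) (a : A) (b : B) :
    stdTensor hM (StdModule.single m a) (StdModule.single n b) =
      StdModule.single (Nat.pair m n) (TensorAlgebra.tmul M a b) := by
  refine Subtype.ext (funext fun k => ?_)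
  rw [stdTensor_apply, StdModule.single_val, StdModule.single_val, StdModule.single_val]
  have h0 : ∀ y : B, TensorAlgebra.tmul M (0 : A) y = 0 := fun y =>
    (TensorAlgebra.tmulL hM).map_zero₂ y
  have h0' : ∀ x : A, TensorAlgebra.tmul M x (0 : B) = 0 := fun x =>
    (TensorAlgebra.tmulL hM x).map_zero
  rcases eq_or_ne k (Nat.pair m n) with rfl | hk
  · rw [Nat.unpair_pair, Pi.single_eq_same, Pi.single_eq_same, Pi.single_eq_same]
  · rw [Pi.single_eq_of_ne hk]
    by_cases h1 : k.unpair.1 = m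
    · have h2 : k.unpair.2 ≠ n := fun h2 => hk (by rw [← h1, ← h2, Nat.pair_unpair])
      rw [Pi.single_eq_of_ne h2, h0']
    · rw [Pi.single_eq_of_ne h1, h0]

/-- The canonical map from `H_A ⊙ H_B` to the standard module over `A ⊗ B`. -/
def stdTensorMap (hM : M.IsSubcross) :
    stdModule A ⊗[ℂ] stdModule B →ₗ[ℂ] stdModule (TensorAlgebra M) :=
  TensorProduct.lift (stdTensor hM)

lemma inner_stdTensorMap (hM : M.IsSubcross) (a a' : stdModule A) (b b' : stdModule B) :
    (stdModule (TensorAlgebra M)).inner (stdTensorMap hM (a ⊗ₜ[ℂ] b))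
      (stdTensorMap hM (a' ⊗ₜ[ℂ] b')) =
      TensorAlgebra.tmul M ((stdModule A).inner a a') ((stdModule B).inner b b') :=
  inner_stdTensor hM a a' b b'

lemma denseRange_stdTensorMap (hM : M.IsSubcross) : DenseRange (stdTensorMap hM) := by
  change DenseRange (TensorProduct.lift (stdTensor hM))
  set S := (LinearMap.range (TensorProduct.lift (stdTensor hM))).topologicalClosure
  have hS : IsClosed (S : Set (StdModule.Carrier (TensorAlgebra M))) :=
    Submodule.isClosed_topologicalClosure _
  refine fun k => StdModule.mem_of_single_mem (S := S) hS (fun n t => ?_) k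
  have hc : Continuous (StdModule.single (A := TensorAlgebra M) n) :=
    AddMonoidHomClass.continuous_of_bound _ 1 fun t => by rw [one_mul, StdModule.norm_single]
  refine (TensorAlgebra.denseRange_coe M).induction_on
    (p := fun t => StdModule.single n t ∈ S) t (hS.preimage hc) fun t => ?_
  induction t with
  | zero => simp
  | add t t' ht ht' => simpa only [map_add] using S.add_mem ht ht'
  | tmul a b =>
    refine Submodule.le_topologicalClosure _ ⟨StdModule.single n.unpair.1 a ⊗ₜ[ℂ]
      StdModule.single n.unpair.2 b, ?_⟩
    rw [TensorProduct.lift.tmul, stdTensor_single, Nat.pair_unpair, TensorAlgebra.coe_tmul]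

end stdTensor

/-! ### The equivalence for compatible seminorms -/

lemma HilbertModule.IsSummandOfStd.of_isometry {T : Type u} [NonUnitalCStarAlgebra T]
    {G G' : HilbertModule.{u, u} T} (hG : G'.IsSummandOfStd) {V : G →L[ℂ] G'} {S : G' →L[ℂ] G}
    (h : IsAdjoint V S) (h1 : S.comp V = ContinuousLinearMap.id ℂ G) : G.IsSummandOfStd := by
  obtain ⟨V', S', h', h1'⟩ := hG
  refine ⟨V'.comp V, S.comp S', h'.comp h, ContinuousLinearMap.ext fun x => ?_⟩
  have e1 : S' (V' (V x)) = V x := congrArg (fun R => R (V x)) h1'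
  have e2 : S (V x) = x := congrArg (fun R => R x) h1
  change S (S' (V' (V x))) = x
  rw [e1, e2]

section split

variable {C : CStarCat.{u, w}} {P : C.Obj} {T : Type w} [NonUnitalCStarAlgebra T]
  (φ : EndIso C P T)

/-- For a projection `p` on `X`, the submodule `p C(P, X)` is complemented in `C(P, X)`. -/
lemma isAdjoint_splitIncl (X : (split C).Obj) :
    IsAdjoint (E := homModule φ.split X) (F := homModule φ X.1) (splitIncl (splitObj P) X)
      (splitProj P X) := by
  have key : ∀ (g : (split C).Hom (splitObj P) X) (k : C.Hom P X.1),
      C.comp (C.adj (splitIncl _ _ g)) k = C.comp (C.adj (splitIncl _ _ g)) (X.2.1.L P k) := by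
    intro g k
    rw [X.2.1.compat, X.2.2.R_adj, L_splitIncl]
  exact fun g k => congrArg φ.inv (key g k)

lemma splitProj_comp_splitIncl (X : (split C).Obj) :
    (splitProj P X).comp (splitIncl (splitObj P) X) = ContinuousLinearMap.id ℂ _ :=
  ContinuousLinearMap.ext fun g => splitIncl_injective _ _ (L_splitIncl g)

end split

section equivalence

variable {A : Type u} {B : Type v} [NonUnitalCStarAlgebra A] [NonUnitalCStarAlgebra B]
  {N : CStarSeminorm (boxdot (Hilb A) (Hilb B))}
  {M : CStarSeminorm (boxdot (ofAlgebra A) (ofAlgebra B))}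

/-- The canonical map from `E ⊙ F` to the module of morphisms `(A, B) → (E, F)`. -/
def extMap (h : N.Extends M) (E : (Hilb A).Obj) (F : (Hilb B).Obj) :
    Hilb.mod E ⊗[ℂ] Hilb.mod F →ₗ[ℂ] homModule (tensorEndIso h) (N.pair E F) :=
  N.tensMap (selfObj A) E (selfObj B) F ∘ₗ (TensorProduct.congr (ket E) (ket F)).toLinearMap

lemma denseRange_extMap (h : N.Extends M) (E : (Hilb A).Obj) (F : (Hilb B).Obj) :
    DenseRange (extMap h E F) :=
  denseRange_comp_of_surjective (N.denseRange_tensMap (selfObj A) E (selfObj B) F)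
    (TensorProduct.congr (ket E) (ket F)).surjective

lemma inv_adj_tens_ket (h : N.Extends M) {E : (Hilb A).Obj} {F : (Hilb B).Obj} (ξ ζ : Hilb.mod E)
    (η κ : Hilb.mod F) :
    (tensorEndIso h).inv (N.completion.comp (N.completion.adj (N.tens (ket E ξ) (ket F η)))
      (N.tens (ket E ζ) (ket F κ))) =
      TensorAlgebra.tmul M ((Hilb.mod E).inner ξ ζ) ((Hilb.mod F).inner η κ) := by
  rw [N.adj_tens, N.comp_tens, adj_ket_comp_ket, adj_ket_comp_ket, tensorEndIso_inv]

lemma inner_extMap (h : N.Extends M) {E : (Hilb A).Obj} {F : (Hilb B).Obj} (ξ ζ : Hilb.mod E)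
    (η κ : Hilb.mod F) :
    (homModule (tensorEndIso h) (N.pair E F)).inner (extMap h E F (ξ ⊗ₜ[ℂ] η))
      (extMap h E F (ζ ⊗ₜ[ℂ] κ)) =
      TensorAlgebra.tmul M ((Hilb.mod E).inner ξ ζ) ((Hilb.mod F).inner η κ) :=
  inv_adj_tens_ket h ξ ζ η κ

/-- The exterior tensor product of adjointable isometries into the standard modules. -/
lemma exists_isometry_std (hM : M.IsSubcross) (h : N.Extends M) {E : (Hilb A).Obj}
    {F : (Hilb B).Obj} {V : Hilb.mod E →L[ℂ] stdModule A} {S : stdModule A →L[ℂ] Hilb.mod E}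
    {V' : Hilb.mod F →L[ℂ] stdModule B} {S' : stdModule B →L[ℂ] Hilb.mod F}
    (hV : IsAdjoint V S) (hV' : IsAdjoint V' S') (h1 : S.comp V = ContinuousLinearMap.id ℂ _)
    (h1' : S'.comp V' = ContinuousLinearMap.id ℂ _) :
    ∃ (W : homModule (tensorEndIso h) (N.pair E F) →L[ℂ] stdModule (TensorAlgebra M))
      (R : stdModule (TensorAlgebra M) →L[ℂ] homModule (tensorEndIso h) (N.pair E F)),
      IsAdjoint W R ∧ R.comp W = ContinuousLinearMap.id ℂ _ ∧
      (V.comp S = ContinuousLinearMap.id ℂ _ → V'.comp S' = ContinuousLinearMap.id ℂ _ →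
        W.comp R = ContinuousLinearMap.id ℂ _) := by
  have hi := inner_eq_of_tmul (j := extMap h E F) (j' := stdTensorMap hM)
    (R := TensorProduct.map V.toLinearMap V'.toLinearMap)
    (R' := TensorProduct.map S.toLinearMap S'.toLinearMap) fun ξ η a b =>
      (inner_stdTensorMap hM (V ξ) a (V' η) b).trans
        ((congrArg₂ (TensorAlgebra.tmul M) (hV ξ a) (hV' η b)).trans
          (inner_extMap h ξ (S a) η (S' b)).symm)
  have e : S.toLinearMap ∘ₗ V.toLinearMap = LinearMap.id :=
    LinearMap.ext fun x => congrArg (fun R => R x) h1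
  have e' : S'.toLinearMap ∘ₗ V'.toLinearMap = LinearMap.id :=
    LinearMap.ext fun x => congrArg (fun R => R x) h1'
  obtain ⟨W, R, hW, h2, h3⟩ := exists_isometry_of_denseRange (denseRange_extMap h E F)
    (denseRange_stdTensorMap hM) _ _ hi fun x => by
      rw [← LinearMap.comp_apply, ← TensorProduct.map_comp, e, e', TensorProduct.map_id]
      rfl
  refine ⟨W, R, hW, h2, fun h4 h4' => h3 fun y => ?_⟩
  have f : V.toLinearMap ∘ₗ S.toLinearMap = LinearMap.id :=
    LinearMap.ext fun x => congrArg (fun R => R x) h4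
  have f' : V'.toLinearMap ∘ₗ S'.toLinearMap = LinearMap.id :=
    LinearMap.ext fun x => congrArg (fun R => R x) h4'
  rw [← LinearMap.comp_apply, ← TensorProduct.map_comp, f, f', TensorProduct.map_id]
  rfl

lemma isSummandOfStd_homModule (hM : M.IsSubcross) (h : N.Extends M) (X : N.completion.Obj) :
    (homModule (tensorEndIso h) X).IsSummandOfStd := by
  obtain ⟨⟨E, V, S, hV, h1⟩, ⟨F, V', S', hV', h1'⟩⟩ := X
  obtain ⟨W, R, hW, h2, -⟩ := exists_isometry_std hM h (E := ⟨E, V, S, hV, h1⟩)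
    (F := ⟨F, V', S', hV', h1'⟩) hV hV' h1 h1'
  exact ⟨W, R, hW, h2⟩

lemma isSummandOfStd_homModule_split (hM : M.IsSubcross) (h : N.Extends M) (X : (boxtimes N).Obj) :
    (homModule (tensorEndIso h).split X).IsSummandOfStd :=
  (isSummandOfStd_homModule hM h X.1).of_isometry (isAdjoint_splitIncl _ X)
    (splitProj_comp_splitIncl X)

lemma isGenerating_genObj (hN : N.IsSubcross) : IsGenerating (C := N.completion) N.genObj :=
  isGenerating_completion hN isGenerating_selfObj isGenerating_selfObj

/-- The functor `Hilb_A ⊠ Hilb_B → Hilb_{A ⊗ B}` represented by the object `(A, B)`. -/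
def extFunctor (hN : N.IsSubcross) (hM : M.IsSubcross) (h : N.Extends M) :
    StarFunctor (boxtimes N) (Hilb (TensorAlgebra M)) :=
  homFunctor (tensorEndIso h).split (isGenerating_split (isGenerating_genObj hN))
    (isSummandOfStd_homModule_split hM h)

lemma extFunctor_fullyFaithful (hN : N.IsSubcross) (hM : M.IsSubcross) (h : N.Extends M) :
    (extFunctor hN hM h).FullyFaithful :=
  homFunctor_fullyFaithful _ _

/-- Every direct summand of the standard module over `A ⊗ B` is in the essential image: it is cut
out of `H_A ⊠ H_B` by a multiplier projection. -/
lemma extFunctor_essSurj (hN : N.IsSubcross) (hM : M.IsSubcross) (h : N.Extends M)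
    (Y : (Hilb (TensorAlgebra M)).Obj) :
    ∃ (X : (boxtimes N).Obj) (m : Multiplier (Hilb (TensorAlgebra M)) ((extFunctor hN hM h).obj X) Y),
      m.IsUnitary := by
  obtain ⟨V, S, hVS, hSV⟩ : (Hilb.mod Y).IsSummandOfStd :=
    (show {E : HilbertModule (TensorAlgebra M) // E.IsSummandOfStd} from Y).2
  obtain ⟨W, R, hWR, -, hWR1⟩ := exists_isometry_std hM h (E := stdObj A) (F := stdObj B)
    isAdjoint_id isAdjoint_id rfl rfl
  have hWR1 := hWR1 rfl rfl
  let X₀ : N.completion.Obj := N.pair (stdObj A) (stdObj B)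
  let φ := tensorEndIso h
  have eSV : ∀ y, S (V y) = y := fun y => congrArg (fun R => R y) hSV
  have eWR : ∀ y, W (R y) = y := fun y => congrArg (fun R => R y) hWR1
  -- the projection onto the summand, transported to the module of `(H_A, H_B)`
  let Q : homModule φ X₀ →L[ℂ] homModule φ X₀ := (R.comp V).comp (S.comp W)
  have hQ : IsAdjoint Q Q := (hWR.symm.comp hVS).comp (hVS.symm.comp hWR)
  have hQQ : Q.comp Q = Q := ContinuousLinearMap.ext fun g => by
    change R (V (S (W (R (V (S (W g))))))) = R (V (S (W g)))
    rw [eWR, eSV]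
  have hgen := isGenerating_genObj hN
  have hstd := isSummandOfStd_homModule hM h
  have hF : (homFunctor φ hgen hstd).FullyFaithful := homFunctor_fullyFaithful _ _
  let p : Multiplier N.completion X₀ X₀ :=
    hF.pullback (X := X₀) (Y := X₀) (Hilb.multiplier (E := homObj hstd X₀) (F := homObj hstd X₀) hQ)
  have hp : p.IsProjection := hF.isProjection_pullback
    (Hilb.isProjection_multiplier (E := homObj hstd X₀) hQ hQQ)
  have hpQ : ∀ g : N.completion.Hom N.genObj X₀, p.L _ g = Q (homModule.of φ g) := by
    intro g
    refine N.completion.eq_of_comp_eq fun k => ?_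
    have h1 : Hilb.op ((homFunctor φ hgen hstd).map (p.L _ g)) =
        Q.comp (leftComp φ N.genObj X₀ g) :=
      congrArg Hilb.op (hF.map_pullback_L (Hilb.multiplier (E := homObj hstd X₀)
        (F := homObj hstd X₀) hQ) g)
    have h2 : N.completion.comp (p.L _ g) k = Q (homModule.of φ (N.completion.comp g k)) :=
      congrArg (fun T => T (homModule.of φ k)) h1
    have h3 : ∀ k, Q (homModule.of φ (N.completion.comp g k)) =
        N.completion.comp (homModule.hom φ (Q (homModule.of φ g))) k := fun k => by
      have h4 := hQ.map_act (homModule.of φ g) (φ.inv k)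
      have h5 : ∀ g' : N.completion.Hom N.genObj X₀,
          (homModule φ X₀).act (homModule.of φ g') (φ.inv k) =
            homModule.of φ (N.completion.comp g' k) := fun g' =>
        congrArg (N.completion.comp g') (φ.hom_inv k)
      rw [h5] at h4
      exact h4.trans (h5 _)
    exact h2.trans (h3 k)
  let X : (split N.completion).Obj := ⟨X₀, p, hp⟩
  let I : homModule φ.split X →L[ℂ] homModule φ X₀ := splitIncl (splitObj N.genObj) X
  let J : homModule φ X₀ →L[ℂ] homModule φ.split X := splitProj N.genObj X
  have hIJ : IsAdjoint I J := isAdjoint_splitIncl φ X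
  have eJI : ∀ g, J (I g) = g := fun g =>
    congrArg (fun R => R g) (splitProj_comp_splitIncl (P := N.genObj) X)
  have eIJ : ∀ g, I (J g) = Q g := fun g => hpQ g
  have eQI : ∀ g, Q (I g) = I g := fun g => by rw [← eIJ, eJI]
  refine ⟨X, Hilb.multiplier (E := homObj (isSummandOfStd_homModule_split hM h) X) (F := Y)
    (T := (S.comp W).comp I) (S := J.comp (R.comp V)) ((hVS.symm.comp hWR).comp hIJ),
    Hilb.isUnitary_multiplier (E := homObj (isSummandOfStd_homModule_split hM h) X) (F := Y)
      ((hVS.symm.comp hWR).comp hIJ) ?_ ?_⟩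
  · refine ContinuousLinearMap.ext fun g => ?_
    exact (congrArg J (eQI g)).trans (eJI g)
  · refine ContinuousLinearMap.ext fun y => ?_
    change S (W (I (J (R (V y))))) = y
    rw [eIJ]
    change S (W (R (V (S (W (R (V y))))))) = y
    rw [eWR, eWR, eSV, eSV]

lemma boxtimesMap_comp {E E' : (Hilb A).Obj} {F F' : (Hilb B).Obj} (S : (Hilb A).Hom E E')
    (T : (Hilb B).Hom F F') (ξ : Hilb.mod E) (η : Hilb.mod F) :
    (boxtimes N).comp (boxtimesMap N S T) (boxtimesMap N (ket E ξ) (ket F η)) =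
      boxtimesMap N (ket E' (Hilb.op S ξ)) (ket F' (Hilb.op T η)) := by
  refine Subtype.ext ?_
  rw [← comp_ket, ← comp_ket]
  exact N.comp_tens S T (ket E ξ) (ket F η)

/-- The functor represented by `(A, B)` is given by exterior tensor products. -/
lemma extFunctor_isInduced (hN : N.IsSubcross) (hM : M.IsSubcross) (h : N.Extends M) :
    IsInducedByExteriorTensor N M (extFunctor hN hM h) := by
  let j : ∀ (E : (Hilb A).Obj) (F : (Hilb B).Obj), Hilb.mod E ⊗[ℂ] Hilb.mod F →ₗ[ℂ]
      homModule (tensorEndIso h).split (splitObj (N.pair E F)) := fun E F =>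
    (splitProj N.genObj (splitObj (N.pair E F))).toLinearMap ∘ₗ extMap h E F
  refine ⟨fun E F => (TensorProduct.mk ℂ (Hilb.mod E) (Hilb.mod F)).compr₂ (j E F),
    fun E F => ⟨fun ξ ζ η κ => inv_adj_tens_ket h ξ ζ η κ, ?_⟩,
    fun E E' F F' S T ξ η => boxtimesMap_comp S T ξ η⟩
  have hd : DenseRange (j E F) := by
    refine DenseRange.comp (g := splitProj N.genObj (splitObj (N.pair E F)))
      (Function.Surjective.denseRange fun g => ⟨splitIncl _ _ g, splitIncl_injective _ _ ?_⟩)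
      (denseRange_extMap h E F) (ContinuousLinearMap.continuous _)
    rfl
  refine eq_top_iff.mpr fun g _ => ?_
  refine closure_mono ?_ (hd g)
  rintro _ ⟨t, rfl⟩
  induction t with
  | zero => exact (map_zero (j E F)).symm ▸ Submodule.zero_mem _
  | add t t' ht ht' => exact (map_add (j E F) t t').symm ▸ Submodule.add_mem _ ht ht'
  | tmul ξ η => exact Submodule.subset_span ⟨ξ, η, rfl⟩

/-- If `N` is a seminorm on `Hilb_A ⊙ Hilb_B` which extends the seminorm `M` on `A ⊙ B`, then the
exterior tensor product is an equivalence between the corresponding categories. -/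
theorem exists_isEquivalence_of_extends (hN : N.IsSubcross) (hM : M.IsSubcross)
    (h : N.Extends M) :
    ∃ Φ : StarFunctor (boxtimes N) (Hilb (TensorAlgebra M)),
      Φ.IsEquivalence ∧ IsInducedByExteriorTensor N M Φ :=
  ⟨extFunctor hN hM h,
    (extFunctor_fullyFaithful hN hM h).isEquivalence (extFunctor_essSurj hN hM h),
    extFunctor_isInduced hN hM h⟩

end equivalence

/-! ### Tensor products of representations on Hilbert spaces -/

section spatial

variable {A : Type u} {B : Type v} [NonUnitalCStarAlgebra A] [NonUnitalCStarAlgebra B]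
  {H : Type w₁} {H' : Type w₂} {K : Type w₃} {K' : Type w₄}
  [NormedAddCommGroup H] [InnerProductSpace ℂ H]
  [NormedAddCommGroup H'] [InnerProductSpace ℂ H']
  [NormedAddCommGroup K] [InnerProductSpace ℂ K]
  [NormedAddCommGroup K'] [InnerProductSpace ℂ K']

/-- The action of `A ⊙ B` on the algebraic tensor product `H ⊙ K` given by actions of `A` on `H`
and of `B` on `K`. -/
def tensorAct (ρ : A →ₗ[ℂ] (H →L[ℂ] H)) (σ : B →ₗ[ℂ] (K →L[ℂ] K)) :
    A ⊗[ℂ] B →ₗ[ℂ] (H ⊗[ℂ] K →ₗ[ℂ] H ⊗[ℂ] K) :=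
  TensorProduct.homTensorHomMap (.id ℂ) H K H K ∘ₗ
    TensorProduct.map (ContinuousLinearMap.coeLM ℂ ∘ₗ ρ) (ContinuousLinearMap.coeLM ℂ ∘ₗ σ)

lemma tensorAct_tmul (ρ : A →ₗ[ℂ] (H →L[ℂ] H)) (σ : B →ₗ[ℂ] (K →L[ℂ] K)) (a : A) (b : B) (x : H)
    (y : K) : tensorAct ρ σ (a ⊗ₜ[ℂ] b) (x ⊗ₜ[ℂ] y) = ρ a x ⊗ₜ[ℂ] σ b y := by
  simp [tensorAct]

/-- The extension of the action of `A ⊙ B` to the Hilbert space tensor product. -/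
def spatial (ρ : A →ₗ[ℂ] (H →L[ℂ] H)) (σ : B →ₗ[ℂ] (K →L[ℂ] K)) :
    A ⊗[ℂ] B →ₗ[ℂ] (UniformSpace.Completion (H ⊗[ℂ] K) →L[ℂ] UniformSpace.Completion (H ⊗[ℂ] K)) :=
  TensorProduct.lift (hilbertMap₂.compl₁₂ ρ σ)

lemma spatial_coe (ρ : A →ₗ[ℂ] (H →L[ℂ] H)) (σ : B →ₗ[ℂ] (K →L[ℂ] K)) (t : A ⊗[ℂ] B)
    (z : H ⊗[ℂ] K) : spatial ρ σ t (z : UniformSpace.Completion (H ⊗[ℂ] K)) =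
      (tensorAct ρ σ t z : H ⊗[ℂ] K) := by
  induction t with
  | zero =>
    rw [map_zero, map_zero, LinearMap.zero_apply, UniformSpace.Completion.coe_zero]
    rfl
  | add t t' h h' =>
    rw [map_add, map_add, _root_.add_apply, h, h', LinearMap.add_apply,
      UniformSpace.Completion.coe_add]
  | tmul a b =>
    refine (hilbertMap_coe (ρ a) (σ b) z).trans (congrArg _ ?_)
    induction z with
    | zero => simp
    | add z z' h h' => rw [map_add, map_add, h, h']
    | tmul x y => rw [tensorAct_tmul, TensorProduct.mapL_tmul]

lemma norm_spatial_le (ρ : A →ₗ[ℂ] (H →L[ℂ] H)) (σ : B →ₗ[ℂ] (K →L[ℂ] K)) (t : A ⊗[ℂ] B) {C : ℝ}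
    (hC : 0 ≤ C) (h : ∀ z, ‖tensorAct ρ σ t z‖ ≤ C * ‖z‖) : ‖spatial ρ σ t‖ ≤ C := by
  refine ContinuousLinearMap.opNorm_le_bound _ hC fun z => ?_
  induction z using UniformSpace.Completion.induction_on with
  | hp => exact isClosed_le (by fun_prop) (by fun_prop)
  | ih z =>
    rw [spatial_coe, UniformSpace.Completion.norm_coe, UniformSpace.Completion.norm_coe]
    exact h z

lemma norm_tensorAct_le (ρ : A →ₗ[ℂ] (H →L[ℂ] H)) (σ : B →ₗ[ℂ] (K →L[ℂ] K)) (t : A ⊗[ℂ] B)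
    (z : H ⊗[ℂ] K) : ‖tensorAct ρ σ t z‖ ≤ ‖spatial ρ σ t‖ * ‖z‖ := by
  have h := (spatial ρ σ t).le_opNorm (z : UniformSpace.Completion (H ⊗[ℂ] K))
  rwa [spatial_coe, UniformSpace.Completion.norm_coe, UniformSpace.Completion.norm_coe] at h

lemma norm_spatial_comm_le (ρ : A →ₗ[ℂ] (H →L[ℂ] H)) (σ : B →ₗ[ℂ] (K →L[ℂ] K)) (t : A ⊗[ℂ] B) :
    ‖spatial σ ρ (TensorProduct.comm ℂ A B t)‖ ≤ ‖spatial ρ σ t‖ := by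
  have h : ∀ z, tensorAct σ ρ (TensorProduct.comm ℂ A B t) (TensorProduct.comm ℂ H K z) =
      TensorProduct.comm ℂ H K (tensorAct ρ σ t z) := fun z => by
    induction t with
    | zero => simp
    | add t t' h h' => simp only [map_add, LinearMap.add_apply, h, h']
    | tmul a b =>
      induction z with
      | zero => simp
      | add z z' h h' => rw [map_add, map_add, map_add, map_add, h, h']
      | tmul x y => simp only [TensorProduct.comm_tmul, tensorAct_tmul]
  refine norm_spatial_le _ _ _ (norm_nonneg (spatial ρ σ t)) fun z => ?_
  obtain ⟨z, rfl⟩ := (TensorProduct.comm ℂ H K).surjective z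
  rw [h, TensorProduct.norm_comm, TensorProduct.norm_comm]
  exact norm_tensorAct_le ρ σ t z

lemma norm_spatial_comm (ρ : A →ₗ[ℂ] (H →L[ℂ] H)) (σ : B →ₗ[ℂ] (K →L[ℂ] K)) (t : A ⊗[ℂ] B) :
    ‖spatial σ ρ (TensorProduct.comm ℂ A B t)‖ = ‖spatial ρ σ t‖ := by
  refine le_antisymm (norm_spatial_comm_le ρ σ t) ?_
  simpa using norm_spatial_comm_le σ ρ (TensorProduct.comm ℂ A B t)

/-- The slice map `x ⊗ y ↦ ⟨e, y⟩ x`. -/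
def slice (e : K) : H ⊗[ℂ] K →ₗ[ℂ] H :=
  (TensorProduct.rid ℂ H).toLinearMap ∘ₗ (innerSL ℂ e).toLinearMap.lTensor H

lemma slice_tmul (e : K) (x : H) (y : K) : slice e (x ⊗ₜ[ℂ] y) = inner ℂ e y • x := by
  simp [slice]

lemma inner_tmul_eq_inner_slice (x : H) (e : K) (z : H ⊗[ℂ] K) :
    inner ℂ (x ⊗ₜ[ℂ] e) z = inner ℂ x (slice e z) := by
  induction z with
  | zero => simp
  | add z z' h h' => rw [map_add, inner_add_right, inner_add_right, h, h']
  | tmul x' y => rw [TensorProduct.inner_tmul, slice_tmul, inner_smul_right, mul_comm]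

/-- The matrix coefficient `∑ aₖ ⊗ bₖ ↦ ∑ ⟨e, σ(bₖ) e'⟩ aₖ` of elements of `A ⊙ B`. -/
def sliceCoeff (σ : B →ₗ[ℂ] (K →L[ℂ] K)) (e e' : K) : A ⊗[ℂ] B →ₗ[ℂ] A :=
  (TensorProduct.rid ℂ A).toLinearMap ∘ₗ ((innerSL ℂ e).toLinearMap ∘ₗ
    (ContinuousLinearMap.apply ℂ K e').toLinearMap ∘ₗ σ).lTensor A

lemma slice_tensorAct (ρ : A →ₗ[ℂ] (H →L[ℂ] H)) (σ : B →ₗ[ℂ] (K →L[ℂ] K)) (e e' : K)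
    (t : A ⊗[ℂ] B) (x : H) :
    slice e (tensorAct ρ σ t (x ⊗ₜ[ℂ] e')) = ρ (sliceCoeff σ e e' t) x := by
  induction t with
  | zero => simp
  | add t t' h h' => simp only [map_add, LinearMap.add_apply, _root_.add_apply, h, h']
  | tmul a b =>
    rw [tensorAct_tmul, slice_tmul]
    simp [sliceCoeff]

section orthonormal

variable {n : Type*} [Fintype n] {e : n → K}

lemma slice_sum_tmul (he : Orthonormal ℂ e) (x : n → H) (i : n) :
    slice (e i) (∑ j, x j ⊗ₜ[ℂ] e j) = x i := by
  classical
  simp [slice_tmul, orthonormal_iff_ite.mp he, ite_smul]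

lemma norm_sum_tmul (he : Orthonormal ℂ e) (x : n → H) :
    ‖∑ j, x j ⊗ₜ[ℂ] e j‖ = ‖WithLp.toLp 2 x‖ := by
  rw [PiLp.norm_eq_of_L2, ← Real.sqrt_sq (norm_nonneg (∑ j, x j ⊗ₜ[ℂ] e j)),
    @norm_sq_eq_re_inner ℂ, sum_inner]
  congr 1
  rw [map_sum]
  refine Finset.sum_congr rfl fun i _ => ?_
  rw [inner_tmul_eq_inner_slice, slice_sum_tmul he, ← norm_sq_eq_re_inner]

/-- Bessel's inequality for slices. -/
lemma norm_slice_le (he : Orthonormal ℂ e) (z : H ⊗[ℂ] K) :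
    ‖WithLp.toLp 2 fun i => slice (e i) z‖ ≤ ‖z‖ := by
  rw [← norm_sum_tmul he]
  set y := ∑ i, slice (e i) z ⊗ₜ[ℂ] e i with hy
  have h : (inner ℂ y z : ℂ) = inner ℂ y y := by
    nth_rw 1 [hy]
    nth_rw 2 [hy]
    rw [sum_inner, sum_inner]
    refine Finset.sum_congr rfl fun i _ => ?_
    rw [inner_tmul_eq_inner_slice, inner_tmul_eq_inner_slice, slice_sum_tmul he]
  rcases (norm_nonneg y).eq_or_lt with h0 | h0
  · rw [← h0]; exact norm_nonneg _
  · refine le_of_mul_le_mul_left ?_ h0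
    have h1 := norm_inner_le_norm (𝕜 := ℂ) y z
    rw [h] at h1
    refine (le_of_eq ?_).trans h1
    rw [← inner_self_eq_norm_mul_norm (𝕜 := ℂ)]
    exact (inner_self_re_eq_norm y)

end orthonormal

lemma exists_orthonormal_sum_tmul (s : Set (H ⊗[ℂ] K)) (hs : s.Finite) :
    ∃ (n : ℕ) (e : Fin n → K), Orthonormal ℂ e ∧
      ∀ z ∈ s, ∃ x : Fin n → H, z = ∑ j, x j ⊗ₜ[ℂ] e j := by
  obtain ⟨N, hN, hsN⟩ := TensorProduct.exists_finite_submodule_right_of_setFinite s hs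
  let b := stdOrthonormalBasis ℂ N
  refine ⟨_, fun j => b j, b.orthonormal.comp_linearIsometry N.subtypeₗᵢ, fun z hz => ?_⟩
  obtain ⟨z, rfl⟩ := hsN hz
  clear hz
  induction z with
  | zero => exact ⟨0, by simp⟩
  | add z z' h h' =>
    obtain ⟨x, hx⟩ := h
    obtain ⟨x', hx'⟩ := h'
    exact ⟨x + x', by simp [hx, hx', TensorProduct.add_tmul, Finset.sum_add_distrib]⟩
  | tmul x k =>
    refine ⟨fun j => b.repr k j • x, ?_⟩
    have hk : (k : K) = ∑ j, b.repr k j • (b j : K) := by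
      nth_rw 1 [← b.sum_repr k]
      simp
    simp only [LinearMap.lTensor_tmul, Submodule.subtype_apply, TensorProduct.smul_tmul,
      ← TensorProduct.tmul_sum, ← hk]

/-- The action of `M_n(A)` on `Hⁿ` given by an action of `A` on `H`. -/
def amplify [CompleteSpace H] [PartialOrder A] [StarOrderedRing A] (n : ℕ)
    (ρ : A →⋆ₙₐ[ℂ] (H →L[ℂ] H)) : CStarMatrix (Fin n) (Fin n) A →⋆ₙₐ[ℂ]
      (PiLp 2 (fun _ : Fin n => H) →L[ℂ] PiLp 2 (fun _ : Fin n => H)) where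
  toFun m := ((PiLp.continuousLinearEquiv 2 ℂ fun _ : Fin n => H).symm :
      (Fin n → H) →L[ℂ] PiLp 2 (fun _ : Fin n => H)) ∘L
    ContinuousLinearMap.pi fun i => ∑ j, (ρ (m i j)) ∘L PiLp.proj 2 (fun _ : Fin n => H) j
  map_smul' c m := by
    ext y i
    simp [Finset.smul_sum]
  map_zero' := by
    ext y i
    simp
  map_add' m m' := by
    ext y i
    simp [Finset.sum_add_distrib]
  map_mul' m m' := by
    ext y i
    simp only [CStarMatrix.mul_apply, map_sum, map_mul]
    simp
    rw [Finset.sum_comm]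
  map_star' m := by
    rw [ContinuousLinearMap.star_eq_adjoint, ContinuousLinearMap.eq_adjoint_iff]
    intro x y
    simp [PiLp.inner_apply, CStarMatrix.star_apply, sum_inner, inner_sum, map_star,
      ContinuousLinearMap.star_eq_adjoint, ContinuousLinearMap.adjoint_inner_left]
    rw [Finset.sum_comm]

lemma amplify_apply [CompleteSpace H] [PartialOrder A] [StarOrderedRing A] {n : ℕ}
    (ρ : A →⋆ₙₐ[ℂ] (H →L[ℂ] H)) (m : CStarMatrix (Fin n) (Fin n) A)
    (x : PiLp 2 (fun _ : Fin n => H)) (i : Fin n) :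
    amplify n ρ m x i = ∑ j, ρ (m i j) (x j) := by
  simp [amplify]

lemma amplify_injective [CompleteSpace H] [PartialOrder A] [StarOrderedRing A] {n : ℕ}
    {ρ : A →⋆ₙₐ[ℂ] (H →L[ℂ] H)} (hρ : Function.Injective ρ) :
    Function.Injective (amplify n ρ) := by
  intro m m' h
  refine CStarMatrix.ext fun i j => hρ (ContinuousLinearMap.ext fun x => ?_)
  have h1 := congrArg (fun T => T (WithLp.toLp 2 (Pi.single j x)) i) h
  simp only [amplify_apply] at h1
  rw [Finset.sum_eq_single j, Finset.sum_eq_single j] at h1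
  · simpa using h1
  all_goals simp +contextual [Pi.single_eq_of_ne]

/-- The compression of an element of `A ⊙ B` to the span of a finite family of vectors of `K`, as a
matrix with entries in `A`. -/
def sliceMatrix {n : ℕ} (σ : B →ₗ[ℂ] (K →L[ℂ] K)) (e : Fin n → K) (t : A ⊗[ℂ] B) :
    CStarMatrix (Fin n) (Fin n) A :=
  CStarMatrix.ofMatrix fun i j => sliceCoeff σ (e i) (e j) t

lemma amplify_sliceMatrix [CompleteSpace H] [PartialOrder A] [StarOrderedRing A] {n : ℕ}
    (ρ : A →⋆ₙₐ[ℂ] (H →L[ℂ] H)) (σ : B →ₗ[ℂ] (K →L[ℂ] K)) (e : Fin n → K) (t : A ⊗[ℂ] B)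
    (x : Fin n → H) :
    amplify n ρ (sliceMatrix σ e t) (WithLp.toLp 2 x) = WithLp.toLp 2 fun i => slice (e i)
      (tensorAct (ρ : A →ₗ[ℂ] (H →L[ℂ] H)) σ t (∑ j, x j ⊗ₜ[ℂ] e j)) := by
  ext i
  change _ = slice (e i) (tensorAct (ρ : A →ₗ[ℂ] (H →L[ℂ] H)) σ t (∑ j, x j ⊗ₜ[ℂ] e j))
  rw [amplify_apply, map_sum (tensorAct (ρ : A →ₗ[ℂ] (H →L[ℂ] H)) σ t), map_sum (slice (e i))]
  refine Finset.sum_congr rfl fun j _ => ?_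
  rw [slice_tensorAct]
  rfl

/-- The norms of elements of `A ⊙ B` are not increased if an injective representation of `A` is
replaced by another one: they are governed by the norms of matrices with entries in `A`, on which
injective representations are isometric. -/
lemma norm_spatial_le_of_injective [CompleteSpace H] [CompleteSpace H']
    (ρ : A →⋆ₙₐ[ℂ] (H →L[ℂ] H)) {ρ' : A →⋆ₙₐ[ℂ] (H' →L[ℂ] H')} (hρ' : Function.Injective ρ')
    (σ : B →ₗ[ℂ] (K →L[ℂ] K)) (t : A ⊗[ℂ] B) :
    ‖spatial (ρ : A →ₗ[ℂ] (H →L[ℂ] H)) σ t‖ ≤ ‖spatial (ρ' : A →ₗ[ℂ] (H' →L[ℂ] H')) σ t‖ := by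
  let _ := CStarAlgebra.spectralOrder A
  have _ := CStarAlgebra.spectralOrderedRing A
  refine norm_spatial_le _ _ _ (norm_nonneg (spatial (ρ' : A →ₗ[ℂ] (H' →L[ℂ] H')) σ t)) fun z => ?_
  -- the vectors `z` and `t z` live in `H ⊙ N` for a finite dimensional subspace `N` of `K`
  obtain ⟨n, e, he, hz⟩ := exists_orthonormal_sum_tmul
    {z, tensorAct (ρ : A →ₗ[ℂ] (H →L[ℂ] H)) σ t z} (Set.toFinite _)
  obtain ⟨x, hx⟩ := hz z (by simp)
  obtain ⟨y, hy⟩ := hz (tensorAct (ρ : A →ₗ[ℂ] (H →L[ℂ] H)) σ t z) (by simp)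
  -- the compression of `t` to `N` is a matrix with entries in `A`
  let m := sliceMatrix σ e t
  have h1 : tensorAct (ρ : A →ₗ[ℂ] (H →L[ℂ] H)) σ t z =
      ∑ j, amplify n ρ m (WithLp.toLp 2 x) j ⊗ₜ[ℂ] e j := by
    rw [amplify_sliceMatrix, ← hx]
    nth_rw 1 [hy]
    rw [hy]
    simp only [slice_sum_tmul he]
  have h2 : ‖amplify n ρ' m‖ ≤ ‖spatial (ρ' : A →ₗ[ℂ] (H' →L[ℂ] H')) σ t‖ := by
    refine ContinuousLinearMap.opNorm_le_bound _
      (norm_nonneg (spatial (ρ' : A →ₗ[ℂ] (H' →L[ℂ] H')) σ t)) fun x' => ?_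
    obtain ⟨x', rfl⟩ := WithLp.toLp_surjective 2 x'
    rw [amplify_sliceMatrix, ← norm_sum_tmul he x']
    exact (norm_slice_le he _).trans (norm_tensorAct_le _ _ _ _)
  rw [h1, norm_sum_tmul he, hx, norm_sum_tmul he]
  refine (ContinuousLinearMap.le_opNorm (amplify n ρ m) _).trans ?_
  gcongr
  refine le_trans ?_ h2
  rw [NonUnitalStarAlgHom.norm_map (amplify n ρ') (amplify_injective hρ')]
  exact NonUnitalStarAlgHom.norm_apply_le (amplify n ρ) m

/-- The spatial norm does not depend on the choice of faithful representations. -/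
lemma norm_spatial_eq [CompleteSpace H] [CompleteSpace H'] [CompleteSpace K] [CompleteSpace K']
    {ρ : A →⋆ₙₐ[ℂ] (H →L[ℂ] H)} (hρ : Function.Injective ρ)
    {ρ' : A →⋆ₙₐ[ℂ] (H' →L[ℂ] H')} (hρ' : Function.Injective ρ')
    {σ : B →⋆ₙₐ[ℂ] (K →L[ℂ] K)} (hσ : Function.Injective σ)
    {σ' : B →⋆ₙₐ[ℂ] (K' →L[ℂ] K')} (hσ' : Function.Injective σ') (t : A ⊗[ℂ] B) :
    ‖spatial (ρ : A →ₗ[ℂ] (H →L[ℂ] H)) (σ : B →ₗ[ℂ] (K →L[ℂ] K)) t‖ =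
      ‖spatial (ρ' : A →ₗ[ℂ] (H' →L[ℂ] H')) (σ' : B →ₗ[ℂ] (K' →L[ℂ] K')) t‖ := by
  have h : ‖spatial (ρ : A →ₗ[ℂ] (H →L[ℂ] H)) (σ : B →ₗ[ℂ] (K →L[ℂ] K)) t‖ =
      ‖spatial (ρ' : A →ₗ[ℂ] (H' →L[ℂ] H')) (σ : B →ₗ[ℂ] (K →L[ℂ] K)) t‖ :=
    le_antisymm (norm_spatial_le_of_injective ρ hρ' _ t) (norm_spatial_le_of_injective ρ' hρ _ t)
  rw [h, ← norm_spatial_comm, ← norm_spatial_comm (ρ' : A →ₗ[ℂ] (H' →L[ℂ] H')) _ t]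
  exact le_antisymm (norm_spatial_le_of_injective σ hσ' _ _)
    (norm_spatial_le_of_injective σ' hσ _ _)

/-- The representation of a `C*`-algebra obtained from a representation of a `C*`-category and a
homomorphism to the endomorphism algebra of an object. -/
def Rep.restrict {V : CStarCat.{u₁, v₁}} (π : Rep.{u₁, v₁, w} V.toStarCat) {X : V.Obj}
    (φ : A →ₗ[ℂ] V.Hom X X) (hmul : ∀ a b, φ (a * b) = V.comp (φ a) (φ b))
    (hstar : ∀ a, φ (star a) = V.adj (φ a)) : A →⋆ₙₐ[ℂ] (π.H X →L[ℂ] π.H X) where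
  toFun a := π.map (φ a)
  map_smul' c a := by simp
  map_zero' := by simp
  map_add' a b := by simp
  map_mul' a b := by rw [hmul]; exact π.map_comp _ _
  map_star' a := by rw [hstar]; exact π.map_adj _

lemma Rep.restrict_injective {V : CStarCat.{u₁, v₁}} {π : Rep.{u₁, v₁, w} V.toStarCat} {X : V.Obj}
    (hπ : Function.Injective (π.map (X := X) (Y := X))) {φ : A →ₗ[ℂ] V.Hom X X}
    (hφ : Function.Injective φ) (hmul : ∀ a b, φ (a * b) = V.comp (φ a) (φ b))
    (hstar : ∀ a, φ (star a) = V.adj (φ a)) : Function.Injective (π.restrict φ hmul hstar) :=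
  hπ.comp hφ

lemma minNorm_apply_map {V₁ : CStarCat.{u₁, v₁}} {V₂ : CStarCat.{u₂, v₂}}
    (ι₁ : Realisation.{u₁, v₁, w₁} V₁) (ι₂ : Realisation.{u₂, v₂, w₂} V₂) {X₁ : V₁.Obj}
    {X₂ : V₂.Obj} {φ₁ : A →ₗ[ℂ] V₁.Hom X₁ X₁} {φ₂ : B →ₗ[ℂ] V₂.Hom X₂ X₂}
    (hm₁ : ∀ a b, φ₁ (a * b) = V₁.comp (φ₁ a) (φ₁ b)) (hs₁ : ∀ a, φ₁ (star a) = V₁.adj (φ₁ a))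
    (hm₂ : ∀ a b, φ₂ (a * b) = V₂.comp (φ₂ a) (φ₂ b)) (hs₂ : ∀ a, φ₂ (star a) = V₂.adj (φ₂ a))
    (t : A ⊗[ℂ] B) :
    (minNorm ι₁ ι₂).N (X := (X₁, X₂)) (Y := (X₁, X₂)) (TensorProduct.map φ₁ φ₂ t) =
      ‖spatial (ι₁.toRep.restrict φ₁ hm₁ hs₁ : A →ₗ[ℂ] (ι₁.H X₁ →L[ℂ] ι₁.H X₁))
        (ι₂.toRep.restrict φ₂ hm₂ hs₂ : B →ₗ[ℂ] (ι₂.H X₂ →L[ℂ] ι₂.H X₂)) t‖ := by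
  have h : (TensorProduct.lift (hilbertMap₂.compl₁₂ (ι₁.map (X := X₁) (Y := X₁))
      (ι₂.map (X := X₂) (Y := X₂)))) ∘ₗ TensorProduct.map φ₁ φ₂ =
      spatial (ι₁.toRep.restrict φ₁ hm₁ hs₁ : A →ₗ[ℂ] (ι₁.H X₁ →L[ℂ] ι₁.H X₁))
        (ι₂.toRep.restrict φ₂ hm₂ hs₂ : B →ₗ[ℂ] (ι₂.H X₂ →L[ℂ] ι₂.H X₂)) :=
    TensorProduct.ext' fun a b => rfl
  rw [← h]
  change (⨆ _ : Unit, ‖(TensorProduct.lift (hilbertMap₂.compl₁₂ (ι₁.map (X := X₁) (Y := X₁))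
    (ι₂.map (X := X₂) (Y := X₂))) ∘ₗ TensorProduct.map φ₁ φ₂) t‖) = _
  exact ciSup_const

universe u₃ v₃ u₄ v₄

/-- The minimal norms defined by two pairs of categories agree on `A ⊙ B` if `A` and `B` are
embedded in endomorphism algebras. -/
lemma minNorm_apply_map_eq {V₁ : CStarCat.{u₁, v₁}} {V₂ : CStarCat.{u₂, v₂}}
    {W₁ : CStarCat.{u₃, v₃}} {W₂ : CStarCat.{u₄, v₄}}
    (ι₁ : Realisation.{u₁, v₁, w₁} V₁) (ι₂ : Realisation.{u₂, v₂, w₂} V₂)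
    (κ₁ : Realisation.{u₃, v₃, w₃} W₁) (κ₂ : Realisation.{u₄, v₄, w₄} W₂) {X₁ : V₁.Obj}
    {X₂ : V₂.Obj} {Y₁ : W₁.Obj} {Y₂ : W₂.Obj}
    {φ₁ : A →ₗ[ℂ] V₁.Hom X₁ X₁} {φ₂ : B →ₗ[ℂ] V₂.Hom X₂ X₂}
    {ψ₁ : A →ₗ[ℂ] W₁.Hom Y₁ Y₁} {ψ₂ : B →ₗ[ℂ] W₂.Hom Y₂ Y₂}
    (hφ₁ : Function.Injective φ₁) (hφ₂ : Function.Injective φ₂)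
    (hψ₁ : Function.Injective ψ₁) (hψ₂ : Function.Injective ψ₂)
    (hm₁ : ∀ a b, φ₁ (a * b) = V₁.comp (φ₁ a) (φ₁ b)) (hs₁ : ∀ a, φ₁ (star a) = V₁.adj (φ₁ a))
    (hm₂ : ∀ a b, φ₂ (a * b) = V₂.comp (φ₂ a) (φ₂ b)) (hs₂ : ∀ a, φ₂ (star a) = V₂.adj (φ₂ a))
    (hn₁ : ∀ a b, ψ₁ (a * b) = W₁.comp (ψ₁ a) (ψ₁ b)) (ht₁ : ∀ a, ψ₁ (star a) = W₁.adj (ψ₁ a))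
    (hn₂ : ∀ a b, ψ₂ (a * b) = W₂.comp (ψ₂ a) (ψ₂ b)) (ht₂ : ∀ a, ψ₂ (star a) = W₂.adj (ψ₂ a))
    (t : A ⊗[ℂ] B) :
    (minNorm ι₁ ι₂).N (X := (X₁, X₂)) (Y := (X₁, X₂)) (TensorProduct.map φ₁ φ₂ t) =
      (minNorm κ₁ κ₂).N (X := (Y₁, Y₂)) (Y := (Y₁, Y₂)) (TensorProduct.map ψ₁ ψ₂ t) := by
  rw [minNorm_apply_map ι₁ ι₂ hm₁ hs₁ hm₂ hs₂, minNorm_apply_map κ₁ κ₂ hn₁ ht₁ hn₂ ht₂]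
  exact norm_spatial_eq (Rep.restrict_injective (ι₁.faithful _ _) hφ₁ _ _)
    (Rep.restrict_injective (κ₁.faithful _ _) hψ₁ _ _)
    (Rep.restrict_injective (ι₂.faithful _ _) hφ₂ _ _)
    (Rep.restrict_injective (κ₂.faithful _ _) hψ₂ _ _) t

/-- The minimal norm on `Hilb_A ⊙ Hilb_B` extends the one on `A ⊙ B`. -/
lemma minNorm_extends (ι₁ : Realisation.{u + 1, u, w₁} (Hilb A))
    (ι₂ : Realisation.{v + 1, v, w₂} (Hilb B)) (ρ : Realisation.{0, u, w₃} (ofAlgebra A))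
    (σ : Realisation.{0, v, w₄} (ofAlgebra B)) : (minNorm ι₁ ι₂).Extends (minNorm ρ σ) := by
  intro t
  have h := minNorm_apply_map_eq ι₁ ι₂ ρ σ (φ₁ := (lmul A).toLinearMap)
    (φ₂ := (lmul B).toLinearMap) (Y₁ := ()) (Y₂ := ()) (ψ₁ := (LinearMap.id : A →ₗ[ℂ] A))
    (ψ₂ := (LinearMap.id : B →ₗ[ℂ] B)) (lmul A).injective (lmul B).injective
    Function.injective_id Function.injective_id lmul_mul lmul_star lmul_mul lmul_star
    (fun _ _ => rfl) (fun _ => rfl) (fun _ _ => rfl) (fun _ => rfl) t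
  exact h.trans (congrArg (TensorAlgebra.algNorm (minNorm ρ σ))
    (LinearMap.congr_fun (TensorProduct.map_id (R := ℂ) (M := A) (N := B)) t))

end spatial

/-! ### Induction of representations of the maximal tensor product -/

/-- The power trick: an estimate for iterated squares improves itself to one without constant. -/
lemma le_mul_of_sq_le {a : ℕ → ℝ} {c K C : ℝ} (ha : ∀ n, 0 ≤ a n) (hc : 0 ≤ c)
    (hK : 0 ≤ K) (h1 : ∀ n, a n * a n ≤ c * a (n + 1)) (h2 : ∀ n, a n ≤ C * K ^ 2 ^ n) :
    a 0 ≤ c * K := by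
  rcases hc.eq_or_lt with rfl | hc
  · have := h1 0
    rw [zero_mul] at this
    rw [zero_mul]
    exact (mul_self_eq_zero.mp (le_antisymm this (mul_self_nonneg _))).le
  have h3 : ∀ n, c * a 0 ^ 2 ^ n ≤ c ^ 2 ^ n * a n := by
    intro n
    induction n with
    | zero => simp
    | succ n ih =>
      have h4 : (c * a 0 ^ 2 ^ n) * (c * a 0 ^ 2 ^ n) ≤
          (c ^ 2 ^ n * a n) * (c ^ 2 ^ n * a n) := by
        exact mul_self_le_mul_self (mul_nonneg hc.le (pow_nonneg (ha 0) _)) ih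
      have h5 : c ^ 2 ^ n * c ^ 2 ^ n * (a n * a n) ≤ c ^ 2 ^ n * c ^ 2 ^ n * (c * a (n + 1)) :=
        mul_le_mul_of_nonneg_left (h1 n) (by positivity)
      refine le_of_mul_le_mul_left ?_ hc
      calc c * (c * a 0 ^ 2 ^ (n + 1)) = (c * a 0 ^ 2 ^ n) * (c * a 0 ^ 2 ^ n) := by ring
        _ ≤ c ^ 2 ^ n * c ^ 2 ^ n * (a n * a n) := by linarith
        _ ≤ c ^ 2 ^ n * c ^ 2 ^ n * (c * a (n + 1)) := h5
        _ = c * (c ^ 2 ^ (n + 1) * a (n + 1)) := by ring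
  by_contra hlt
  push Not at hlt
  have h6 : ∀ n, c * a 0 ^ 2 ^ n ≤ C * (c * K) ^ 2 ^ n := fun n => by
    calc c * a 0 ^ 2 ^ n ≤ c ^ 2 ^ n * a n := h3 n
      _ ≤ c ^ 2 ^ n * (C * K ^ 2 ^ n) := by gcongr; exact h2 n
      _ = C * (c * K) ^ 2 ^ n := by rw [mul_pow]; ring
  have ha0 : 0 < a 0 := (mul_nonneg hc.le hK).trans_lt hlt
  rcases hK.eq_or_lt with rfl | hK
  · have := h6 0
    simp only [pow_zero, pow_one, mul_zero] at this
    nlinarith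
  have hr : 1 < a 0 / (c * K) := (one_lt_div (by positivity)).mpr hlt
  obtain ⟨n, hn⟩ := pow_unbounded_of_one_lt (C / c) hr
  have h7 : (a 0 / (c * K)) ^ n ≤ (a 0 / (c * K)) ^ 2 ^ n :=
    pow_le_pow_right₀ hr.le Nat.lt_two_pow_self.le
  have h8 : (a 0 / (c * K)) ^ 2 ^ n ≤ C / c := by
    rw [div_pow, div_le_div_iff₀ (by positivity) hc, mul_comm]
    exact h6 n
  linarith

namespace CStarCat

variable (V : CStarCat.{u, v}) {X : V.Obj}

/-- The iterated squares `s, s², s⁴, …` of an endomorphism. -/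
def iterSq (s : V.Hom X X) : ℕ → V.Hom X X
  | 0 => s
  | n + 1 => V.comp (iterSq s n) (iterSq s n)

lemma adj_iterSq {s : V.Hom X X} (hs : V.adj s = s) (n : ℕ) :
    V.adj (V.iterSq s n) = V.iterSq s n := by
  induction n with
  | zero => exact hs
  | succ n ih => exact (V.adj_comp _ _).trans (by rw [ih]; rfl)

lemma norm_iterSq_le (s : V.Hom X X) (n : ℕ) : ‖V.iterSq s n‖ ≤ ‖s‖ ^ 2 ^ n := by
  induction n with
  | zero => simp [iterSq]
  | succ n ih =>
    refine (V.norm_comp_le _ _).trans ((mul_le_mul ih ih (norm_nonneg _) (by positivity)).trans_eq ?_)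
    ring

end CStarCat

/-- A representation of `A ⊙ B` on a Hilbert space. -/
structure TensorRep (A : Type u) (B : Type v) (H : Type w) [NonUnitalCStarAlgebra A]
    [NonUnitalCStarAlgebra B] [NormedAddCommGroup H] [InnerProductSpace ℂ H] [CompleteSpace H] where
  map : A →ₗ[ℂ] B →ₗ[ℂ] (H →L[ℂ] H)
  map_mul : ∀ a a' b b', map (a * a') (b * b') = (map a b).comp (map a' b')
  map_star : ∀ a b, map (star a) (star b) = (map a b).adjoint

namespace TensorRep

variable {A : Type u} {B : Type v} {H : Type w} [NonUnitalCStarAlgebra A]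
  [NonUnitalCStarAlgebra B] [NormedAddCommGroup H] [InnerProductSpace ℂ H] [CompleteSpace H]
  (P : TensorRep A B H)

lemma inner_map_map (a a' : A) (b b' : B) (h h' : H) :
    inner ℂ (P.map a b h) (P.map a' b' h') =
      inner ℂ h (P.map (star a * a') (star b * b') h') := by
  rw [P.map_mul, P.map_star, ContinuousLinearMap.comp_apply,
    ContinuousLinearMap.adjoint_inner_right]

lemma norm_map_le (a : A) (b : B) : ‖P.map a b‖ ≤ ‖a‖ * ‖b‖ := by
  have h := norm_bimap_le_mul P.map P.map_mul P.map_star (IsSelfAdjoint.star_mul_self a).star_eq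
    (IsSelfAdjoint.star_mul_self b).star_eq
  rw [P.map_mul, P.map_star, ContinuousLinearMap.norm_adjoint_comp_self,
    CStarRing.norm_star_mul_self, CStarRing.norm_star_mul_self, mul_mul_mul_comm] at h
  exact (mul_self_le_mul_self_iff (norm_nonneg _) (by positivity)).mpr h

/-- The representation as a bounded bilinear map. -/
def mapL : A →L[ℂ] B →L[ℂ] (H →L[ℂ] H) :=
  LinearMap.mkContinuous₂ P.map 1 fun a b => by rw [one_mul]; exact P.norm_map_le a b

lemma sum_square (x : ℕ → A) (y : ℕ → B) (s t : Finset ℕ) :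
    ∑ i ∈ s ×ˢ t, P.map (x i.1) (y i.2) = P.map (∑ m ∈ s, x m) (∑ n ∈ t, y n) := by
  rw [Finset.sum_product, map_sum P.map, LinearMap.sum_apply]
  exact Finset.sum_congr rfl fun m _ => (map_sum (P.map (x m)) _ _).symm

lemma memℓp_map (a : StdModule.Carrier A) (b : StdModule.Carrier B) (h : H) :
    Memℓp (fun i : ℕ × ℕ => P.map (a.1 i.1) (b.1 i.2) h) 2 := by
  refine memℓp_gen ?_
  simp only [ENNReal.toReal_ofNat, Real.rpow_two]
  refine summable_of_sum_le (c := ‖h‖ * ((‖a‖ * ‖a‖) * (‖b‖ * ‖b‖) * ‖h‖)) (fun _ => sq_nonneg _)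
    fun u => ?_
  refine (Finset.sum_le_sum_of_subset_of_nonneg Finset.subset_product
    fun _ _ _ => sq_nonneg _).trans ?_
  have h1 : ∀ i : ℕ × ℕ, ‖P.map (a.1 i.1) (b.1 i.2) h‖ ^ 2 = RCLike.re (inner ℂ h
      (P.map (star (a.1 i.1) * a.1 i.1) (star (b.1 i.2) * b.1 i.2) h)) := fun i => by
    rw [← P.inner_map_map, ← norm_sq_eq_re_inner]
  rw [Finset.sum_congr rfl fun i _ => h1 i, ← map_sum, ← inner_sum, ← _root_.sum_apply,
    P.sum_square (fun m => star (a.1 m) * a.1 m) (fun n => star (b.1 n) * b.1 n)]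
  refine (re_inner_le_norm _ _).trans ?_
  gcongr
  refine (ContinuousLinearMap.le_opNorm _ _).trans ?_
  gcongr
  refine (P.norm_map_le _ _).trans ?_
  gcongr
  exacts [StdModule.norm_sum_le a _, StdModule.norm_sum_le b _]

/-- The vector `(π(a_m ⊗ b_n) h)_{m,n}` of `ℓ²(ℕ × ℕ, H)`. -/
def std : StdModule.Carrier A →ₗ[ℂ] StdModule.Carrier B →ₗ[ℂ] H →ₗ[ℂ]
    lp (fun _ : ℕ × ℕ => H) 2 :=
  LinearMap.mk₂ ℂ
    (fun a b =>
      { toFun := fun h => ⟨fun i => P.map (a.1 i.1) (b.1 i.2) h, P.memℓp_map a b h⟩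
        map_add' := fun h h' => Subtype.ext (funext fun _ => (P.map _ _).map_add h h')
        map_smul' := fun c h => Subtype.ext (funext fun _ => (P.map _ _).map_smul c h) })
    (fun a a' b => LinearMap.ext fun h => Subtype.ext <| funext fun i =>
      congrArg (fun T => T h) (P.map.map_add₂ (a.1 i.1) (a'.1 i.1) (b.1 i.2)))
    (fun c a b => LinearMap.ext fun h => Subtype.ext <| funext fun i =>
      congrArg (fun T => T h) (P.map.map_smul₂ c (a.1 i.1) (b.1 i.2)))
    (fun a b b' => LinearMap.ext fun h => Subtype.ext <| funext fun i =>
      congrArg (fun T => T h) ((P.map (a.1 i.1)).map_add (b.1 i.2) (b'.1 i.2)))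
    (fun c a b => LinearMap.ext fun h => Subtype.ext <| funext fun i =>
      congrArg (fun T => T h) ((P.map (a.1 i.1)).map_smul c (b.1 i.2)))

lemma inner_std (a a' : StdModule.Carrier A) (b b' : StdModule.Carrier B) (h h' : H) :
    inner ℂ (P.std a b h) (P.std a' b' h') =
      inner ℂ h (P.map ((stdModule A).inner a a') ((stdModule B).inner b b') h') := by
  have h1 : HasSum (fun i : ℕ × ℕ => inner ℂ (P.map (a.1 i.1) (b.1 i.2) h)
      (P.map (a'.1 i.1) (b'.1 i.2) h')) (inner ℂ (P.std a b h) (P.std a' b' h')) :=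
    lp.hasSum_inner _ _
  have h2 := tendsto_bilin P.mapL (StdModule.summable_inner a a').hasSum
    (StdModule.summable_inner b b').hasSum
  have h3 : Filter.Tendsto (fun s : Finset ℕ => inner ℂ h (P.map
      (∑ m ∈ s, star (a.1 m) * a'.1 m) (∑ n ∈ s, star (b.1 n) * b'.1 n) h')) Filter.atTop
      (nhds (inner ℂ h (P.map ((stdModule A).inner a a') ((stdModule B).inner b b') h'))) :=
    ((continuous_const.inner (ContinuousLinearMap.apply ℂ H h').continuous).tendsto _).comp h2
  refine tendsto_nhds_unique (h1.comp tendsto_product_atTop) (h3.congr fun s => ?_)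
  rw [← P.sum_square, _root_.sum_apply, inner_sum]
  exact Finset.sum_congr rfl fun i _ => (P.inner_map_map _ _ _ _ _ _).symm

/-- A chosen isometric embedding of an object of `Hilb_A` in the standard module. -/
def _root_.CStarTensor.Hilb.embed (E : (Hilb A).Obj) : Hilb.mod E →ₗ[ℂ] StdModule.Carrier A :=
  (show (Hilb.mod E).IsSummandOfStd from
    (show {E : HilbertModule.{u, u} A // E.IsSummandOfStd} from E).2).choose.toLinearMap

lemma _root_.CStarTensor.Hilb.inner_embed (E : (Hilb A).Obj) (x y : Hilb.mod E) :
    (stdModule A).inner (Hilb.embed E x) (Hilb.embed E y) = (Hilb.mod E).inner x y := by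
  obtain ⟨S, hS, h1⟩ := (show (Hilb.mod E).IsSummandOfStd from
    (show {E : HilbertModule.{u, u} A // E.IsSummandOfStd} from E).2).choose_spec
  refine (hS x _).trans ?_
  exact congrArg ((Hilb.mod E).inner x) (congrArg (fun T => T y) h1)

/-- The operator underlying a morphism of `Hilb_A`, as a linear function of the morphism. -/
def _root_.CStarTensor.Hilb.opₗ (E E' : (Hilb A).Obj) :
    (Hilb A).Hom E E' →ₗ[ℂ] (Hilb.mod E →ₗ[ℂ] Hilb.mod E') where
  toFun T := (Hilb.op T).toLinearMap
  map_add' _ _ := rfl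
  map_smul' _ _ := rfl

variable (E E' E'' : (Hilb A).Obj) (F F' F'' : (Hilb B).Obj)

/-- The map `(ξ ⊗ η) ⊗ h ↦ (π(ξ_m ⊗ η_n) h)_{m,n}`, where `ξ` and `η` are regarded as elements of
the standard modules. -/
def toLp : (Hilb.mod E ⊗[ℂ] Hilb.mod F) ⊗[ℂ] H →ₗ[ℂ] lp (fun _ : ℕ × ℕ => H) 2 :=
  TensorProduct.lift (TensorProduct.lift (P.std.compl₁₂ (Hilb.embed E) (Hilb.embed F)))

/-- The Hilbert space `(E ⊗ F) ⊗_π H`, realised as a closed subspace of `ℓ²(ℕ × ℕ, H)`. -/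
def space : Submodule ℂ (lp (fun _ : ℕ × ℕ => H) 2) :=
  (LinearMap.range (P.toLp E F)).topologicalClosure

instance : CompleteSpace (P.space E F) :=
  (Submodule.isClosed_topologicalClosure _).completeSpace_coe

/-- The inner product of `ℓ²(ℕ × ℕ, H)`. The shortcut instance takes precedence over inner products
of `C*`-module type. -/
instance : Inner ℂ (P.space E F) := (Submodule.innerProductSpace (P.space E F)).toInner

/-- The canonical map `E ⊙ F ⊙ H → (E ⊗ F) ⊗_π H`. -/
def toSpace : (Hilb.mod E ⊗[ℂ] Hilb.mod F) ⊗[ℂ] H →ₗ[ℂ] P.space E F :=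
  (P.toLp E F).codRestrict _ fun x => Submodule.le_topologicalClosure _ ⟨x, rfl⟩

lemma denseRange_toSpace : DenseRange (P.toSpace E F) := by
  rintro ⟨y, hy⟩
  rw [closure_subtype]
  refine closure_mono ?_ (show y ∈ closure (Set.range (P.toLp E F)) from hy)
  rintro _ ⟨x, rfl⟩
  exact ⟨_, ⟨x, rfl⟩, rfl⟩

variable {E E' E'' F F' F''}

lemma inner_toSpace (x x' : Hilb.mod E) (y y' : Hilb.mod F) (h h' : H) :
    inner ℂ (P.toSpace E F ((x ⊗ₜ[ℂ] y) ⊗ₜ[ℂ] h)) (P.toSpace E F ((x' ⊗ₜ[ℂ] y') ⊗ₜ[ℂ] h')) =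
      inner ℂ h (P.map ((Hilb.mod E).inner x x') ((Hilb.mod F).inner y y') h') := by
  rw [← Hilb.inner_embed, ← Hilb.inner_embed]
  exact P.inner_std _ _ _ _ _ _

lemma norm_toSpace_le (x : Hilb.mod E) (y : Hilb.mod F) (h : H) :
    ‖P.toSpace E F ((x ⊗ₜ[ℂ] y) ⊗ₜ[ℂ] h)‖ ≤ ‖x‖ * ‖y‖ * ‖h‖ := by
  refine (mul_self_le_mul_self_iff (norm_nonneg _) (by positivity)).mpr ?_
  rw [← sq, @norm_sq_eq_re_inner ℂ, P.inner_toSpace]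
  calc RCLike.re (inner ℂ h (P.map ((Hilb.mod E).inner x x) ((Hilb.mod F).inner y y) h))
      ≤ ‖h‖ * ‖P.map ((Hilb.mod E).inner x x) ((Hilb.mod F).inner y y) h‖ := re_inner_le_norm _ _
    _ ≤ ‖h‖ * (((‖x‖ * ‖x‖) * (‖y‖ * ‖y‖)) * ‖h‖) := by
        gcongr
        refine (ContinuousLinearMap.le_opNorm _ _).trans ?_
        gcongr
        refine (P.norm_map_le _ _).trans ?_
        gcongr
        exacts [(Hilb.mod E).norm_inner_le x x, (Hilb.mod F).norm_inner_le y y]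
    _ = _ := by ring

variable (H) in
/-- The operators `S ⊗ T ⊗ 1` on `E ⊙ F ⊙ H`. -/
def act : (Hilb A).Hom E E' ⊗[ℂ] (Hilb B).Hom F F' →ₗ[ℂ]
    ((Hilb.mod E ⊗[ℂ] Hilb.mod F) ⊗[ℂ] H →ₗ[ℂ] (Hilb.mod E' ⊗[ℂ] Hilb.mod F') ⊗[ℂ] H) :=
  LinearMap.rTensorHom H ∘ₗ TensorProduct.homTensorHomMap (.id ℂ) _ _ _ _ ∘ₗ
    TensorProduct.map (Hilb.opₗ E E') (Hilb.opₗ F F')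

omit [CompleteSpace H] in
lemma act_tmul (S : (Hilb A).Hom E E') (T : (Hilb B).Hom F F') (x : Hilb.mod E) (y : Hilb.mod F)
    (h : H) : act H (S ⊗ₜ[ℂ] T) ((x ⊗ₜ[ℂ] y) ⊗ₜ[ℂ] h) =
      (Hilb.op S x ⊗ₜ[ℂ] Hilb.op T y) ⊗ₜ[ℂ] h := by
  simp only [act, LinearMap.comp_apply, TensorProduct.map_tmul, LinearMap.coe_rTensorHom,
    LinearMap.rTensor_tmul, TensorProduct.homTensorHomMap_apply]
  rfl

omit [CompleteSpace H] in
lemma act_act (g : (Hilb A).Hom E' E'' ⊗[ℂ] (Hilb B).Hom F' F'')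
    (f : (Hilb A).Hom E E' ⊗[ℂ] (Hilb B).Hom F F') (z : (Hilb.mod E ⊗[ℂ] Hilb.mod F) ⊗[ℂ] H) :
    act H g (act H f z) = act H (TensorProduct.map₂ (Hilb A).comp (Hilb B).comp g f) z := by
  have h : act H (TensorProduct.map₂ (Hilb A).comp (Hilb B).comp g f) = act H g ∘ₗ act H f := ?_
  · exact (LinearMap.congr_fun h z).symm
  clear z
  induction g with
  | zero => simp
  | add g g' e e' => simp only [map_add, LinearMap.add_apply, e, e', LinearMap.add_comp]
  | tmul S T =>
    induction f with
    | zero => simp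
    | add f f' e e' => simp only [map_add, e, e', LinearMap.comp_add]
    | tmul S' T' =>
      ext x y h
      change act H (_ ⊗ₜ[ℂ] _) ((x ⊗ₜ[ℂ] y) ⊗ₜ[ℂ] h) =
        act H (S ⊗ₜ[ℂ] T) (act H (S' ⊗ₜ[ℂ] T') ((x ⊗ₜ[ℂ] y) ⊗ₜ[ℂ] h))
      rw [act_tmul, act_tmul, act_tmul, Hilb.op_comp, Hilb.op_comp]
      rfl

lemma inner_act (f : (Hilb A).Hom E E' ⊗[ℂ] (Hilb B).Hom F F')
    (z : (Hilb.mod E ⊗[ℂ] Hilb.mod F) ⊗[ℂ] H) (z' : (Hilb.mod E' ⊗[ℂ] Hilb.mod F') ⊗[ℂ] H) :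
    inner ℂ (P.toSpace E F z) (P.toSpace E F
      (act H (TensorProduct.map (Hilb A).adj (Hilb B).adj f) z')) =
      inner ℂ (P.toSpace E' F' (act H f z)) (P.toSpace E' F' z') := by
  induction f with
  | zero => simp
  | add f f' e e' =>
    simp only [map_add, LinearMap.add_apply, inner_add_left, inner_add_right, e, e']
  | tmul S T =>
    induction z with
    | zero => simp
    | add z z₁ e e' => simp only [map_add, inner_add_left, e, e']
    | tmul z h =>
      induction z with
      | zero => simp
      | add z z₁ e e' => simp only [map_add, TensorProduct.add_tmul, inner_add_left, e, e']
      | tmul x y =>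
        induction z' with
        | zero => simp
        | add z z₁ e e' => simp only [map_add, inner_add_right, e, e']
        | tmul z h' =>
          induction z with
          | zero => simp
          | add z z₁ e e' => simp only [map_add, TensorProduct.add_tmul, inner_add_right, e, e']
          | tmul x' y' =>
            rw [TensorProduct.map_tmul, act_tmul, act_tmul, inner_toSpace, inner_toSpace]
            congr 2
            exact congrArg₂ (fun a b => P.map a b) (Hilb.isAdjoint_op S x x').symm
              (Hilb.isAdjoint_op T y y').symm

/-- A crude bound, which is not uniform in the vector. -/
lemma exists_norm_act_le (z : (Hilb.mod E ⊗[ℂ] Hilb.mod F) ⊗[ℂ] H) :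
    ∃ C : ℝ, 0 ≤ C ∧ ∀ (S : (Hilb A).Hom E E) (T : (Hilb B).Hom F F),
      ‖P.toSpace E F (act H (S ⊗ₜ[ℂ] T) z)‖ ≤ C * (‖S‖ * ‖T‖) := by
  have hadd : ∀ z z' : (Hilb.mod E ⊗[ℂ] Hilb.mod F) ⊗[ℂ] H,
      (∃ C : ℝ, 0 ≤ C ∧ ∀ (S : (Hilb A).Hom E E) (T : (Hilb B).Hom F F),
        ‖P.toSpace E F (act H (S ⊗ₜ[ℂ] T) z)‖ ≤ C * (‖S‖ * ‖T‖)) →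
      (∃ C : ℝ, 0 ≤ C ∧ ∀ (S : (Hilb A).Hom E E) (T : (Hilb B).Hom F F),
        ‖P.toSpace E F (act H (S ⊗ₜ[ℂ] T) z')‖ ≤ C * (‖S‖ * ‖T‖)) →
      ∃ C : ℝ, 0 ≤ C ∧ ∀ (S : (Hilb A).Hom E E) (T : (Hilb B).Hom F F),
        ‖P.toSpace E F (act H (S ⊗ₜ[ℂ] T) (z + z'))‖ ≤ C * (‖S‖ * ‖T‖) := by
    rintro z z' ⟨C, hC, h⟩ ⟨C', hC', h'⟩
    refine ⟨C + C', add_nonneg hC hC', fun S T => ?_⟩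
    rw [map_add, map_add, add_mul]
    exact (norm_add_le _ _).trans (add_le_add (h S T) (h' S T))
  induction z with
  | zero => exact ⟨0, le_rfl, fun S T => by simp⟩
  | add z z' h h' => exact hadd z z' h h'
  | tmul z h =>
    induction z with
    | zero => exact ⟨0, le_rfl, fun S T => by simp⟩
    | add z z' h h' =>
      rw [TensorProduct.add_tmul]
      exact hadd _ _ h h'
    | tmul x y =>
      refine ⟨‖x‖ * ‖y‖ * ‖h‖, by positivity, fun S T => ?_⟩
      rw [act_tmul]
      refine (P.norm_toSpace_le _ _ _).trans ?_
      calc ‖Hilb.op S x‖ * ‖Hilb.op T y‖ * ‖h‖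
          ≤ (‖S‖ * ‖x‖) * (‖T‖ * ‖y‖) * ‖h‖ := by
            gcongr
            exacts [(Hilb.op S).le_opNorm x, (Hilb.op T).le_opNorm y]
        _ = _ := by ring

/-- The bound of the formally positive operator `S* S ⊗ T* T ⊗ 1` follows from
`le_mul_of_sq_le`, and it gives the bound of `S ⊗ T ⊗ 1`. -/
lemma norm_act_tmul_le (S : (Hilb A).Hom E E') (T : (Hilb B).Hom F F')
    (z : (Hilb.mod E ⊗[ℂ] Hilb.mod F) ⊗[ℂ] H) :
    ‖P.toSpace E' F' (act H (S ⊗ₜ[ℂ] T) z)‖ ≤ ‖S‖ * ‖T‖ * ‖P.toSpace E F z‖ := by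
  let s := (Hilb A).iterSq ((Hilb A).comp ((Hilb A).adj S) S)
  let t := (Hilb B).iterSq ((Hilb B).comp ((Hilb B).adj T) T)
  have hs : ∀ n, (Hilb A).adj (s n) = s n :=
    (Hilb A).adj_iterSq (((Hilb A).adj_comp _ _).trans (by rw [(Hilb A).adj_adj]))
  have ht : ∀ n, (Hilb B).adj (t n) = t n :=
    (Hilb B).adj_iterSq (((Hilb B).adj_comp _ _).trans (by rw [(Hilb B).adj_adj]))
  obtain ⟨C, hC, hCz⟩ := P.exists_norm_act_le z
  have h0 := le_mul_of_sq_le (a := fun n => ‖P.toSpace E F (act H (s n ⊗ₜ[ℂ] t n) z)‖)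
    (c := ‖P.toSpace E F z‖) (K := (‖S‖ * ‖S‖) * (‖T‖ * ‖T‖)) (C := C) (fun n => norm_nonneg _)
    (norm_nonneg _) (by positivity)
    (fun n => by
      have h1 := P.inner_act (s n ⊗ₜ[ℂ] t n) z (act H (s n ⊗ₜ[ℂ] t n) z)
      rw [TensorProduct.map_tmul, hs, ht, act_act] at h1
      have h2 := (congrArg RCLike.re h1).trans (inner_self_eq_norm_mul_norm (𝕜 := ℂ) _)
      refine h2.symm.trans_le ?_
      exact re_inner_le_norm _ _)
    (fun n => by
      refine (hCz _ _).trans ?_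
      rw [mul_pow, ← (Hilb A).norm_adj_comp_self, ← (Hilb B).norm_adj_comp_self]
      gcongr
      exacts [(Hilb A).norm_iterSq_le _ n, (Hilb B).norm_iterSq_le _ n])
  have h1 := P.inner_act (S ⊗ₜ[ℂ] T) z (act H (S ⊗ₜ[ℂ] T) z)
  rw [TensorProduct.map_tmul, act_act] at h1
  refine (mul_self_le_mul_self_iff (norm_nonneg _) (by positivity)).mpr ?_
  have h2 := (congrArg RCLike.re h1).trans (inner_self_eq_norm_mul_norm (𝕜 := ℂ) _)
  refine h2.symm.trans_le ((re_inner_le_norm _ _).trans ?_)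
  calc _ ≤ ‖P.toSpace E F z‖ * (‖P.toSpace E F z‖ * ((‖S‖ * ‖S‖) * (‖T‖ * ‖T‖))) := by
        gcongr
        exact h0
    _ = _ := by ring

end TensorRep

namespace TensorRep

variable {A : Type u} {B : Type v} {H : Type w} [NonUnitalCStarAlgebra A]
  [NonUnitalCStarAlgebra B] [NormedAddCommGroup H] [InnerProductSpace ℂ H] [CompleteSpace H]
  (P : TensorRep A B H) {E E' E'' : (Hilb A).Obj} {F F' F'' : (Hilb B).Obj}

lemma exists_norm_act_le_mul (f : (Hilb A).Hom E E' ⊗[ℂ] (Hilb B).Hom F F') :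
    ∃ K : ℝ, ∀ z, ‖(P.toSpace E' F' ∘ₗ act H f) z‖ ≤ K * ‖P.toSpace E F z‖ := by
  induction f with
  | zero => exact ⟨0, fun z => by simp⟩
  | add f f' h h' =>
    obtain ⟨K, h⟩ := h
    obtain ⟨K', h'⟩ := h'
    refine ⟨K + K', fun z => ?_⟩
    rw [map_add, LinearMap.comp_add, LinearMap.add_apply, add_mul]
    exact (norm_add_le _ _).trans (add_le_add (h z) (h' z))
  | tmul S T => exact ⟨‖S‖ * ‖T‖, fun z => P.norm_act_tmul_le S T z⟩

/-- The extension of `S ⊗ T ⊗ 1` to the Hilbert spaces `(E ⊗ F) ⊗_π H`. -/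
def ext (f : (Hilb A).Hom E E' ⊗[ℂ] (Hilb B).Hom F F') : P.space E F →L[ℂ] P.space E' F' :=
  (P.toSpace E' F' ∘ₗ act H f).extendOfNorm (P.toSpace E F)

lemma ext_toSpace (f : (Hilb A).Hom E E' ⊗[ℂ] (Hilb B).Hom F F')
    (z : (Hilb.mod E ⊗[ℂ] Hilb.mod F) ⊗[ℂ] H) :
    P.ext f (P.toSpace E F z) = P.toSpace E' F' (act H f z) :=
  LinearMap.extendOfNorm_eq (P.denseRange_toSpace E F) (P.exists_norm_act_le_mul f) z

lemma clm_ext {S T : P.space E F →L[ℂ] P.space E' F'}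
    (h : ∀ z, S (P.toSpace E F z) = T (P.toSpace E F z)) : S = T :=
  ContinuousLinearMap.ext fun y => (P.denseRange_toSpace E F).induction_on y
    (isClosed_eq S.continuous T.continuous) h

/-- The representation of `Hilb_A ⊙ Hilb_B` induced by a representation of `A ⊙ B`. -/
def induce : Rep.{max (u + 1) (v + 1), max u v, w} (boxdot (Hilb A) (Hilb B)) where
  H X := P.space X.1 X.2
  map {X Y} :=
    { toFun := fun f => P.ext f
      map_add' := fun f g => P.clm_ext fun z => by
        rw [_root_.add_apply, ext_toSpace, ext_toSpace, ext_toSpace, map_add, LinearMap.add_apply,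
          map_add]
      map_smul' := fun c f => P.clm_ext fun z => by
        rw [_root_.smul_apply, ext_toSpace, ext_toSpace, map_smul, LinearMap.smul_apply,
          map_smul]
        rfl }
  map_comp g f := P.clm_ext fun z => by
    change P.ext _ _ = P.ext _ (P.ext _ _)
    rw [ext_toSpace, ext_toSpace, ext_toSpace, act_act]
  map_adj {X Y} f := by
    refine (ContinuousLinearMap.eq_adjoint_iff _ _).mpr fun x y => ?_
    change inner ℂ (P.ext _ x) y = inner ℂ x (P.ext _ y)
    refine (P.denseRange_toSpace _ _).induction_on x (isClosed_eq (by fun_prop) (by fun_prop))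
      fun z => ?_
    refine (P.denseRange_toSpace _ _).induction_on y (isClosed_eq (by fun_prop) (by fun_prop))
      fun z' => ?_
    rw [ext_toSpace, ext_toSpace]
    have h := P.inner_act ((boxdot (Hilb A) (Hilb B)).adj f) z z'
    rw [← h]
    exact congrArg (fun g => inner ℂ (P.toSpace Y.1 Y.2 z) (P.toSpace Y.1 Y.2 (act H g z')))
      ((boxdot (Hilb A) (Hilb B)).adj_adj f)

/-- Approximate units of the compact operators converge strongly to the identity. -/
lemma _root_.CStarTensor.Hilb.mem_closure_op (E : (Hilb A).Obj) (x : Hilb.mod E) :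
    x ∈ closure {y : Hilb.mod E | ∃ S : (Hilb A).Hom E E, y = Hilb.op S x} := by
  refine Metric.mem_closure_iff.mpr fun ε hε => ?_
  obtain ⟨S, hS⟩ := (Hilb A).exists_norm_sub_comp_lt' (ket E x) hε
  refine ⟨_, ⟨S, rfl⟩, ?_⟩
  rwa [comp_ket, ← map_sub, norm_ket, ← dist_eq_norm] at hS

lemma induce_nondegenerate : P.induce.Nondegenerate := by
  rintro ⟨E, F⟩
  change (Submodule.span ℂ {ξ : P.space E F | ∃ (e : (Hilb A).Hom E E ⊗[ℂ] (Hilb B).Hom F F)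
    (η : P.space E F), ξ = P.ext e η}).topologicalClosure = ⊤
  set S := (Submodule.span ℂ {ξ : P.space E F | ∃ (e : (Hilb A).Hom E E ⊗[ℂ] (Hilb B).Hom F F)
    (η : P.space E F), ξ = P.ext e η}).topologicalClosure
  have hS : IsClosed (S : Set (P.space E F)) := Submodule.isClosed_topologicalClosure _
  refine eq_top_iff.mpr fun y _ => ?_
  refine (P.denseRange_toSpace E F).induction_on (p := fun y => y ∈ S) y hS fun z => ?_
  induction z with
  | zero => rw [map_zero]; exact S.zero_mem
  | add z z' h h' => rw [map_add]; exact S.add_mem h h'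
  | tmul z h =>
    induction z with
    | zero => rw [TensorProduct.zero_tmul, map_zero]; exact S.zero_mem
    | add z z' h h' => rw [TensorProduct.add_tmul, map_add]; exact S.add_mem h h'
    | tmul ξ η =>
      let β : Hilb.mod E →L[ℂ] Hilb.mod F →L[ℂ] P.space E F :=
        LinearMap.mkContinuous₂ ((TensorProduct.mk ℂ (Hilb.mod E) (Hilb.mod F)).compr₂
          (P.toSpace E F ∘ₗ (TensorProduct.mk ℂ _ H).flip h)) ‖h‖ fun x y =>
            (P.norm_toSpace_le x y h).trans_eq (by ring)
      refine hS.closure_subset (map_mem_closure₂ (f := fun x y => β x y) β.continuous₂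
        (Hilb.mem_closure_op E ξ) (Hilb.mem_closure_op F η) ?_)
      rintro _ ⟨s, rfl⟩ _ ⟨t, rfl⟩
      refine Submodule.le_topologicalClosure _ (Submodule.subset_span
        ⟨s ⊗ₜ[ℂ] t, P.toSpace E F ((ξ ⊗ₜ[ℂ] η) ⊗ₜ[ℂ] h), ?_⟩)
      rw [ext_toSpace, act_tmul]
      rfl

/-- The linear extension of the representation to `A ⊙ B`. -/
def lift : A ⊗[ℂ] B →ₗ[ℂ] (H →L[ℂ] H) := TensorProduct.lift P.map

variable (A) in
/-- The underlying space of the Hilbert module `A` is `A`. -/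
def _root_.CStarTensor.selfId : Hilb.mod (selfObj A) →ₗ[ℂ] A := (LinearMap.id : A →ₗ[ℂ] A)

/-- The map `(a ⊗ b) ⊗ h ↦ π(a ⊗ b) h`. -/
def eval : (Hilb.mod (selfObj A) ⊗[ℂ] Hilb.mod (selfObj B)) ⊗[ℂ] H →ₗ[ℂ] H :=
  TensorProduct.lift (ContinuousLinearMap.coeLM ℂ ∘ₗ
    TensorProduct.lift (P.map.compl₁₂ (selfId A) (selfId B)))

lemma eval_tmul (a : Hilb.mod (selfObj A)) (b : Hilb.mod (selfObj B)) (h : H) :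
    P.eval ((a ⊗ₜ[ℂ] b) ⊗ₜ[ℂ] h) = P.map (selfId A a) (selfId B b) h := rfl

/-- Inducing a representation of `A ⊙ B` does not change it on the object `(A, B)`: the canonical map
`(A ⊗ B) ⊗_π H → H` is isometric. -/
lemma norm_toSpace_self (z : (Hilb.mod (selfObj A) ⊗[ℂ] Hilb.mod (selfObj B)) ⊗[ℂ] H) :
    ‖P.toSpace (selfObj A) (selfObj B) z‖ = ‖P.eval z‖ := by
  have h : ∀ z z', inner ℂ (P.toSpace (selfObj A) (selfObj B) z)
      (P.toSpace (selfObj A) (selfObj B) z') = inner ℂ (P.eval z) (P.eval z') := by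
    intro z z'
    induction z with
    | zero => simp
    | add z z₁ e e' => simp only [map_add, inner_add_left, e, e']
    | tmul z h =>
      induction z with
      | zero => simp
      | add z z₁ e e' => simp only [TensorProduct.add_tmul, map_add, inner_add_left, e, e']
      | tmul a b =>
        induction z' with
        | zero => simp
        | add z z₁ e e' => simp only [map_add, inner_add_right, e, e']
        | tmul z h' =>
          induction z with
          | zero => simp
          | add z z₁ e e' => simp only [TensorProduct.add_tmul, map_add, inner_add_right, e, e']
          | tmul a' b' =>
            rw [inner_toSpace, eval_tmul, eval_tmul, P.inner_map_map]
            rfl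
  have h1 := h z z
  rw [inner_self_eq_norm_sq_to_K, inner_self_eq_norm_sq_to_K] at h1
  have h2 : ‖P.toSpace (selfObj A) (selfObj B) z‖ ^ 2 = ‖P.eval z‖ ^ 2 := by exact_mod_cast h1
  exact (sq_eq_sq₀ (norm_nonneg _) (norm_nonneg _)).mp h2

lemma eval_act (t : A ⊗[ℂ] B) (z : (Hilb.mod (selfObj A) ⊗[ℂ] Hilb.mod (selfObj B)) ⊗[ℂ] H) :
    P.eval (act H (TensorProduct.congr (lmul A) (lmul B) t) z) = P.lift t (P.eval z) := by
  induction t with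
  | zero => simp
  | add t t' h h' => simp only [map_add, LinearMap.add_apply, _root_.add_apply, h, h']
  | tmul a b =>
    induction z with
    | zero => simp
    | add z z' h h' => rw [map_add, map_add, h, h', map_add, map_add]
    | tmul z h =>
      induction z with
      | zero => simp
      | add z z' h h' => rw [TensorProduct.add_tmul, map_add, map_add, h, h', map_add, map_add]
      | tmul a' b' =>
        rw [TensorProduct.congr_tmul, act_tmul, eval_tmul, eval_tmul]
        exact congrArg (fun T => T h) (P.map_mul a (selfId A a') b (selfId B b'))

/-- The induced representation dominates the given one on `A ⊙ B`. -/
lemma norm_lift_le (hP : DenseRange P.eval) (t : A ⊗[ℂ] B) :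
    ‖P.lift t‖ ≤ ‖P.induce.map (X := (selfObj A, selfObj B)) (Y := (selfObj A, selfObj B))
      (TensorProduct.congr (lmul A) (lmul B) t)‖ := by
  change _ ≤ ‖P.ext (TensorProduct.congr (lmul A) (lmul B) t)‖
  refine ContinuousLinearMap.opNorm_le_bound _
    (norm_nonneg (P.ext (TensorProduct.congr (lmul A) (lmul B) t))) fun x => ?_
  refine hP.induction_on x (isClosed_le (by fun_prop) (by fun_prop)) fun z => ?_
  rw [← eval_act, ← norm_toSpace_self, ← norm_toSpace_self, ← ext_toSpace]
  exact ContinuousLinearMap.le_opNorm _ _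

lemma denseRange_eval (hP : (Submodule.span ℂ {ξ : H | ∃ (t : A ⊗[ℂ] B) (η : H),
    ξ = P.lift t η}).topologicalClosure = ⊤) : DenseRange P.eval := by
  have h : Submodule.span ℂ {ξ : H | ∃ (t : A ⊗[ℂ] B) (η : H), ξ = P.lift t η} ≤
      LinearMap.range P.eval := by
    refine Submodule.span_le.mpr ?_
    rintro _ ⟨t, η, rfl⟩
    induction t with
    | zero => simp
    | add t t' h h' =>
      rw [map_add, _root_.add_apply]
      exact add_mem h h'
    | tmul a b => exact ⟨(a ⊗ₜ[ℂ] b : Hilb.mod (selfObj A) ⊗[ℂ] Hilb.mod (selfObj B)) ⊗ₜ[ℂ] η, rfl⟩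
  intro x
  have hx : x ∈ (Submodule.span ℂ {ξ : H | ∃ (t : A ⊗[ℂ] B) (η : H),
    ξ = P.lift t η}).topologicalClosure := by rw [hP]; trivial
  exact closure_mono (SetLike.coe_subset_coe.mpr h) hx

end TensorRep

/-! ### The maximal norms -/

section maxNorm

variable {A : Type u} {B : Type v} [NonUnitalCStarAlgebra A] [NonUnitalCStarAlgebra B]

lemma TensorRep.norm_lift_le_maxNorm {H : Type max u v} [NormedAddCommGroup H]
    [InnerProductSpace ℂ H] [CompleteSpace H] (P : TensorRep A B H)
    (hP : (Submodule.span ℂ {ξ : H | ∃ (t : A ⊗[ℂ] B) (η : H),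
      ξ = P.lift t η}).topologicalClosure = ⊤) (t : A ⊗[ℂ] B) :
    ‖P.lift t‖ ≤ (maxNorm (Hilb A) (Hilb B)).N (X := (selfObj A, selfObj B))
      (Y := (selfObj A, selfObj B)) (TensorProduct.congr (lmul A) (lmul B) t) :=
  (P.norm_lift_le (P.denseRange_eval hP) t).trans <|
    le_ciSup (f := fun π : {π : Rep.{max (u + 1) (v + 1), max u v, max u v}
        (boxdot (Hilb A) (Hilb B)) // π.Nondegenerate} =>
      ‖π.1.map (X := (selfObj A, selfObj B)) (Y := (selfObj A, selfObj B))
        (TensorProduct.congr (lmul A) (lmul B) t)‖)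
      (Rep.bddAbove_norm (fun π : {π : Rep.{max (u + 1) (v + 1), max u v, max u v}
        (boxdot (Hilb A) (Hilb B)) // π.Nondegenerate} => π.1) _) ⟨P.induce, P.induce_nondegenerate⟩

lemma map_mul_of_map_mul {V₁ : CStarCat.{u₁, v₁}} {V₂ : CStarCat.{u₂, v₂}} {X₁ : V₁.Obj}
    {X₂ : V₂.Obj} {φ₁ : A →ₗ[ℂ] V₁.Hom X₁ X₁} {φ₂ : B →ₗ[ℂ] V₂.Hom X₂ X₂}
    (hm₁ : ∀ a b, φ₁ (a * b) = V₁.comp (φ₁ a) (φ₁ b))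
    (hm₂ : ∀ a b, φ₂ (a * b) = V₂.comp (φ₂ a) (φ₂ b)) (g f : A ⊗[ℂ] B) :
    TensorProduct.map φ₁ φ₂ (TensorProduct.map₂ (LinearMap.mul ℂ A) (LinearMap.mul ℂ B) g f) =
      TensorProduct.map₂ V₁.comp V₂.comp (TensorProduct.map φ₁ φ₂ g)
        (TensorProduct.map φ₁ φ₂ f) := by
  induction g with
  | zero => simp
  | add g g' e e' => simp only [map_add, LinearMap.add_apply, e, e']
  | tmul a b =>
    induction f with
    | zero => simp
    | add f f' e e' => simp only [map_add, e, e']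
    | tmul a' b' => exact congrArg₂ (fun x y => x ⊗ₜ[ℂ] y) (hm₁ a a') (hm₂ b b')

lemma map_star_of_map_star {V₁ : CStarCat.{u₁, v₁}} {V₂ : CStarCat.{u₂, v₂}} {X₁ : V₁.Obj}
    {X₂ : V₂.Obj} {φ₁ : A →ₗ[ℂ] V₁.Hom X₁ X₁} {φ₂ : B →ₗ[ℂ] V₂.Hom X₂ X₂}
    (hs₁ : ∀ a, φ₁ (star a) = V₁.adj (φ₁ a)) (hs₂ : ∀ a, φ₂ (star a) = V₂.adj (φ₂ a))
    (f : A ⊗[ℂ] B) :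
    TensorProduct.map φ₁ φ₂ (TensorProduct.map (starLinearEquiv ℂ (A := A)).toLinearMap
      (starLinearEquiv ℂ (A := B)).toLinearMap f) =
      TensorProduct.map V₁.adj V₂.adj (TensorProduct.map φ₁ φ₂ f) := by
  induction f with
  | zero => simp
  | add f f' e e' => simp only [map_add, e, e']
  | tmul a b => exact congrArg₂ (fun x y => x ⊗ₜ[ℂ] y) (hs₁ a) (hs₂ b)

/-- A representation of `V₁ ⊙ V₂` restricts to a representation of `A ⊙ B` if `A` and `B` are mapped
to endomorphism algebras. -/
def Rep.restrictPair {V₁ : CStarCat.{u₁, v₁}} {V₂ : CStarCat.{u₂, v₂}}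
    (π : Rep.{max u₁ u₂, max v₁ v₂, w} (boxdot V₁ V₂)) {X₁ : V₁.Obj} {X₂ : V₂.Obj}
    (φ₁ : A →ₗ[ℂ] V₁.Hom X₁ X₁) (φ₂ : B →ₗ[ℂ] V₂.Hom X₂ X₂)
    (hm₁ : ∀ a b, φ₁ (a * b) = V₁.comp (φ₁ a) (φ₁ b)) (hs₁ : ∀ a, φ₁ (star a) = V₁.adj (φ₁ a))
    (hm₂ : ∀ a b, φ₂ (a * b) = V₂.comp (φ₂ a) (φ₂ b)) (hs₂ : ∀ a, φ₂ (star a) = V₂.adj (φ₂ a)) :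
    Rep.{0, max u v, w} (boxdot (ofAlgebra A) (ofAlgebra B)) where
  H _ := π.H (X₁, X₂)
  normed _ := π.normed (X₁, X₂)
  inner _ := π.inner (X₁, X₂)
  complete _ := π.complete (X₁, X₂)
  map := π.map (X := (X₁, X₂)) (Y := (X₁, X₂)) ∘ₗ TensorProduct.map φ₁ φ₂
  map_comp g f := (congrArg (π.map (X := (X₁, X₂)) (Y := (X₁, X₂)))
    (map_mul_of_map_mul hm₁ hm₂ g f)).trans
      (π.map_comp (X := (X₁, X₂)) (Y := (X₁, X₂)) (Z := (X₁, X₂)) _ _)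
  map_adj f := (congrArg (π.map (X := (X₁, X₂)) (Y := (X₁, X₂)))
    (map_star_of_map_star hs₁ hs₂ f)).trans (π.map_adj (X := (X₁, X₂)) (Y := (X₁, X₂)) _)

lemma Rep.restrictPair_nondegenerate {V₁ : CStarCat.{u₁, v₁}} {V₂ : CStarCat.{u₂, v₂}}
    {π : Rep.{max u₁ u₂, max v₁ v₂, w} (boxdot V₁ V₂)} (hπ : π.Nondegenerate) {X₁ : V₁.Obj}
    {X₂ : V₂.Obj} {φ₁ : A →ₗ[ℂ] V₁.Hom X₁ X₁} {φ₂ : B →ₗ[ℂ] V₂.Hom X₂ X₂}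
    (hφ₁ : Function.Surjective φ₁) (hφ₂ : Function.Surjective φ₂)
    (hm₁ : ∀ a b, φ₁ (a * b) = V₁.comp (φ₁ a) (φ₁ b)) (hs₁ : ∀ a, φ₁ (star a) = V₁.adj (φ₁ a))
    (hm₂ : ∀ a b, φ₂ (a * b) = V₂.comp (φ₂ a) (φ₂ b)) (hs₂ : ∀ a, φ₂ (star a) = V₂.adj (φ₂ a)) :
    (π.restrictPair φ₁ φ₂ hm₁ hs₁ hm₂ hs₂).Nondegenerate := by
  intro _
  refine eq_top_iff.mpr ((hπ (X₁, X₂)).symm.le.trans (Submodule.topologicalClosure_mono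
    (Submodule.span_mono ?_)))
  rintro _ ⟨e, η, rfl⟩
  obtain ⟨e, rfl⟩ := TensorProduct.map_surjective hφ₁ hφ₂ e
  exact ⟨e, η, rfl⟩

/-- The representation of `V₁(X₁, X₁) ⊙ V₂(X₂, X₂)` contained in a representation of `V₁ ⊙ V₂`. -/
def Rep.tensorRep {V₁ : CStarCat.{u₁, v₁}} {V₂ : CStarCat.{u₂, v₂}}
    (π : Rep.{max u₁ u₂, max v₁ v₂, w} (boxdot V₁ V₂)) (X₁ : V₁.Obj) (X₂ : V₂.Obj) :
    TensorRep (V₁.End X₁) (V₂.End X₂) (π.H (X₁, X₂)) where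
  map := (TensorProduct.mk ℂ (V₁.Hom X₁ X₁) (V₂.Hom X₂ X₂)).compr₂
    (π.map (X := (X₁, X₂)) (Y := (X₁, X₂)))
  map_mul a a' b b' := π.map_comp (X := (X₁, X₂)) (Y := (X₁, X₂)) (Z := (X₁, X₂))
    (a ⊗ₜ[ℂ] b) (a' ⊗ₜ[ℂ] b')
  map_star a b := π.map_adj (X := (X₁, X₂)) (Y := (X₁, X₂)) (a ⊗ₜ[ℂ] b)

lemma Rep.tensorRep_lift {V₁ : CStarCat.{u₁, v₁}} {V₂ : CStarCat.{u₂, v₂}}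
    (π : Rep.{max u₁ u₂, max v₁ v₂, w} (boxdot V₁ V₂)) (X₁ : V₁.Obj) (X₂ : V₂.Obj)
    (t : V₁.Hom X₁ X₁ ⊗[ℂ] V₂.Hom X₂ X₂) :
    (π.tensorRep X₁ X₂).lift t = π.map (X := (X₁, X₂)) (Y := (X₁, X₂)) t := by
  induction t with
  | zero => exact (map_zero (π.tensorRep X₁ X₂).lift).trans (map_zero (π.map (X := (X₁, X₂)) (Y := (X₁, X₂)))).symm
  | add t t' h h' =>
    exact (map_add (π.tensorRep X₁ X₂).lift t t').trans
      ((congrArg₂ (· + ·) h h').trans (map_add (π.map (X := (X₁, X₂)) (Y := (X₁, X₂))) t t').symm)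
  | tmul a b => rfl

lemma Rep.Nondegenerate.tensorRep {V₁ : CStarCat.{u₁, v₁}} {V₂ : CStarCat.{u₂, v₂}}
    {π : Rep.{max u₁ u₂, max v₁ v₂, w} (boxdot V₁ V₂)} (hπ : π.Nondegenerate) (X₁ : V₁.Obj)
    (X₂ : V₂.Obj) : (Submodule.span ℂ {ξ : π.H (X₁, X₂) | ∃ (t : V₁.End X₁ ⊗[ℂ] V₂.End X₂)
      (η : π.H (X₁, X₂)), ξ = (π.tensorRep X₁ X₂).lift t η}).topologicalClosure = ⊤ := by
  refine eq_top_iff.mpr ((hπ (X₁, X₂)).symm.le.trans (Submodule.topologicalClosure_mono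
    (Submodule.span_mono ?_)))
  rintro _ ⟨e, η, rfl⟩
  exact ⟨e, η, congrArg (fun T => T η) (π.tensorRep_lift X₁ X₂ e).symm⟩

/-- The maximal norm on `Hilb_A ⊙ Hilb_B` extends the one on `A ⊙ B`. -/
lemma maxNorm_extends :
    (maxNorm (Hilb A) (Hilb B)).Extends (maxNorm (ofAlgebra A) (ofAlgebra B)) := by
  intro t
  refine le_antisymm (Real.iSup_le (fun π => ?_) (apply_nonneg _ _))
    (Real.iSup_le (fun π => ?_) (apply_nonneg _ _))
  · let π' := π.1.restrictPair (lmul A).toLinearMap (lmul B).toLinearMap lmul_mul lmul_star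
      lmul_mul lmul_star
    have h : π'.Nondegenerate := Rep.restrictPair_nondegenerate π.2 (lmul A).surjective
      (lmul B).surjective lmul_mul lmul_star lmul_mul lmul_star
    exact le_ciSup (f := fun π : {π : Rep.{0, max u v, max u v}
        (boxdot (ofAlgebra A) (ofAlgebra B)) // π.Nondegenerate} =>
      ‖π.1.map (X := ((), ())) (Y := ((), ())) t‖)
      (Rep.bddAbove_norm (fun π : {π : Rep.{0, max u v, max u v}
        (boxdot (ofAlgebra A) (ofAlgebra B)) // π.Nondegenerate} => π.1) _) ⟨π', h⟩
  · exact (congrArg norm (π.1.tensorRep_lift () () t)).symm.trans_le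
      (TensorRep.norm_lift_le_maxNorm (A := A) (B := B) (π.1.tensorRep () ())
        (π.2.tensorRep () ()) t)

end maxNorm

end CStarTensor

end

open CStarTensor in
theorem mainTheorem6
    (A : Type u) [NonUnitalCStarAlgebra A] (B : Type v) [NonUnitalCStarAlgebra B] :
    (∀ (ι₁ : Realisation.{u + 1, u, w₁} (Hilb A)) (ι₂ : Realisation.{v + 1, v, w₂} (Hilb B))
        (ρ : Realisation.{0, u, w₃} (ofAlgebra A)) (σ : Realisation.{0, v, w₄} (ofAlgebra B)),
      ∃ Φ : StarFunctor (boxtimes (minNorm ι₁ ι₂)) (Hilb (TensorAlgebra (minNorm ρ σ))),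
        Φ.IsEquivalence ∧ IsInducedByExteriorTensor (minNorm ι₁ ι₂) (minNorm ρ σ) Φ) ∧
    (∃ Φ : StarFunctor (boxtimes (maxNorm (Hilb A) (Hilb B)))
        (Hilb (TensorAlgebra (maxNorm (ofAlgebra A) (ofAlgebra B)))),
      Φ.IsEquivalence ∧
        IsInducedByExteriorTensor (maxNorm (Hilb A) (Hilb B))
          (maxNorm (ofAlgebra A) (ofAlgebra B)) Φ) :=
  ⟨fun ι₁ ι₂ ρ σ => exists_isEquivalence_of_extends (minNorm_isSubcross ι₁ ι₂)
      (minNorm_isSubcross ρ σ) (minNorm_extends ι₁ ι₂ ρ σ),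
    exists_isEquivalence_of_extends maxNorm_isSubcross maxNorm_isSubcross maxNorm_extends⟩
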